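/- **Lemma (Jensen-gap characterization).** Let $T>0$, $A,Q\in\mathbb R^{n\times n}$ with $Q\succeq 0$ symmetric, $H_j\in\mathbb R^{m_j\times n}$ and symmetric $R_j\succ0$ for $j=1,\dots,M$, and put $$g_j(P)=PH_j^\top(H_jPH_j^\top+R_j)^{-1}H_jP,\qquad S_j=H_j^\top R_j^{-1}H_j .$$ Let $\lambda=(\lambda_1,\dots,\lambda_M)$ be a deterministic schedule on $[0,T]$ whose components are measurable, essentially bounded and nonnegative almost everywhere. On a probability space let $N_1,\dots,N_M$ be independent Poisson processes on $[0,T]$ with rate functions $\lambda_j$, independent of a random matrix $P(0)$ with $P(0)\succ0$ a.s. Let $P$ be the covariance process of the continuous-discrete Kalman filter (CD-KF), i.e. the càdlàg solution on $[0,T]$ of $$dP(t)=\big(AP(t)+P(t)A^\top+Q\big)\,dt-\sum_{j=1}^M g_j(P(t^-))\,dN_j(t),$$ and let $Y(t)=P(t)^{-1}$ be the information process. Assume that $\mathbb E\big[\|Y(t)\|_F^2+\|P(t)\|_F\,\big|\,Y(0)\big]<\infty$ a.s. for every $t\in[0,T]$. Then the conditional means $\bar Y(t)=\mathbb E[Y(t)\mid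 Y(0)]$ and $\bar P(t)=\mathbb E[P(t)\mid P(0)]$, and the conditional means $\mathbb E[Y(t)QY(t)\mid Y(0)]$ and $\mathbb E[g_j(P(t))\mid P(0)]$, exist (as means under regular conditional laws), and they have versions for which, with the Jensen gaps $$\Delta_Y(t)=\mathbb E[Y(t)QY(t)\mid Y(0)]-\bar Y(t)Q\bar Y(t),\qquad \Delta_P(t)=\sum_{j=1}^M\lambda_j(t)\Big(\mathbb E[g_j(P(t))\mid P(0)]-g_j(\bar P(t))\Big),$$ the following holds almost surely: $t\mapsto\bar Y(t)$ and $t\mapsto\bar P(t)$ are absolutely continuous on $[0,T]$ and, for almost every $t\in[0,T]$, $$\dot{\bar Y}(t)=-\bar Y(t)A-A^\top\bar Y(t)-\bar Y(t)Q\bar Y(t)+\sum_{j=1}^M\lambda_j(t)S_j-\Delta_Y(t),$$ $$\dot{\bar P}(t)=A\bar P(t)+\bar P(t)A^\top+Q-\sum_{j=1}^M\lambda_j(t)g_j(\bar P(t))-\Delta_P(t);$$ moreover $\Delta_Y(t)\succeq0$ for every $t\in[0,T]$, and $\Delta_P(t)\succeq0$ for every $t\in[0,T]$ at which all $\lambda_j(t)\ge0$,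 hence for almost every $t$. -/

import Mathlib

open MeasureTheory ProbabilityTheory Filter Set
open scoped Topology Matrix

/-- The Kalman jump map `g(P) = P Hᵀ (H P Hᵀ + R)⁻¹ H P`: a measurement with observation matrix `H`
and noise covariance `R` replaces the error covariance `P` by `P - g(P)`. -/
noncomputable def jumpMap {n m : ℕ} (H : Matrix (Fin m) (Fin n) ℝ) (R : Matrix (Fin m) (Fin m) ℝ)
    (P : Matrix (Fin n) (Fin n) ℝ) : Matrix (Fin n) (Fin n) ℝ :=
  P * Hᵀ * (H * P * Hᵀ + R)⁻¹ * H * P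

/-- The information contribution `S = Hᵀ R⁻¹ H` of a measurement. -/
noncomputable def infoContribution {n m : ℕ} (H : Matrix (Fin m) (Fin n) ℝ)
    (R : Matrix (Fin m) (Fin m) ℝ) : Matrix (Fin n) (Fin n) ℝ :=
  Hᵀ * R⁻¹ * H

/-- An admissible deterministic schedule on `[0, T]`: each rate is measurable, essentially bounded
and nonnegative almost everywhere. -/
def IsSchedule {M : ℕ} (T : ℝ) (lam : Fin M → ℝ → ℝ) : Prop :=
  ∀ j, MemLp (lam j) ⊤ (volume.restrict (Icc 0 T)) ∧
    ∀ᵐ t ∂volume.restrict (Icc 0 T), 0 ≤ lam j t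

/-- `N` is an (inhomogeneous) Poisson process on `[0, T]` with rate function `rate`: it starts at
`0`, has nondecreasing right-continuous paths, independent increments, and its increment over
`(s, t]` is Poisson distributed with mean `∫_s^t rate`. -/
structure IsPoissonProcess {Ω : Type*} [MeasurableSpace Ω] (μ : Measure Ω) (T : ℝ) (rate : ℝ → ℝ)
    (N : ℝ → Ω → ℕ) : Prop where
  measurable : ∀ t ∈ Icc 0 T, Measurable (N t)
  zero : ∀ᵐ ω ∂μ, N 0 ω = 0
  monotone : ∀ᵐ ω ∂μ, MonotoneOn (fun t => N t ω) (Icc 0 T)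
  rightCont : ∀ᵐ ω ∂μ, ∀ t ∈ Ico 0 T, ContinuousWithinAt (fun s => N s ω) (Ici t) t
  indep : HasIndepIncrements (fun t : Icc (0 : ℝ) T => N t) μ
  law : ∀ s ∈ Icc 0 T, ∀ t ∈ Icc 0 T, s ≤ t →
    μ.map (fun ω => N t ω - N s ω) = poissonMeasure (∫ u in s..t, rate u).toNNReal

/-- The jump `k(s) - k(s-)` at time `s` of a counting path `k`. -/
noncomputable def countJump (k : ℝ → ℕ) (s : ℝ) : ℕ := k s - Function.leftLim k s

/-- The path `p` is càdlàg on `[0, T]` and solves the error covariance equation of the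
continuous-discrete Kalman filter driven by the counting paths `k j`,
`dp = (A p + p Aᵀ + Q) dt - ∑ j, g_j(p(t-)) dk_j`, in integrated form. -/
structure IsCovariancePath {n M : ℕ} {m : Fin M → ℕ} (T : ℝ) (A Q : Matrix (Fin n) (Fin n) ℝ)
    (H : ∀ j, Matrix (Fin (m j)) (Fin n) ℝ) (R : ∀ j, Matrix (Fin (m j)) (Fin (m j)) ℝ)
    (k : Fin M → ℝ → ℕ) (p : ℝ → Matrix (Fin n) (Fin n) ℝ) : Prop where
  rightCont : ∀ t ∈ Ico 0 T, ContinuousWithinAt p (Ici t) t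
  leftLimit : ∀ t ∈ Ioc 0 T, ∃ l, Tendsto p (𝓝[<] t) (𝓝 l)
  equation : ∀ t ∈ Icc 0 T,
    p t = p 0 + Matrix.of (fun a b => ∫ s in (0 : ℝ)..t, (A * p s + p s * Aᵀ + Q) a b)
      - ∑ j, ∑ᶠ s ∈ Ioc 0 t, (countJump (k j) s : ℝ) • jumpMap (H j) (R j) (Function.leftLim p s)

/-- The Frobenius norm. -/
noncomputable def frobNorm {n : ℕ} (X : Matrix (Fin n) (Fin n) ℝ) : ℝ :=
  √(∑ a, ∑ b, X a b ^ 2)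

/-- `E[X ∣ Z] < ∞` almost surely, for a nonnegative random variable `X`; the expectation is taken
under the regular conditional law of `X` given `Z`. -/
def CondMeanFinite {Ω β : Type*} [MeasurableSpace Ω] [MeasurableSpace β] (μ : Measure Ω)
    [IsFiniteMeasure μ] (X : Ω → ℝ) (Z : Ω → β) : Prop :=
  ∀ᵐ ω ∂μ, ∫⁻ x, ENNReal.ofReal x ∂(condDistrib X Z μ (Z ω)) < ⊤

/-- `C` is a version of the conditional mean `E[X ∣ Z]` of the random matrix `X`: it is
`σ(Z)`-measurable and, almost surely, every entry of `X` is integrable under its regular conditional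
law given `Z`, with mean the corresponding entry of `C`. If the entries of `X` are integrable, this
is the usual conditional expectation; in general only conditional integrability is required. -/
def IsCondMean {Ω β : Type*} [MeasurableSpace Ω] [mβ : MeasurableSpace β] {n : ℕ} (μ : Measure Ω)
    [IsFiniteMeasure μ] (X : Ω → Matrix (Fin n) (Fin n) ℝ) (Z : Ω → β)
    (C : Ω → Matrix (Fin n) (Fin n) ℝ) : Prop :=
  ∀ a b, Measurable[mβ.comap Z] (fun ω => C ω a b) ∧
    ∀ᵐ ω ∂μ, Integrable (fun x : ℝ => x) (condDistrib (fun ω' => X ω' a b) Z μ (Z ω)) ∧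
      C ω a b = ∫ x, x ∂(condDistrib (fun ω' => X ω' a b) Z μ (Z ω))

/-- `X` solves `Ẋ(t) = V(t)` on `[0, T]` in the sense of Carathéodory: `X` is absolutely continuous
and has derivative `V t` at almost every `t`. -/
def SolvesODE {n : ℕ} (T : ℝ) (X V : ℝ → Matrix (Fin n) (Fin n) ℝ) : Prop :=
  (∀ a b, AbsolutelyContinuousOnInterval (fun t => X t a b) 0 T) ∧
    ∀ᵐ t ∂volume.restrict (Icc 0 T), HasDerivAt X (V t) t

/-- The Jensen gap of `Y ↦ Y Q Y`, where `second` is the mean of `Y Q Y` and `mean` that of `Y`. -/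
def infoJensenGap {n : ℕ} (Q second mean : Matrix (Fin n) (Fin n) ℝ) : Matrix (Fin n) (Fin n) ℝ :=
  second - mean * Q * mean

/-- The Jensen gap of the jump maps at rates `rate j`, where `gmean j` is the mean of `g_j(P)` and
`mean` that of `P`. -/
noncomputable def covJensenGap {n M : ℕ} {m : Fin M → ℕ} (H : ∀ j, Matrix (Fin (m j)) (Fin n) ℝ)
    (R : ∀ j, Matrix (Fin (m j)) (Fin (m j)) ℝ) (rate : Fin M → ℝ)
    (gmean : Fin M → Matrix (Fin n) (Fin n) ℝ) (mean : Matrix (Fin n) (Fin n) ℝ) :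
    Matrix (Fin n) (Fin n) ℝ :=
  ∑ j, rate j • (gmean j - jumpMap (H j) (R j) mean)

/-! The proof works path by path, then averages over the Poisson noise for a frozen initial value,
and finally conditions.

Pathwise, the Woodbury identity `P - g_j(P) = (P⁻¹ + S_j)⁻¹` (`sub_jumpMap_eq_inv`) turns a
measurement into the addition of the constant `S_j` to `Y = P⁻¹`, and between measurements the
Lyapunov equation for `P` becomes a Riccati equation for `Y`. So `Y(t) = Y(0) + ∫ infoDrift(Y) ds +
∑ N_j(t) S_j`, provided that no two processes jump together: a simultaneous jump would subtract
`g_i(P) + g_j(P)`, which is not an addition of information. Independent Poisson processes almost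
surely have no such jumps (`ae_simple_jumps`). The information equation has a unique solution, and a
linear Hamiltonian system with `P = U V⁻¹` constructs it for all times
(`isInfoPath_inv_covSolution`); its Picard series makes `P(t)` a measurable function of `P(0)` and
the counting paths. Trace estimates bound `P` by a constant uniform in the measurement history and
`‖Y‖` linearly in the number of measurements, so for a fixed initial value all expectations needed
are finite.

For a fixed initial value, the mean of `Y` is obtained by averaging the integral equation, because
the noise enters with constant coefficients (`mean_information_eq`). For `P` the jump size depends
on the state. No stochastic integral is used: `exists_increment_estimate` expands the increment over
`(s, t]` with jumps evaluated at time `s`, up to an error whose mean is `O((t - s)²)`; the increment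
`N_j(t) - N_j(s)` is independent of `P(s)`, so the mean jump term factors
(`mean_increment_estimate`). `eq_add_integral_of_increment_le` sums such increments into an integral
equation, although the rates are merely measurable.

The gap for `Y` is `E[(Y - Ȳ) Q (Y - Ȳ)]`. The gap for `P` is positive because, in the Loewner
order, `g_j` is the maximum of affine maps indexed by a gain `K`, attained at the Kalman gain:
choosing the gain of the mean proves Jensen's inequality (`integral_jumpMap_sub_posSemidef`).

Since `P(0)` is independent of the noise, the regular conditional law given `P(0)`, or given `Y(0) =
P(0)⁻¹`, is the law of the solution started from the frozen value (`isCondMean_of_indepFun`), which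
transfers everything to the conditional means. -/

/-! ### Right derivatives and induction on an interval -/

section RealLine

/-- Induction along a compact real interval. -/
theorem Icc_induction {a b : ℝ} {p : ℝ → Prop} (ha : a ≤ b → p a)
    (hr : ∀ t ∈ Ico a b, (∀ s ∈ Icc a t, p s) → ∃ u > t, ∀ s ∈ Ioo t u, s ≤ b → p s)
    (hl : ∀ t ∈ Ioc a b, (∀ s ∈ Ico a t, p s) → p t) : ∀ t ∈ Icc a b, p t := by
  by_contra hcon
  push Not at hcon
  obtain ⟨t₀, ht₀, hpt₀⟩ := hcon
  set B : Set ℝ := {t | t ∈ Icc a b ∧ ¬ p t} with hB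
  have hBne : B.Nonempty := ⟨t₀, ht₀, hpt₀⟩
  have hBbdd : BddBelow B := ⟨a, fun x hx => hx.1.1⟩
  set c := sInf B with hc
  have hac : a ≤ c := le_csInf hBne fun x hx => hx.1.1
  have hct : c ≤ t₀ := csInf_le hBbdd ⟨ht₀, hpt₀⟩
  have hlt : ∀ s ∈ Ico a c, p s := fun s hs => by
    by_contra h
    exact absurd (csInf_le hBbdd ⟨⟨hs.1, (hs.2.trans_le hct).le.trans ht₀.2⟩, h⟩) (not_le.2 hs.2)
  have hpc : p c := by
    rcases eq_or_lt_of_le hac with h | h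
    · rw [← h]; exact ha (ht₀.1.trans ht₀.2)
    · exact hl c ⟨h, hct.trans ht₀.2⟩ hlt
  have hcb : c < b := by
    rcases lt_or_eq_of_le (hct.trans ht₀.2) with h | h
    · exact h
    · have : t₀ = c := le_antisymm (h ▸ ht₀.2) hct
      exact absurd hpc (this ▸ hpt₀)
  obtain ⟨u, huc, hu⟩ := hr c ⟨hac, hcb⟩ fun s hs => by
    rcases lt_or_eq_of_le hs.2 with h | h
    · exact hlt s ⟨hs.1, h⟩
    · exact h ▸ hpc
  obtain ⟨x, hx, hxu⟩ := exists_lt_of_csInf_lt hBne huc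
  have hcx : c ≤ x := csInf_le hBbdd hx
  rcases lt_or_eq_of_le hcx with h | h
  · exact hx.2 (hu x ⟨h, hxu⟩ hx.1.2)
  · exact hx.2 (h ▸ hpc)

variable {E : Type*} [NormedAddCommGroup E] [NormedSpace ℝ E]

/-- The fundamental theorem of calculus for right derivatives, in primitive form. -/
theorem hasDerivWithinAt_Ici_of_eq_integral {a b t : ℝ} {f F : ℝ → E} [CompleteSpace E]
    (hf : IntervalIntegrable f volume a b) (ht : t ∈ Ico a b)
    (hF : ∀ s ∈ Icc a b, F s = F a + ∫ r in a..s, f r)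
    (hc : ContinuousWithinAt f (Ioi t) t) (hm : AEStronglyMeasurable f (volume.restrict (Icc a b))) :
    HasDerivWithinAt F (f t) (Ici t) t := by
  have hab : a ≤ b := ht.1.trans ht.2.le
  have h1 : HasDerivWithinAt (fun s => ∫ r in a..s, f r) (f t) (Ici t) t := by
    refine intervalIntegral.integral_hasDerivWithinAt_right (t := Ioi t) ?_ ?_ hc
    · exact hf.mono_set (by rw [uIcc_of_le ht.1, uIcc_of_le hab]; exact Icc_subset_Icc_right ht.2.le)
    · refine ⟨Ioc t b, Ioc_mem_nhdsGT ht.2, hm.mono_measure (Measure.restrict_mono ?_ le_rfl)⟩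
      exact Ioc_subset_Icc_self.trans (Icc_subset_Icc_left ht.1)
  have h2 := h1.const_add (F a)
  refine h2.congr_of_eventuallyEq ?_ (hF t ⟨ht.1, ht.2.le⟩)
  filter_upwards [Ico_mem_nhdsGE ht.2] with s hs
  exact hF s ⟨ht.1.trans hs.1, hs.2.le⟩

theorem eq_add_integral_of_hasDerivWithinAt_Ici [CompleteSpace E] {a b : ℝ} {F f : ℝ → E}
    (hF : ContinuousOn F (Icc a b)) (hd : ∀ t ∈ Ico a b, HasDerivWithinAt F (f t) (Ici t) t)
    (hf : IntervalIntegrable f volume a b) {t : ℝ} (ht : t ∈ Icc a b) :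
    F t = F a + ∫ s in a..t, f s := by
  have hab : a ≤ b := ht.1.trans ht.2
  rw [intervalIntegral.integral_eq_sub_of_hasDeriv_right]
  · abel
  · rw [uIcc_of_le ht.1]; exact hF.mono (Icc_subset_Icc_right ht.2)
  · rw [min_eq_left ht.1, max_eq_right ht.1]
    intro x hx
    exact (hd x ⟨hx.1.le, hx.2.trans_le ht.2⟩).mono Ioi_subset_Ici_self
  · exact hf.mono_set (by rw [uIcc_of_le ht.1, uIcc_of_le hab]; exact Icc_subset_Icc_right ht.2)

theorem le_of_hasDerivWithinAt_Ici_nonneg {a b : ℝ} {F f : ℝ → ℝ}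
    (hF : ContinuousOn F (Icc a b)) (hd : ∀ t ∈ Ico a b, HasDerivWithinAt F (f t) (Ici t) t)
    (hf : ∀ t ∈ Ico a b, f t ≤ 0) {t : ℝ} (ht : t ∈ Icc a b) : F t ≤ F a :=
  image_le_of_deriv_right_le_deriv_boundary (B := fun _ => F a) (B' := fun _ => 0) hF hd le_rfl
    continuousOn_const (fun _ _ => hasDerivWithinAt_const _ _ _) hf ht

end RealLine

/-! ### Measurability and boundedness of càdlàg paths -/

section Cadlag

/-- The right end of the cell of length `1 / (k + 1)` containing `s`, projected to `[0, T]`. -/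
noncomputable def gridCeil (T : ℝ) (k : ℕ) (s : ℝ) : ℝ :=
  max 0 (min T (((⌊((k : ℝ) + 1) * s⌋ : ℝ) + 1) / ((k : ℝ) + 1)))

theorem le_gridCeil {T : ℝ} (k : ℕ) {s : ℝ} (hs : s ≤ T) : s ≤ gridCeil T k s := by
  refine le_max_of_le_right (le_min hs ?_)
  rw [le_div_iff₀ (by positivity), mul_comm]
  exact (Int.lt_floor_add_one _).le

theorem tendsto_gridCeil {T s : ℝ} (h0 : 0 ≤ s) (hs : s ≤ T) :
    Tendsto (fun k => gridCeil T k s) atTop (𝓝[≥] s) := by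
  refine tendsto_nhdsWithin_iff.2 ⟨?_, Eventually.of_forall fun k => le_gridCeil k hs⟩
  have h1 : Tendsto (fun k : ℕ => s + 1 / ((k : ℝ) + 1)) atTop (𝓝 s) := by
    simpa using (tendsto_const_nhds (x := s)).add (tendsto_one_div_add_atTop_nhds_zero_nat (𝕜 := ℝ))
  refine tendsto_of_tendsto_of_tendsto_of_le_of_le tendsto_const_nhds h1
    (fun k => le_gridCeil k hs) fun k => ?_
  have hk : (0 : ℝ) < (k : ℝ) + 1 := by positivity
  refine max_le (by positivity) ((min_le_right _ _).trans ?_)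
  have h2 : (s + 1 / ((k : ℝ) + 1)) * ((k : ℝ) + 1) = ((k : ℝ) + 1) * s + 1 := by field_simp
  rw [div_le_iff₀ hk, h2]
  linarith [Int.floor_le (((k : ℝ) + 1) * s)]

variable {Ω E : Type*} [mΩ : MeasurableSpace Ω] {μ : Measure Ω}
  [NormedAddCommGroup E]

/-- A process with right-continuous paths is jointly measurable. -/
theorem aestronglyMeasurable_uncurry_of_rightCont {T : ℝ} (hT : 0 ≤ T) {X : ℝ → Ω → E}
    (hX : ∀ t ∈ Icc 0 T, AEStronglyMeasurable (X t) μ)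
    (hc : ∀ᵐ ω ∂μ, ∀ t ∈ Ico 0 T, ContinuousWithinAt (fun s => X s ω) (Ici t) t) :
    AEStronglyMeasurable (fun q : ℝ × Ω => X q.1 q.2) ((volume.restrict (Icc 0 T)).prod μ) := by
  refine aestronglyMeasurable_of_tendsto_ae atTop
    (f := fun k (q : ℝ × Ω) => X (gridCeil T k q.1) q.2) (fun k => ?_) ?_
  -- On each of these countably many strips the sampled time is constant, so the approximant depends
  -- on `ω` only.
  · have hcov : (⋃ i : ℤ, {q : ℝ × Ω | ⌊((k : ℝ) + 1) * q.1⌋ = i}) = univ :=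
      eq_univ_of_forall fun q => mem_iUnion.2 ⟨_, rfl⟩
    rw [← Measure.restrict_univ (μ := (volume.restrict (Icc 0 T)).prod μ), ← hcov,
      aestronglyMeasurable_iUnion_iff]
    intro i
    have hset : MeasurableSet {q : ℝ × Ω | ⌊((k : ℝ) + 1) * q.1⌋ = i} :=
      (Int.measurable_floor.comp (measurable_const.mul measurable_fst)) (measurableSet_singleton i)
    have h1 : AEStronglyMeasurable
        (fun q : ℝ × Ω => X (max 0 (min T (((i : ℝ) + 1) / ((k : ℝ) + 1)))) q.2)
        ((volume.restrict (Icc 0 T)).prod μ) :=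
      (hX _ ⟨le_max_left _ _, max_le hT (min_le_left _ _)⟩).comp_snd
    refine (h1.mono_measure Measure.restrict_le_self).congr ?_
    filter_upwards [ae_restrict_mem hset] with q hq
    have hq' : ⌊((k : ℝ) + 1) * q.1⌋ = i := hq
    simp only [gridCeil, hq']
  -- Right continuity is available on `[0, T)` only; the slice at time `T` is null.
  · have h1 : ∀ᵐ q ∂((volume.restrict (Icc 0 T)).prod μ), q.1 ∈ Icc 0 T ∧ q.1 ≠ T := by
      have h0 : ∀ᵐ s ∂(volume.restrict (Icc 0 T)), s ∈ Icc 0 T ∧ s ≠ T :=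
        (ae_restrict_mem measurableSet_Icc).and
          (ae_restrict_of_ae (by simp [ae_iff, measure_singleton]))
      exact Measure.quasiMeasurePreserving_fst.ae h0
    have h2 : ∀ᵐ q ∂((volume.restrict (Icc 0 T)).prod μ),
        ∀ t ∈ Ico 0 T, ContinuousWithinAt (fun s => X s q.2) (Ici t) t :=
      Measure.quasiMeasurePreserving_snd.ae hc
    filter_upwards [h1, h2] with q hq hq2
    exact (hq2 q.1 ⟨hq.1.1, lt_of_le_of_ne hq.1.2 hq.2⟩).tendsto.comp
      (tendsto_gridCeil hq.1.1 hq.1.2)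

/-- A deterministic path is a process over a one-point probability space, so joint measurability
specializes to it. -/
theorem aestronglyMeasurable_of_rightCont {T : ℝ} (hT : 0 ≤ T) {f : ℝ → E}
    (hc : ∀ t ∈ Ico 0 T, ContinuousWithinAt f (Ici t) t) :
    AEStronglyMeasurable f (volume.restrict (Icc 0 T)) := by
  have h := aestronglyMeasurable_uncurry_of_rightCont (μ := Measure.dirac ()) hT
    (X := fun t (_ : Unit) => f t) (fun t _ => aestronglyMeasurable_const)
    (Eventually.of_forall fun _ => hc)
  have h2 := h.prod_swap.prodMk_left
  rw [ae_dirac_eq] at h2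
  exact h2

/-- Boundedness on `[a, t]` propagates along the interval: right continuity carries it past `t`, and
the left limit controls the last stretch before `t`. -/
theorem exists_bound_of_cadlag {a b : ℝ} {f : ℝ → E}
    (hc : ∀ t ∈ Ico a b, ContinuousWithinAt f (Ici t) t)
    (hl : ∀ t ∈ Ioc a b, ∃ l, Tendsto f (𝓝[<] t) (𝓝 l)) : ∃ C, ∀ t ∈ Icc a b, ‖f t‖ ≤ C := by
  rcases lt_or_ge b a with h | hab
  · exact ⟨0, fun t ht => absurd (ht.1.trans ht.2) (not_le.2 h)⟩
  refine Icc_induction (a := a) (b := b) (p := fun t => ∃ C, ∀ s ∈ Icc a t, ‖f s‖ ≤ C)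
    (fun _ => ⟨‖f a‖, fun s hs => by rw [le_antisymm hs.2 hs.1]⟩) ?_ ?_ b ⟨hab, le_rfl⟩
  · intro t ht hp
    obtain ⟨C, hC⟩ := hp t ⟨ht.1, le_rfl⟩
    have h1 : ∀ᶠ s in 𝓝[≥] t, ‖f s‖ < ‖f t‖ + 1 :=
      (hc t ht).norm.eventually_lt tendsto_const_nhds (lt_add_one _)
    obtain ⟨u, hu, hsub⟩ := mem_nhdsGE_iff_exists_Ico_subset.1 h1
    refine ⟨u, hu, fun s hs _ => ⟨max C (‖f t‖ + 1), fun r hr => ?_⟩⟩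
    rcases le_total r t with h | h
    · exact le_max_of_le_left (hC r ⟨hr.1, h⟩)
    · exact le_max_of_le_right (hsub ⟨h, hr.2.trans_lt hs.2⟩ : ‖f r‖ < _).le
  · intro t ht hp
    obtain ⟨l, hl⟩ := hl t ht
    have h1 : ∀ᶠ s in 𝓝[<] t, ‖f s‖ < ‖l‖ + 1 := hl.norm.eventually_lt tendsto_const_nhds
      (lt_add_one _)
    obtain ⟨u, hu, hsub⟩ := (mem_nhdsLT_iff_exists_mem_Ico_Ioo_subset ht.1).1 h1
    have hv : (u + t) / 2 ∈ Ico a t := ⟨by linarith [hu.1, hu.2], by linarith [hu.1, hu.2]⟩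
    obtain ⟨C, hC⟩ := hp _ hv
    refine ⟨max (max C ‖f t‖) (‖l‖ + 1), fun r hr => ?_⟩
    rcases le_total r ((u + t) / 2) with h | h
    · exact le_max_of_le_left (le_max_of_le_left (hC r ⟨hr.1, h⟩))
    rcases eq_or_lt_of_le hr.2 with h' | h'
    · exact le_max_of_le_left (le_max_of_le_right (h' ▸ le_rfl))
    · exact le_max_of_le_right (hsub ⟨by linarith [hu.2], h'⟩ : ‖f r‖ < _).le

theorem intervalIntegrable_of_cadlag {T : ℝ} (hT : 0 ≤ T) {f : ℝ → E}
    (hc : ∀ t ∈ Ico 0 T, ContinuousWithinAt f (Ici t) t)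
    (hl : ∀ t ∈ Ioc 0 T, ∃ l, Tendsto f (𝓝[<] t) (𝓝 l)) : IntervalIntegrable f volume 0 T := by
  obtain ⟨C, hC⟩ := exists_bound_of_cadlag hc hl
  rw [intervalIntegrable_iff_integrableOn_Icc_of_le hT]
  refine Integrable.mono' (integrable_const C) (aestronglyMeasurable_of_rightCont hT hc) ?_
  filter_upwards [ae_restrict_mem measurableSet_Icc] with t ht using hC t ht

end Cadlag

/-! ### Positive semidefinite matrices, norms and inverses -/

section MatrixTools

open scoped Matrix.Norms.L2Operator

variable {n : ℕ}

/-- Square real matrices. -/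
abbrev RMat (n : ℕ) := Matrix (Fin n) (Fin n) ℝ

theorem posSemidef_iff_real {M : RMat n} :
    M.PosSemidef ↔ Mᵀ = M ∧ ∀ x : Fin n → ℝ, 0 ≤ x ⬝ᵥ M *ᵥ x := by
  rw [Matrix.posSemidef_iff_dotProduct_mulVec]
  simp [Matrix.IsHermitian]

theorem Matrix.PosSemidef.transpose_eq {m : Type*} {M : Matrix m m ℝ} (h : M.PosSemidef) :
    Mᵀ = M := by
  simpa [Matrix.IsHermitian] using h.1

theorem Matrix.PosDef.transpose_eq {m : Type*} {M : Matrix m m ℝ} (h : M.PosDef) : Mᵀ = M :=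
  h.posSemidef.transpose_eq

theorem Matrix.PosDef.isUnit_det' {m : ℕ} {M : RMat m} (h : M.PosDef) : IsUnit M.det :=
  (Matrix.isUnit_iff_isUnit_det M).1 h.isUnit

theorem Matrix.PosSemidef.transpose_mul_mul {m k : Type*} [Fintype m] [Fintype k]
    {M : Matrix m m ℝ} (h : M.PosSemidef) (B : Matrix m k ℝ) : (Bᵀ * M * B).PosSemidef := by
  simpa using h.conjTranspose_mul_mul_same B

theorem Matrix.PosSemidef.mul_mul_transpose {m k : Type*} [Fintype m] [Fintype k]
    {M : Matrix m m ℝ} (h : M.PosSemidef) (B : Matrix k m ℝ) : (B * M * Bᵀ).PosSemidef := by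
  simpa using h.mul_mul_conjTranspose_same B

/-- The entry `(a, b)` as a continuous linear map. -/
noncomputable def entryCLM (a b : Fin n) : RMat n →L[ℝ] ℝ :=
  LinearMap.toContinuousLinearMap (Matrix.entryLinearMap ℝ ℝ a b)

@[simp] theorem entryCLM_apply (a b : Fin n) (M : RMat n) : entryCLM a b M = M a b := rfl

/-- The trace as a continuous linear map. -/
noncomputable def traceCLM (n : ℕ) : RMat n →L[ℝ] ℝ :=
  LinearMap.toContinuousLinearMap (Matrix.traceLinearMap (Fin n) ℝ ℝ)

@[simp] theorem traceCLM_apply (M : RMat n) : traceCLM n M = M.trace := rfl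

/-- A constant that bounds the operator norm by the entries. -/
noncomputable def entryConst (n : ℕ) : ℝ :=
  ∑ a : Fin n, ∑ b : Fin n, ‖(Matrix.single a b 1 : RMat n)‖

theorem entryConst_nonneg (n : ℕ) : 0 ≤ entryConst n := by unfold entryConst; positivity

theorem norm_le_of_forall_entry {M : RMat n} {c : ℝ} (h : ∀ a b, |M a b| ≤ c) :
    ‖M‖ ≤ entryConst n * c := by
  conv_lhs => rw [Matrix.matrix_eq_sum_single M]
  rw [entryConst, Finset.sum_mul]
  refine (norm_sum_le _ _).trans (Finset.sum_le_sum fun a _ => ?_)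
  rw [Finset.sum_mul]
  refine (norm_sum_le _ _).trans (Finset.sum_le_sum fun b _ => ?_)
  have : (Matrix.single a b (M a b) : RMat n) = M a b • Matrix.single a b 1 := by
    rw [Matrix.smul_single, smul_eq_mul, mul_one]
  rw [this, norm_smul, mul_comm, Real.norm_eq_abs]
  exact mul_le_mul_of_nonneg_left (h a b) (norm_nonneg _)

theorem abs_trace_le (M : RMat n) : |M.trace| ≤ ‖traceCLM n‖ * ‖M‖ :=
  (traceCLM n).le_opNorm M

/-- Testing the quadratic form on `e_a ± e_b` gives `2|M a b| ≤ M a a + M b b`, and each diagonal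
entry is at most the trace. Through this bound all norm estimates reduce to trace estimates. -/
theorem Matrix.PosSemidef.abs_entry_le_trace {M : RMat n} (h : M.PosSemidef) (a b : Fin n) :
    |M a b| ≤ M.trace := by
  have hd : ∀ i, 0 ≤ M i i := fun i => h.diag_nonneg
  have htr : ∀ i, M i i ≤ M.trace := fun i =>
    Finset.single_le_sum (f := fun i => M i i) (fun i _ => hd i) (Finset.mem_univ i)
  have hs : M b a = M a b := congrFun (congrFun h.transpose_eq a) b
  have key : ∀ c : ℝ, 0 ≤ M a a + c * M a b + c * (M b a + c * M b b) := fun c => by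
    have := (posSemidef_iff_real.1 h).2 (Pi.single a 1 + c • Pi.single b 1)
    simp only [Matrix.mulVec_add, Matrix.mulVec_smul, add_dotProduct, smul_dotProduct,
      dotProduct_add, dotProduct_smul, Matrix.mulVec_single_one, single_one_dotProduct,
      smul_eq_mul, Matrix.col_apply] at this
    linarith
  have h1 := key 1
  have h2 := key (-1)
  rw [abs_le]
  constructor <;> linarith [htr a, htr b]

theorem Matrix.PosSemidef.norm_le_trace {M : RMat n} (h : M.PosSemidef) : ‖M‖ ≤ entryConst n * M.trace :=
  norm_le_of_forall_entry h.abs_entry_le_trace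

theorem norm_le_of_posSemidef_sub {M N : RMat n} (hM : M.PosSemidef) (h : (N - M).PosSemidef) :
    ‖M‖ ≤ entryConst n * N.trace := by
  refine hM.norm_le_trace.trans (mul_le_mul_of_nonneg_left ?_ (entryConst_nonneg n))
  have := h.trace_nonneg
  rw [Matrix.trace_sub] at this
  linarith

theorem posSemidef_of_tendsto {ι : Type*} {l : Filter ι} [l.NeBot] {F : ι → RMat n} {M : RMat n}
    (h : Tendsto F l (𝓝 M)) (hF : ∀ᶠ i in l, (F i).PosSemidef) : M.PosSemidef := by
  rw [posSemidef_iff_real]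
  constructor
  · have h1 : Tendsto (fun i => (F i)ᵀ) l (𝓝 Mᵀ) :=
      ((continuous_id.matrix_transpose).tendsto M).comp h
    refine tendsto_nhds_unique (h1.congr' ?_) h
    filter_upwards [hF] with i hi using hi.transpose_eq
  · intro x
    have h1 : Tendsto (fun i => x ⬝ᵥ F i *ᵥ x) l (𝓝 (x ⬝ᵥ M *ᵥ x)) :=
      ((continuous_const.dotProduct (continuous_id.matrix_mulVec continuous_const)).tendsto M).comp h
    refine ge_of_tendsto h1 ?_
    filter_upwards [hF] with i hi using (posSemidef_iff_real.1 hi).2 x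

theorem posSemidef_integral {α : Type*} [MeasurableSpace α] {ν : Measure α} {F : α → RMat n}
    (hi : Integrable F ν) (hF : ∀ᵐ x ∂ν, (F x).PosSemidef) : (∫ x, F x ∂ν).PosSemidef := by
  have hlin : ∀ L : RMat n →L[ℝ] ℝ, L (∫ x, F x ∂ν) = ∫ x, L (F x) ∂ν :=
    fun L => (L.integral_comp_comm hi).symm
  have hent : ∀ a b, (∫ x, F x ∂ν) a b = ∫ x, F x a b ∂ν := fun a b =>
    hlin (entryCLM a b)
  rw [posSemidef_iff_real]
  constructor
  · ext a b
    rw [Matrix.transpose_apply, hent, hent]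
    refine integral_congr_ae ?_
    filter_upwards [hF] with x hx using congrFun (congrFun hx.transpose_eq a) b
  · intro x
    have := hlin (LinearMap.toContinuousLinearMap
      { toFun := fun M => x ⬝ᵥ M *ᵥ x
        map_add' := fun M N => by simp [Matrix.add_mulVec]
        map_smul' := fun c M => by simp [Matrix.smul_mulVec] })
    simp only [LinearMap.coe_toContinuousLinearMap', LinearMap.coe_mk, AddHom.coe_mk] at this
    rw [this]
    refine integral_nonneg_of_ae ?_
    filter_upwards [hF] with y hy using (posSemidef_iff_real.1 hy).2 x

theorem integral_matrix_apply {α : Type*} [MeasurableSpace α] {ν : Measure α} {F : α → RMat n}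
    (hi : Integrable F ν) (a b : Fin n) : (∫ x, F x ∂ν) a b = ∫ x, F x a b ∂ν :=
  ((entryCLM a b).integral_comp_comm hi).symm

theorem continuousAt_rmat_inv {M : RMat n} (h : IsUnit M.det) :
    ContinuousAt (fun X : RMat n => X⁻¹) M := by
  obtain ⟨u, rfl⟩ := (Matrix.isUnit_iff_isUnit_det M).2 h
  simp_rw [Matrix.nonsing_inv_eq_ringInverse]
  exact NormedRing.inverse_continuousAt u

theorem HasDerivWithinAt.matrix_inv {F : ℝ → RMat n} {F' : RMat n} {s : Set ℝ} {t : ℝ}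
    (hF : HasDerivWithinAt F F' s t) (h : IsUnit (F t).det) :
    HasDerivWithinAt (fun x => (F x)⁻¹) (-((F t)⁻¹ * F' * (F t)⁻¹)) s t := by
  obtain ⟨u, hu⟩ := (Matrix.isUnit_iff_isUnit_det (F t)).2 h
  have h1 := hasFDerivAt_ringInverse (𝕜 := ℝ) u
  rw [hu] at h1
  have h2 := h1.comp_hasDerivWithinAt t hF
  have h3 : (↑u⁻¹ : RMat n) = (F t)⁻¹ := by
    rw [← hu, Matrix.nonsing_inv_eq_ringInverse, Ring.inverse_unit]
  simp_rw [Matrix.nonsing_inv_eq_ringInverse] at *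
  convert! h2 using 1
  simp [h3]

/-- Inversion is not continuous at singular matrices, so measurability comes from the formula `det⁻¹
• adjugate`. -/
theorem MeasureTheory.StronglyMeasurable.matrix_inv {α : Type*} [MeasurableSpace α]
    {F : α → RMat n} (hF : StronglyMeasurable F) : StronglyMeasurable fun x => (F x)⁻¹ := by
  have h1 : StronglyMeasurable fun x => (F x).det :=
    (continuous_id.matrix_det).comp_stronglyMeasurable hF
  have h2 : StronglyMeasurable fun x => (F x).adjugate :=
    (continuous_id.matrix_adjugate).comp_stronglyMeasurable hF
  have h3 : (fun x => (F x)⁻¹) = fun x => ((F x).det)⁻¹ • (F x).adjugate := by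
    ext1 x; rw [Matrix.inv_def, Ring.inverse_eq_inv']
  rw [h3]
  exact (h1.measurable.inv.stronglyMeasurable).smul h2

end MatrixTools

/-! ### Algebra of the Kalman jump: Woodbury identity and affine minorants -/

section JumpAlgebra

variable {n m : ℕ}

theorem Matrix.PosDef.inv_mul_self' {M : RMat n} (h : M.PosDef) : M⁻¹ * M = 1 :=
  Matrix.nonsing_inv_mul M h.isUnit_det'

theorem Matrix.PosDef.mul_inv_self' {M : RMat n} (h : M.PosDef) : M * M⁻¹ = 1 :=
  Matrix.mul_nonsing_inv M h.isUnit_det'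

theorem innovation_posDef (H : Matrix (Fin m) (Fin n) ℝ) {R : RMat m} (hR : R.PosDef) {P : RMat n}
    (hP : P.PosSemidef) : (H * P * Hᵀ + R).PosDef :=
  hR.posSemidef_add (hP.mul_mul_transpose H)

theorem infoContribution_posSemidef (H : Matrix (Fin m) (Fin n) ℝ) {R : RMat m} (hR : R.PosDef) :
    (infoContribution H R).PosSemidef :=
  hR.inv.posSemidef.transpose_mul_mul H

/-- The Woodbury identity: a measurement adds its information contribution to the inverse of the
covariance. -/
theorem sub_jumpMap_eq_inv (H : Matrix (Fin m) (Fin n) ℝ) {R : RMat m} (hR : R.PosDef)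
    {P : RMat n} (hP : P.PosDef) :
    P - jumpMap H R P = (P⁻¹ + infoContribution H R)⁻¹ := by
  have hC := innovation_posDef H hR hP.posSemidef
  have h := Matrix.add_mul_mul_inv_eq_sub (A := P⁻¹) (U := Hᵀ) (C := R⁻¹) (V := H) hP.inv.isUnit
    hR.inv.isUnit (by
      rw [Matrix.nonsing_inv_nonsing_inv _ hR.isUnit_det',
        Matrix.nonsing_inv_nonsing_inv _ hP.isUnit_det', add_comm]
      exact hC.isUnit)
  rw [infoContribution, h, Matrix.nonsing_inv_nonsing_inv _ hR.isUnit_det',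
    Matrix.nonsing_inv_nonsing_inv _ hP.isUnit_det', jumpMap, add_comm R]

/-- Inversion is antitone on positive definite matrices. -/
theorem inv_sub_inv_add_posSemidef {Y D : RMat n} (hY : Y.PosDef) (hD : D.PosSemidef) :
    (Y⁻¹ - (Y + D)⁻¹).PosSemidef := by
  have hYD := hY.add_posSemidef hD
  set J := (Y + D)⁻¹ with hJ
  have hJs : Jᵀ = J := hYD.inv.transpose_eq
  have h1 : Y⁻¹ - J = J * D * Y⁻¹ := by
    have : J * (Y + D) * Y⁻¹ = Y⁻¹ := by rw [hYD.inv_mul_self', one_mul]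
    rw [mul_add, add_mul, mul_assoc J Y, hY.mul_inv_self', mul_one] at this
    rw [sub_eq_iff_eq_add, add_comm]; exact this.symm
  have h2 : Y⁻¹ - J = Y⁻¹ * D * J := by
    have := congrArg Matrix.transpose h1
    rwa [Matrix.transpose_sub, Matrix.transpose_mul, Matrix.transpose_mul, hJs,
      hY.inv.transpose_eq, hD.transpose_eq, ← mul_assoc] at this
  -- Inserting `Y⁻¹ = J + Y⁻¹ D J` into `J D Y⁻¹` symmetrizes the difference into a sum of two
  -- congruences of semidefinite matrices.
  have h3 : Y⁻¹ - J = J * D * Jᵀ + (J * D) * Y⁻¹ * (J * D)ᵀ := by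
    rw [Matrix.transpose_mul, hJs, hD.transpose_eq]
    have : Y⁻¹ = J + Y⁻¹ * D * J := by rw [← h2]; abel
    calc Y⁻¹ - J = J * D * (J + Y⁻¹ * D * J) := by rw [← this, h1]
      _ = _ := by noncomm_ring
  rw [h3]
  exact (hD.mul_mul_transpose J).add (hY.inv.posSemidef.mul_mul_transpose _)

/-- A measurement adds information, hence lowers the covariance. With `sub_jumpMap_posSemidef` this
gives `0 ⪯ g(P) ⪯ P`. -/
theorem jumpMap_posSemidef (H : Matrix (Fin m) (Fin n) ℝ) {R : RMat m} (hR : R.PosDef)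
    {P : RMat n} (hP : P.PosDef) : (jumpMap H R P).PosSemidef := by
  have h : jumpMap H R P = P - (P⁻¹ + infoContribution H R)⁻¹ := by
    rw [← sub_jumpMap_eq_inv H hR hP]; abel
  have := inv_sub_inv_add_posSemidef hP.inv (infoContribution_posSemidef H hR)
  rwa [Matrix.nonsing_inv_nonsing_inv _ hP.isUnit_det', ← h] at this

theorem sub_jumpMap_posSemidef (H : Matrix (Fin m) (Fin n) ℝ) {R : RMat m} (hR : R.PosDef)
    {P : RMat n} (hP : P.PosDef) : (P - jumpMap H R P).PosSemidef := by
  rw [sub_jumpMap_eq_inv H hR hP]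
  exact (hP.inv.add_posSemidef (infoContribution_posSemidef H hR)).inv.posSemidef

/-- The affine minorant of the jump map with slope determined by the gain `K`. -/
noncomputable def jumpMinorant (H : Matrix (Fin m) (Fin n) ℝ) (R : RMat m)
    (K : Matrix (Fin m) (Fin n) ℝ) (P : RMat n) : RMat n :=
  (H * P)ᵀ * K + Kᵀ * (H * P) - Kᵀ * (H * P * Hᵀ + R) * K

/-- Completing the square: with `C = H P Hᵀ + R` the difference equals `(H P - C K)ᵀ C⁻¹ (H P - C
K)`. -/
theorem jumpMap_sub_jumpMinorant_posSemidef (H : Matrix (Fin m) (Fin n) ℝ) {R : RMat m}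
    (hR : R.PosDef) (K : Matrix (Fin m) (Fin n) ℝ) {P : RMat n} (hP : P.PosSemidef) :
    (jumpMap H R P - jumpMinorant H R K P).PosSemidef := by
  have hC := innovation_posDef H hR hP
  have h1 := hC.inv.posSemidef.transpose_mul_mul (H * P - (H * P * Hᵀ + R) * K)
  convert h1 using 1
  rw [jumpMinorant, jumpMap]
  set C := H * P * Hᵀ + R
  have e1 : (H * P - C * K)ᵀ = P * Hᵀ - Kᵀ * C := by
    rw [Matrix.transpose_sub, Matrix.transpose_mul, Matrix.transpose_mul, hP.transpose_eq,
      hC.transpose_eq]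
  have e2 : (H * P)ᵀ = P * Hᵀ := by rw [Matrix.transpose_mul, hP.transpose_eq]
  have e3 : (P * Hᵀ - Kᵀ * C) * C⁻¹ = P * Hᵀ * C⁻¹ - Kᵀ := by
    rw [Matrix.sub_mul, Matrix.mul_assoc Kᵀ, hC.mul_inv_self', Matrix.mul_one]
  have e4 : P * Hᵀ * C⁻¹ * (C * K) = P * Hᵀ * K := by
    rw [Matrix.mul_assoc _ C⁻¹, ← Matrix.mul_assoc C⁻¹, hC.inv_mul_self', Matrix.one_mul]
  rw [e1, e2, e3, Matrix.mul_sub, Matrix.sub_mul, Matrix.sub_mul, e4]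
  simp only [Matrix.mul_assoc]
  abel

/-- The square vanishes at `K = C⁻¹ H P`, so the jump map is the upper envelope of its affine
minorants and thus convex in the Loewner order. -/
theorem jumpMinorant_eq_jumpMap (H : Matrix (Fin m) (Fin n) ℝ) {R : RMat m}
    (hR : R.PosDef) {P : RMat n} (hP : P.PosSemidef) :
    jumpMinorant H R ((H * P * Hᵀ + R)⁻¹ * (H * P)) P = jumpMap H R P := by
  have hC := innovation_posDef H hR hP
  rw [jumpMinorant, jumpMap]
  set C := H * P * Hᵀ + R
  have e2 : (H * P)ᵀ = P * Hᵀ := by rw [Matrix.transpose_mul, hP.transpose_eq]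
  have e1 : (C⁻¹ * (H * P))ᵀ = P * Hᵀ * C⁻¹ := by
    rw [Matrix.transpose_mul, e2, hC.inv.transpose_eq]
  have e4 : P * Hᵀ * C⁻¹ * C = P * Hᵀ := by
    rw [Matrix.mul_assoc _ C⁻¹, hC.inv_mul_self', Matrix.mul_one]
  rw [e1, e2, e4]
  simp only [Matrix.mul_assoc]
  abel

end JumpAlgebra

/-! ### Linear equations with measurable coefficients via the Peano-Baker series -/

section LinearODE

variable {E : Type*} [NormedAddCommGroup E] [NormedSpace ℝ E]

/-- The terms of the Picard (Peano-Baker) series of `ẋ = B x`, `x 0 = x₀`. -/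
noncomputable def picardTerm (B : ℝ → E →L[ℝ] E) (x₀ : E) : ℕ → ℝ → E
  | 0 => fun _ => x₀
  | k + 1 => fun t => ∫ s in Ioc 0 t, B s (picardTerm B x₀ k s)

/-- The solution of the linear equation `ẋ = B x`, `x 0 = x₀`, for `t ≥ 0`. -/
noncomputable def linearSolution (B : ℝ → E →L[ℝ] E) (x₀ : E) (t : ℝ) : E :=
  ∑' k, picardTerm B x₀ k t

theorem norm_picardTerm_le {B : ℝ → E →L[ℝ] E} {b : ℝ} (hb : ∀ s, ‖B s‖ ≤ b) (x₀ : E) (k : ℕ)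
    {t : ℝ} (ht : 0 ≤ t) : ‖picardTerm B x₀ k t‖ ≤ ‖x₀‖ * ((b * t) ^ k / k.factorial) := by
  have hb0 : 0 ≤ b := (norm_nonneg _).trans (hb 0)
  induction k generalizing t with
  | zero => simp [picardTerm]
  | succ k ih =>
    have hint : ∫ s in Ioc 0 t, b * (‖x₀‖ * ((b * s) ^ k / k.factorial)) =
        ‖x₀‖ * ((b * t) ^ (k + 1) / (k + 1).factorial) := by
      rw [← intervalIntegral.integral_of_le ht]
      have : ∀ s : ℝ, b * (‖x₀‖ * ((b * s) ^ k / k.factorial)) =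
          (b ^ (k + 1) * ‖x₀‖ / k.factorial) * s ^ k := fun s => by rw [mul_pow]; ring
      simp_rw [this]
      rw [intervalIntegral.integral_const_mul, integral_pow, Nat.factorial_succ]
      push_cast
      have h1 : (k.factorial : ℝ) ≠ 0 := by positivity
      have h2 : (k : ℝ) + 1 ≠ 0 := by positivity
      field_simp
      simp
      ring
    rw [← hint]
    refine norm_integral_le_of_norm_le ?_ ?_
    · exact (Continuous.integrableOn_Ioc (by fun_prop))
    · filter_upwards [ae_restrict_mem measurableSet_Ioc] with s hs
      exact ((B s).le_opNorm _).trans (mul_le_mul (hb s) (ih hs.1.le) (norm_nonneg _) hb0)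

theorem summable_picardTerm [CompleteSpace E] {B : ℝ → E →L[ℝ] E} {b : ℝ} (hb : ∀ s, ‖B s‖ ≤ b)
    (x₀ : E) (t : ℝ) : Summable fun k => picardTerm B x₀ k t := by
  rcases le_or_gt 0 t with ht | ht
  · exact Summable.of_norm_bounded ((Real.summable_pow_div_factorial (b * t)).mul_left ‖x₀‖)
      fun k => norm_picardTerm_le hb x₀ k ht
  -- For `t < 0` the set `Ioc 0 t` is empty, so only the zeroth term survives.
  · refine summable_of_ne_finset_zero (s := {0}) fun k hk => ?_
    obtain ⟨j, rfl⟩ := Nat.exists_eq_succ_of_ne_zero (by simpa using hk)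
    simp [picardTerm, Ioc_eq_empty (not_lt.2 ht.le)]

variable {Ω : Type*} [MeasurableSpace Ω]

/-- The reason for solving by an explicit series: each term is a parametric integral of the previous
one, so joint measurability in the parameter and time is inherited. -/
theorem stronglyMeasurable_picardTerm {B : Ω → ℝ → E →L[ℝ] E} {x₀ : Ω → E}
    (hB : StronglyMeasurable fun q : Ω × ℝ => B q.1 q.2) (hx : StronglyMeasurable x₀) (k : ℕ) :
    StronglyMeasurable fun q : Ω × ℝ => picardTerm (B q.1) (x₀ q.1) k q.2 := by
  induction k with
  | zero => exact hx.comp_measurable measurable_fst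
  | succ k ih =>
    -- The moving domain `(0, t]` is encoded as an indicator, which makes the integral one over a
    -- fixed space.
    have hset : MeasurableSet {q : (Ω × ℝ) × ℝ | 0 < q.2 ∧ q.2 ≤ q.1.2} :=
      (measurableSet_lt measurable_const measurable_snd).inter
        (measurableSet_le measurable_snd (measurable_snd.comp measurable_fst))
    have hg : Measurable fun q : (Ω × ℝ) × ℝ => (q.1.1, q.2) := by fun_prop
    have h1 : StronglyMeasurable fun q : Ω × ℝ =>
        B q.1 q.2 (picardTerm (B q.1) (x₀ q.1) k q.2) :=
      (isBoundedBilinearMap_apply.continuous).comp_stronglyMeasurable (hB.prodMk ih)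
    have h2 := ((h1.comp_measurable hg).indicator hset).integral_prod_right' (ν := volume)
    convert! h2 using 2 with q
    simp only [picardTerm]
    rw [← integral_indicator measurableSet_Ioc]
    rfl

theorem stronglyMeasurable_linearSolution [CompleteSpace E] {B : Ω → ℝ → E →L[ℝ] E} {x₀ : Ω → E}
    (hB : StronglyMeasurable fun q : Ω × ℝ => B q.1 q.2) (hx : StronglyMeasurable x₀)
    (hb : ∀ ω, ∃ b, ∀ s, ‖B ω s‖ ≤ b) :
    StronglyMeasurable fun q : Ω × ℝ => linearSolution (B q.1) (x₀ q.1) q.2 := by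
  refine stronglyMeasurable_of_tendsto atTop
    (f := fun N (q : Ω × ℝ) => ∑ k ∈ Finset.range N, picardTerm (B q.1) (x₀ q.1) k q.2)
    (fun N => ?_) ?_
  · exact Finset.stronglyMeasurable_fun_sum _ fun k _ => stronglyMeasurable_picardTerm hB hx k
  · rw [tendsto_pi_nhds]
    intro q
    obtain ⟨b, hb⟩ := hb q.1
    exact (summable_picardTerm hb _ _).hasSum.tendsto_sum_nat

theorem stronglyMeasurable_picardTerm_time {B : ℝ → E →L[ℝ] E} (hB : StronglyMeasurable B) (x₀ : E)
    (k : ℕ) : StronglyMeasurable (picardTerm B x₀ k) :=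
  (stronglyMeasurable_picardTerm (Ω := Unit) (B := fun _ => B) (x₀ := fun _ => x₀)
    (hB.comp_measurable measurable_snd) stronglyMeasurable_const k).comp_measurable
    (measurable_prodMk_left (x := ()))

theorem stronglyMeasurable_linearSolution_time [CompleteSpace E] {B : ℝ → E →L[ℝ] E} {b : ℝ}
    (hB : StronglyMeasurable B) (hb : ∀ s, ‖B s‖ ≤ b) (x₀ : E) :
    StronglyMeasurable (linearSolution B x₀) :=
  (stronglyMeasurable_linearSolution (Ω := Unit) (B := fun _ => B) (x₀ := fun _ => x₀)
    (hB.comp_measurable measurable_snd) stronglyMeasurable_const fun _ => ⟨b, hb⟩).comp_measurable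
    (measurable_prodMk_left (x := ()))

theorem norm_linearSolution_le [CompleteSpace E] {B : ℝ → E →L[ℝ] E} {b : ℝ} (hb : ∀ s, ‖B s‖ ≤ b)
    (x₀ : E) {t : ℝ} (ht : 0 ≤ t) : ‖linearSolution B x₀ t‖ ≤ ‖x₀‖ * Real.exp (b * t) := by
  have h : HasSum (fun k : ℕ => ‖x₀‖ * ((b * t) ^ k / k.factorial)) (‖x₀‖ * Real.exp (b * t)) := by
    rw [Real.exp_eq_exp_ℝ]
    exact (NormedSpace.expSeries_div_hasSum_exp (b * t)).mul_left _
  exact tsum_of_norm_bounded h fun k => norm_picardTerm_le hb x₀ k ht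

/-- Removing the zeroth term shifts the series by one index, and the factorial bound permits
termwise integration. -/
theorem linearSolution_eq [CompleteSpace E] {B : ℝ → E →L[ℝ] E} {b : ℝ}
    (hB : StronglyMeasurable B) (hb : ∀ s, ‖B s‖ ≤ b) (x₀ : E) {t : ℝ} (ht : 0 ≤ t) :
    linearSolution B x₀ t = x₀ + ∫ s in (0 : ℝ)..t, B s (linearSolution B x₀ s) := by
  have hb0 : 0 ≤ b := (norm_nonneg _).trans (hb 0)
  have hs := summable_picardTerm hb x₀ t
  rw [linearSolution, hs.tsum_eq_zero_add, intervalIntegral.integral_of_le ht]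
  congr 1
  refine HasSum.tsum_eq ?_
  refine hasSum_integral_of_dominated_convergence
    (fun k _ => b * (‖x₀‖ * ((b * t) ^ k / k.factorial))) (fun k => ?_) (fun k => ?_) ?_ ?_ ?_
  · exact ((isBoundedBilinearMap_apply.continuous).comp_stronglyMeasurable
      (hB.prodMk (stronglyMeasurable_picardTerm_time hB x₀ k))).aestronglyMeasurable
  · filter_upwards [ae_restrict_mem measurableSet_Ioc] with s hs
    refine ((B s).le_opNorm _).trans (mul_le_mul (hb s) ?_ (norm_nonneg _) hb0)
    refine (norm_picardTerm_le hb x₀ k hs.1.le).trans ?_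
    have h1 : 0 ≤ b * s := mul_nonneg hb0 hs.1.le
    have h2 : b * s ≤ b * t := mul_le_mul_of_nonneg_left hs.2 hb0
    gcongr
  · exact Eventually.of_forall fun _ =>
      ((Real.summable_pow_div_factorial (b * t)).mul_left ‖x₀‖).mul_left b
  · exact integrable_const _
  · exact Eventually.of_forall fun s => (B s).hasSum (summable_picardTerm hb x₀ s).hasSum

end LinearODE

/-! ### Counting paths, the information equation and its Hamiltonian system -/

section StepPaths

open scoped Matrix.Norms.L2Operator

variable {n M : ℕ}

/-- A family of bounded, nondecreasing, right-continuous counting paths. -/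
structure IsStepPath (k : Fin M → ℝ → ℕ) : Prop where
  mono : ∀ j, Monotone (k j)
  right : ∀ t, ∀ᶠ s in 𝓝[≥] t, ∀ j, k j s = k j t
  bdd : ∃ K, ∀ j s, k j s ≤ K

/-- A nondecreasing integer-valued path that is bounded by `f t` attains its supremum before `t` and
is constant from then on. -/
theorem exists_eventually_eq_left {f : ℝ → ℕ} {t : ℝ} (hf : ∀ᶠ a in 𝓝[<] t, MonotoneOn f (Icc a t)) :
    ∃ l ≤ f t, ∀ᶠ s in 𝓝[<] t, f s = l := by
  obtain ⟨a, ha, hat⟩ := (hf.and self_mem_nhdsWithin).exists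
  have hat : a < t := hat
  have hb : BddAbove (f '' Ico a t) := ⟨f t, by
    rintro _ ⟨s, hs, rfl⟩
    exact ha ⟨hs.1, hs.2.le⟩ ⟨hat.le, le_rfl⟩ hs.2.le⟩
  have hne : (f '' Ico a t).Nonempty := ⟨f a, a, ⟨le_rfl, hat⟩, rfl⟩
  obtain ⟨c, hc, hcl⟩ := Nat.sSup_mem hne hb
  refine ⟨sSup (f '' Ico a t), ?_, ?_⟩
  · rw [← hcl]; exact ha ⟨hc.1, hc.2.le⟩ ⟨hat.le, le_rfl⟩ hc.2.le
  · filter_upwards [Ioo_mem_nhdsLT hc.2] with s hs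
    refine le_antisymm (le_csSup hb ⟨s, ⟨hc.1.trans hs.1.le, hs.2⟩, rfl⟩) ?_
    rw [← hcl]
    exact ha ⟨hc.1, hc.2.le⟩ ⟨hc.1.trans hs.1.le, hs.2.le⟩ hs.1.le

theorem IsStepPath.left {k : Fin M → ℝ → ℕ} (hk : IsStepPath k) (t : ℝ) :
    ∃ l : Fin M → ℕ, (∀ j, l j ≤ k j t) ∧ ∀ᶠ s in 𝓝[<] t, ∀ j, k j s = l j := by
  have h : ∀ j, ∃ l ≤ k j t, ∀ᶠ s in 𝓝[<] t, k j s = l := fun j =>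
    exists_eventually_eq_left (Eventually.of_forall fun a => (hk.mono j).monotoneOn _)
  choose l hl hl' using h
  exact ⟨l, hl, eventually_all.2 hl'⟩

/-- The information accumulated when measurement `j` has been made `c j` times. -/
noncomputable def infoSum (S : Fin M → RMat n) (c : Fin M → ℕ) : RMat n := ∑ j, (c j : ℝ) • S j

theorem infoSum_posSemidef {S : Fin M → RMat n} (hS : ∀ j, (S j).PosSemidef) (c : Fin M → ℕ) :
    (infoSum S c).PosSemidef :=
  Matrix.posSemidef_sum _ fun j _ => (hS j).smul (Nat.cast_nonneg _)

theorem infoSum_sub_posSemidef {S : Fin M → RMat n} (hS : ∀ j, (S j).PosSemidef) {c d : Fin M → ℕ}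
    (h : ∀ j, c j ≤ d j) : (infoSum S d - infoSum S c).PosSemidef := by
  have : infoSum S d - infoSum S c = infoSum S (fun j => d j - c j) := by
    simp only [infoSum, ← Finset.sum_sub_distrib, ← sub_smul, Nat.cast_sub (h _)]
  rw [this]
  exact infoSum_posSemidef hS _

/-- The vector field of the information Riccati equation. -/
def infoDrift (A Q Y : RMat n) : RMat n := -(Y * A) - Aᵀ * Y - Y * Q * Y

theorem continuous_infoDrift (A Q : RMat n) : Continuous (infoDrift A Q) := by
  unfold infoDrift; fun_prop

/-- A positive definite path that solves the information equation
`dY = (-YA - AᵀY - YQY) dt + ∑ j, S j dk_j` on `[0, T]`, in integrated form. -/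
structure IsInfoPath (T : ℝ) (A Q : RMat n) (S : Fin M → RMat n) (k : Fin M → ℝ → ℕ) (y₀ : RMat n)
    (y : ℝ → RMat n) : Prop where
  posDef : ∀ t ∈ Icc 0 T, (y t).PosDef
  integrable : IntervalIntegrable (fun s => infoDrift A Q (y s)) volume 0 T
  equation : ∀ t ∈ Icc 0 T,
    y t = y₀ + (∫ s in (0 : ℝ)..t, infoDrift A Q (y s)) + infoSum S fun j => k j t

/-- The linear Hamiltonian field in the coordinates `(U, W)` with `W = V - σ U`, in which the jumps
of `V` are absorbed in the coefficient. -/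
noncomputable def hamiltonianField (A Q σ : RMat n) :
    (RMat n × RMat n) →L[ℝ] (RMat n × RMat n) :=
  let L := ContinuousLinearMap.mul ℝ (RMat n)
  let V := ContinuousLinearMap.snd ℝ (RMat n) (RMat n) + (L σ).comp (.fst ℝ (RMat n) (RMat n))
  let U' := (L A).comp (.fst ℝ (RMat n) (RMat n)) + (L Q).comp V
  let W' := -((L Aᵀ).comp V) - (L σ).comp U'
  (ContinuousLinearMap.inl ℝ (RMat n) (RMat n)).comp U' +
    (ContinuousLinearMap.inr ℝ (RMat n) (RMat n)).comp W'

theorem hamiltonianField_apply (A Q σ : RMat n) (x : RMat n × RMat n) :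
    hamiltonianField A Q σ x = (A * x.1 + Q * (x.2 + σ * x.1),
      -(Aᵀ * (x.2 + σ * x.1)) - σ * (A * x.1 + Q * (x.2 + σ * x.1))) := by
  simp [hamiltonianField]
  constructor
  · simp only [mul_add]
  · simp only [mul_add, neg_add]; abel

theorem continuous_hamiltonianField (A Q : RMat n) : Continuous (hamiltonianField A Q) := by
  unfold hamiltonianField
  simp only
  fun_prop

/-- The solution `(U, W)` of the Hamiltonian system that starts from `(p₀, 1)`. -/
noncomputable def hamiltonianState (A Q : RMat n) (S : Fin M → RMat n) (k : Fin M → ℝ → ℕ)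
    (p₀ : RMat n) (t : ℝ) : RMat n × RMat n :=
  linearSolution (fun s => hamiltonianField A Q (infoSum S fun j => k j s)) (p₀, 1) t

/-- The error covariance at time `t` of the filter that starts from `p₀` and is driven by the
counting paths `k`. -/
noncomputable def covSolution (A Q : RMat n) (S : Fin M → RMat n) (k : Fin M → ℝ → ℕ)
    (p₀ : RMat n) (t : ℝ) : RMat n :=
  (hamiltonianState A Q S k p₀ t).1 *
    ((hamiltonianState A Q S k p₀ t).2 +
      infoSum S (fun j => k j t) * (hamiltonianState A Q S k p₀ t).1)⁻¹

/-- Bounded counts take finitely many values, so the coefficient has finite range. -/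
theorem IsStepPath.norm_hamiltonianField_le {k : Fin M → ℝ → ℕ} (hk : ∃ K, ∀ j s, k j s ≤ K)
    (A Q : RMat n) (S : Fin M → RMat n) :
    ∃ b, ∀ s, ‖hamiltonianField A Q (infoSum S fun j => k j s)‖ ≤ b := by
  obtain ⟨K, hK⟩ := hk
  have hfin : (Set.range fun s => hamiltonianField A Q (infoSum S fun j => k j s)).Finite := by
    refine Set.Finite.subset ((Set.Finite.pi' (ι := Fin M) (t := fun _ => Set.Iic K)
      fun _ => Set.finite_Iic K).image fun c => hamiltonianField A Q (infoSum S c)) ?_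
    rintro _ ⟨s, rfl⟩
    exact ⟨fun j => k j s, fun j => hK j s, rfl⟩
  obtain ⟨b, hb⟩ := hfin.isBounded.exists_norm_le
  exact ⟨b, fun s => hb _ ⟨s, rfl⟩⟩

theorem measurable_infoSum {Ω : Type*} [MeasurableSpace Ω] (S : Fin M → RMat n)
    {c : Fin M → Ω → ℕ} (hc : ∀ j, Measurable (c j)) :
    StronglyMeasurable fun ω => infoSum S fun j => c j ω := by
  unfold infoSum
  refine Finset.stronglyMeasurable_fun_sum _ fun j _ => ?_
  exact ((measurable_from_nat (f := fun i : ℕ => (i : ℝ))).comp (hc j)).stronglyMeasurable.smul_const _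

end StepPaths

/-! ### Regularity of the Hamiltonian state and of information paths -/

section InfoExistence

open scoped Matrix.Norms.L2Operator

variable {n M : ℕ}

theorem HasDerivWithinAt.matrix_transpose {F : ℝ → RMat n} {F' : RMat n} {s : Set ℝ} {t : ℝ}
    (hF : HasDerivWithinAt F F' s t) : HasDerivWithinAt (fun x => (F x)ᵀ) F'ᵀ s t :=
  (LinearMap.toContinuousLinearMap
    (Matrix.transposeLinearEquiv (Fin n) (Fin n) ℝ ℝ).toLinearMap).hasFDerivAt.comp_hasDerivWithinAt t hF

theorem IsStepPath.stronglyMeasurable_infoSum {k : Fin M → ℝ → ℕ} (hk : IsStepPath k)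
    (S : Fin M → RMat n) : StronglyMeasurable fun s => infoSum S fun j => k j s :=
  measurable_infoSum S fun j => (hk.mono j).measurable

theorem IsStepPath.infoSum_right {k : Fin M → ℝ → ℕ} (hk : IsStepPath k) (S : Fin M → RMat n)
    (t : ℝ) : ContinuousWithinAt (fun s => infoSum S fun j => k j s) (Ici t) t := by
  refine (tendsto_const_nhds (x := infoSum S fun j => k j t)).congr' ?_
  filter_upwards [hk.right t] with s hs
  simp only [hs]

section Hamiltonian

variable (A Q : RMat n) (S : Fin M → RMat n) {k : Fin M → ℝ → ℕ} (hk : IsStepPath k) (p₀ : RMat n)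
include hk

theorem hamiltonianState_zero : hamiltonianState A Q S k p₀ 0 = (p₀, 1) := by
  obtain ⟨b, hb⟩ := IsStepPath.norm_hamiltonianField_le hk.bdd A Q S
  have hB : StronglyMeasurable fun s => hamiltonianField A Q (infoSum S fun j => k j s) :=
    (continuous_hamiltonianField A Q).comp_stronglyMeasurable (hk.stronglyMeasurable_infoSum S)
  rw [hamiltonianState, linearSolution_eq hB hb _ le_rfl]
  simp

theorem continuousOn_hamiltonianState {T : ℝ} (hT : 0 ≤ T) :
    ContinuousOn (hamiltonianState A Q S k p₀) (Icc 0 T) ∧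
    ∀ t ∈ Ico 0 T, HasDerivWithinAt (hamiltonianState A Q S k p₀)
      (hamiltonianField A Q (infoSum S fun j => k j t) (hamiltonianState A Q S k p₀ t))
      (Ici t) t := by
  obtain ⟨b, hb⟩ := IsStepPath.norm_hamiltonianField_le hk.bdd A Q S
  have hb0 : 0 ≤ b := (ContinuousLinearMap.opNorm_nonneg _).trans (hb 0)
  have hB : StronglyMeasurable fun s => hamiltonianField A Q (infoSum S fun j => k j s) :=
    (continuous_hamiltonianField A Q).comp_stronglyMeasurable (hk.stronglyMeasurable_infoSum S)
  set x := hamiltonianState A Q S k p₀ with hx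
  set f := fun s => hamiltonianField A Q (infoSum S fun j => k j s) (x s) with hf
  have hfm : StronglyMeasurable f := (isBoundedBilinearMap_apply.continuous).comp_stronglyMeasurable
    (hB.prodMk (stronglyMeasurable_linearSolution_time hB hb _))
  have hfi : IntervalIntegrable f volume 0 T := by
    rw [intervalIntegrable_iff_integrableOn_Icc_of_le hT]
    refine Integrable.mono' (integrable_const (b * (‖(p₀, (1 : RMat n))‖ * Real.exp (b * T))))
      hfm.aestronglyMeasurable ?_
    filter_upwards [ae_restrict_mem measurableSet_Icc] with t ht
    refine (ContinuousLinearMap.le_opNorm _ _).trans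
      (mul_le_mul (hb t) ?_ (norm_nonneg _) hb0)
    refine (norm_linearSolution_le hb _ ht.1).trans ?_
    gcongr
    exact ht.2
  have hxeq : ∀ t, 0 ≤ t → x t = (p₀, 1) + ∫ s in (0 : ℝ)..t, f s := fun t ht =>
    linearSolution_eq hB hb _ ht
  have hx0 : x 0 = (p₀, 1) := hamiltonianState_zero A Q S hk p₀
  have hcont : ContinuousOn x (Icc 0 T) := by
    have h1 : ContinuousOn (fun t => ∫ s in (0 : ℝ)..t, f s) (uIcc 0 T) :=
      intervalIntegral.continuousOn_primitive_interval
        (by rw [uIcc_of_le hT]; exact (intervalIntegrable_iff_integrableOn_Icc_of_le hT).1 hfi)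
    rw [uIcc_of_le hT] at h1
    exact (continuousOn_const.add h1).congr fun t ht => hxeq t ht.1
  refine ⟨hcont, fun t ht => ?_⟩
  refine hasDerivWithinAt_Ici_of_eq_integral hfi ht (fun s hs => by rw [hx0, hxeq s hs.1]) ?_
    hfm.aestronglyMeasurable
  have h1 : ContinuousWithinAt x (Ioi t) t :=
    (hcont t ⟨ht.1, ht.2.le⟩).mono_of_mem_nhdsWithin
      (mem_of_superset (Ioo_mem_nhdsGT ht.2) fun s hs => ⟨ht.1.trans hs.1.le, hs.2.le⟩)
  have h2 : ContinuousWithinAt (fun s => hamiltonianField A Q (infoSum S fun j => k j s)) (Ioi t) t :=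
    (continuous_hamiltonianField A Q).continuousAt.comp_continuousWithinAt
      ((hk.infoSum_right S t).mono Ioi_subset_Ici_self)
  exact h2.clm_apply h1

end Hamiltonian

/-- The components of the Hamiltonian state have the right derivatives of the Hamiltonian system. -/
theorem hamiltonian_components (A Q : RMat n) (S : Fin M → RMat n) {k : Fin M → ℝ → ℕ}
    (hk : IsStepPath k) (p₀ : RMat n) {T : ℝ} (hT : 0 ≤ T) :
    ∃ U W : ℝ → RMat n, (∀ t, hamiltonianState A Q S k p₀ t = (U t, W t)) ∧ U 0 = p₀ ∧ W 0 = 1 ∧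
      ContinuousOn U (Icc 0 T) ∧ ContinuousOn W (Icc 0 T) ∧
      (∀ t ∈ Ico 0 T, HasDerivWithinAt U
        (A * U t + Q * (W t + infoSum S (fun j => k j t) * U t)) (Ici t) t) ∧
      ∀ t ∈ Ico 0 T, HasDerivWithinAt W (-(Aᵀ * (W t + infoSum S (fun j => k j t) * U t)) -
        infoSum S (fun j => k j t) * (A * U t + Q * (W t + infoSum S (fun j => k j t) * U t)))
        (Ici t) t := by
  obtain ⟨hc, hd⟩ := continuousOn_hamiltonianState A Q S hk p₀ hT
  have h0 := hamiltonianState_zero A Q S hk p₀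
  refine ⟨fun t => (hamiltonianState A Q S k p₀ t).1, fun t => (hamiltonianState A Q S k p₀ t).2,
    fun t => rfl, by simp [h0], by simp [h0], hc.fst, hc.snd, fun t ht => ?_, fun t ht => ?_⟩
  · have := (hd t ht).fst
    rwa [hamiltonianField_apply] at this
  · have := (hd t ht).snd
    rwa [hamiltonianField_apply] at this

theorem IsInfoPath.continuousOn_sub {T : ℝ} (hT : 0 ≤ T) {A Q : RMat n} {S : Fin M → RMat n}
    {k : Fin M → ℝ → ℕ} {y₀ : RMat n} {y : ℝ → RMat n} (h : IsInfoPath T A Q S k y₀ y) :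
    ContinuousOn (fun t => y t - infoSum S fun j => k j t) (Icc 0 T) := by
  have h1 : ContinuousOn (fun t => ∫ s in (0 : ℝ)..t, infoDrift A Q (y s)) (uIcc 0 T) :=
    intervalIntegral.continuousOn_primitive_interval (by
      rw [uIcc_of_le hT]; exact (intervalIntegrable_iff_integrableOn_Icc_of_le hT).1 h.integrable)
  rw [uIcc_of_le hT] at h1
  refine ((continuousOn_const (c := y₀)).add h1).congr fun t ht => ?_
  show _ = y₀ + _
  rw [h.equation t ht]; abel

theorem rightCont_of_continuousOn_sub {T : ℝ} {S : Fin M → RMat n} {k : Fin M → ℝ → ℕ}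
    (hk : IsStepPath k) {y : ℝ → RMat n}
    (h : ContinuousOn (fun t => y t - infoSum S fun j => k j t) (Icc 0 T)) :
    ∀ t ∈ Ico 0 T, ContinuousWithinAt y (Ici t) t := by
  intro t ht
  have h1 : ContinuousWithinAt (fun t => y t - infoSum S fun j => k j t) (Ici t) t :=
    (h t ⟨ht.1, ht.2.le⟩).mono_of_mem_nhdsWithin
      (mem_of_superset (Ico_mem_nhdsGE ht.2) fun s hs => ⟨ht.1.trans hs.1, hs.2.le⟩)
  exact (h1.add (hk.infoSum_right S t)).congr (fun s _ => by simp) (by simp)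

theorem leftLimit_of_continuousOn_sub {T : ℝ} {S : Fin M → RMat n} {k : Fin M → ℝ → ℕ}
    {y : ℝ → RMat n} {t : ℝ} (ht : t ∈ Ioc 0 T) {l : Fin M → ℕ}
    (hl : ∀ᶠ s in 𝓝[<] t, ∀ j, k j s = l j)
    (h : ContinuousOn (fun t => y t - infoSum S fun j => k j t) (Icc 0 T)) :
    Tendsto y (𝓝[<] t) (𝓝 (y t - infoSum S (fun j => k j t) + infoSum S l)) := by
  have h1 : ContinuousWithinAt (fun t => y t - infoSum S fun j => k j t) (Iio t) t :=
    (h t ⟨ht.1.le, ht.2⟩).mono_of_mem_nhdsWithin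
      (mem_of_superset (Ioo_mem_nhdsLT ht.1) fun s hs => ⟨hs.1.le, hs.2.le.trans ht.2⟩)
  have h2 := h1.tendsto.add_const (infoSum S l)
  refine h2.congr' ?_
  filter_upwards [hl] with s hs
  simp [hs]

end InfoExistence

/-! ### Global existence for the information equation -/

section InfoExistence

open scoped Matrix.Norms.L2Operator

variable {n M : ℕ}

/-- The identity behind `(UᵀV)' = Vᵀ Q V`, with `V = W + σ U`: the matrix `X` stands for `σ U'`,
which is subtracted in `W'` and restored in `V'`. -/
theorem hamiltonian_gram_deriv (A Q U V X : RMat n) :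
    (A * U + Q * V)ᵀ * V + Uᵀ * (-(Aᵀ * V) - X + X) = Vᵀ * Qᵀ * V := by
  simp only [Matrix.transpose_add, Matrix.transpose_mul]
  noncomm_ring

/-- `Uᵀ V` dominates its initial value along the Hamiltonian system. -/
theorem hamiltonian_gram_ge {T : ℝ} {A Q : RMat n} (hQ : Q.PosSemidef) {S : Fin M → RMat n}
    (hS : ∀ j, (S j).PosSemidef) {k : Fin M → ℝ → ℕ} (hk : IsStepPath k) {p₀ : RMat n}
    (hp : p₀.PosDef) {U W : ℝ → RMat n} (hU0 : U 0 = p₀) (hW0 : W 0 = 1)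
    (hUc : ContinuousOn U (Icc 0 T)) (hWc : ContinuousOn W (Icc 0 T))
    (hU : ∀ t ∈ Ico 0 T, HasDerivWithinAt U
        (A * U t + Q * (W t + infoSum S (fun j => k j t) * U t)) (Ici t) t)
    (hW : ∀ t ∈ Ico 0 T, HasDerivWithinAt W (-(Aᵀ * (W t + infoSum S (fun j => k j t) * U t)) -
        infoSum S (fun j => k j t) * (A * U t + Q * (W t + infoSum S (fun j => k j t) * U t)))
        (Ici t) t) :
    ∀ t ∈ Icc 0 T, ((U t)ᵀ * (W t + infoSum S (fun j => k j t) * U t) - p₀).PosSemidef := by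
  set σ : ℝ → RMat n := fun t => infoSum S fun j => k j t with hσ
  have hσp : ∀ t, (σ t).PosSemidef := fun t => infoSum_posSemidef hS _
  -- The counts may be nonzero at time `0`; then `V(0) = 1 + σ(0) p₀` and the excess is `p₀ σ(0)
  -- p₀`. Afterwards `UᵀV` grows by the integral of `Vᵀ Q V` between jumps and by a congruence of
  -- the increment of `σ` at jumps.
  refine Icc_induction (fun _ => ?_) ?_ ?_
  · have : (U 0)ᵀ * (W 0 + σ 0 * U 0) - p₀ = p₀ᵀ * σ 0 * p₀ := by
      rw [hU0, hW0, hp.transpose_eq]; noncomm_ring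
    rw [this]
    exact (hσp 0).transpose_mul_mul p₀
  · intro t ht hprev
    obtain ⟨u, hu, hsub⟩ := mem_nhdsGE_iff_exists_Ico_subset.1 (hk.right t)
    refine ⟨u, hu, fun s hs hsT => ?_⟩
    have hconst : ∀ r ∈ Icc t s, σ r = σ t := fun r hr => by
      have : ∀ j, k j r = k j t := hsub ⟨hr.1, hr.2.trans_lt hs.2⟩
      simp only [hσ, this]
    set G : ℝ → RMat n := fun r => (U r)ᵀ * (W r + σ t * U r) with hG
    have hmem : ∀ r ∈ Icc t s, r ∈ Icc 0 T := fun r hr => ⟨ht.1.trans hr.1, hr.2.trans hsT⟩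
    have hUc' : ContinuousOn U (Icc t s) := hUc.mono hmem
    have hWc' : ContinuousOn W (Icc t s) := hWc.mono hmem
    set V : ℝ → RMat n := fun r => W r + σ t * U r with hV
    have hVc : ContinuousOn V (Icc t s) := hWc'.add (continuousOn_const.mul hUc')
    have hGc : ContinuousOn G (Icc t s) :=
      (continuous_id.matrix_transpose.comp_continuousOn hUc').mul hVc
    have hGd : ∀ r ∈ Ico t s, HasDerivWithinAt G ((V r)ᵀ * Q * V r) (Ici r) r := by
      intro r hr
      have hr' : r ∈ Ico 0 T := ⟨ht.1.trans hr.1, hr.2.trans_le hsT⟩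
      have h1 := hU r hr'
      have h2 := hW r hr'
      change HasDerivWithinAt U (A * U r + Q * (W r + σ r * U r)) (Ici r) r at h1
      change HasDerivWithinAt W (-(Aᵀ * (W r + σ r * U r)) -
        σ r * (A * U r + Q * (W r + σ r * U r))) (Ici r) r at h2
      rw [hconst r ⟨hr.1, hr.2.le⟩] at h1 h2
      have h3 := h1.matrix_transpose.mul (h2.add (h1.const_mul (σ t)))
      convert! h3 using 1
      have h4 := hamiltonian_gram_deriv A Q (U r) (V r) (σ t * (A * U r + Q * V r))
      rw [hQ.transpose_eq] at h4
      exact h4.symm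
    have hfi : ContinuousOn (fun r => (V r)ᵀ * Q * V r) (Icc t s) :=
      ((continuous_id.matrix_transpose.comp_continuousOn hVc).mul continuousOn_const).mul hVc
    have hint : IntervalIntegrable (fun r => (V r)ᵀ * Q * V r) volume t s :=
      ContinuousOn.intervalIntegrable_of_Icc hs.1.le hfi
    have hFTC := eq_add_integral_of_hasDerivWithinAt_Ici hGc hGd hint
      (right_mem_Icc.2 hs.1.le)
    have hpos : (∫ r in t..s, (V r)ᵀ * Q * V r).PosSemidef := by
      rw [intervalIntegral.integral_of_le hs.1.le]
      rw [intervalIntegrable_iff_integrableOn_Ioc_of_le hs.1.le] at hint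
      exact posSemidef_integral hint (Eventually.of_forall fun r => hQ.transpose_mul_mul _)
    have hGs : (U s)ᵀ * (W s + σ s * U s) - p₀ = (G t - p₀) + ∫ r in t..s, (V r)ᵀ * Q * V r := by
      rw [hconst s ⟨hs.1.le, le_rfl⟩]
      change G s - p₀ = _
      rw [hFTC]; abel
    rw [hGs]
    exact (hprev t ⟨ht.1, le_rfl⟩).add hpos
  · intro t ht hprev
    obtain ⟨l, hl, hev⟩ := hk.left t
    have hlim : Tendsto (fun s => (U s)ᵀ * (W s + infoSum S l * U s) - p₀) (𝓝[<] t)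
        (𝓝 ((U t)ᵀ * (W t + infoSum S l * U t) - p₀)) := by
      have hsub : Icc 0 T ∈ 𝓝[<] t :=
        mem_of_superset (Ioo_mem_nhdsLT ht.1) fun s hs => ⟨hs.1.le, hs.2.le.trans ht.2⟩
      have hU1 : Tendsto U (𝓝[<] t) (𝓝 (U t)) :=
        (hUc t ⟨ht.1.le, ht.2⟩).mono_of_mem_nhdsWithin hsub
      have hW1 : Tendsto W (𝓝[<] t) (𝓝 (W t)) :=
        (hWc t ⟨ht.1.le, ht.2⟩).mono_of_mem_nhdsWithin hsub
      exact (((continuous_id.matrix_transpose.tendsto _).comp hU1).mul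
        (hW1.add (hU1.const_mul _))).sub_const _
    have hpl := posSemidef_of_tendsto hlim (by
      filter_upwards [hev, Ioo_mem_nhdsLT ht.1] with s hs hs'
      have := hprev s ⟨hs'.1.le, hs'.2⟩
      simpa only [hσ, hs] using this)
    have hsplit : (U t)ᵀ * (W t + σ t * U t) - p₀ = ((U t)ᵀ * (W t + infoSum S l * U t) - p₀) +
        (U t)ᵀ * (σ t - infoSum S l) * U t := by noncomm_ring
    rw [hsplit]
    exact hpl.add ((infoSum_sub_posSemidef hS hl).transpose_mul_mul _)

theorem IsStepPath.cadlag_infoDrift {T : ℝ} {A Q : RMat n} {S : Fin M → RMat n}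
    {k : Fin M → ℝ → ℕ} (hk : IsStepPath k) (hT : 0 ≤ T) {y : ℝ → RMat n}
    (h : ContinuousOn (fun t => y t - infoSum S fun j => k j t) (Icc 0 T)) :
    IntervalIntegrable (fun s => infoDrift A Q (y s)) volume 0 T := by
  refine intervalIntegrable_of_cadlag hT (fun t ht => ?_) fun t ht => ?_
  · exact (continuous_infoDrift A Q).continuousAt.comp_continuousWithinAt
      (rightCont_of_continuousOn_sub hk h t ht)
  · obtain ⟨l, -, hl⟩ := hk.left t
    exact ⟨_, ((continuous_infoDrift A Q).tendsto _).comp (leftLimit_of_continuousOn_sub ht hl h)⟩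

/-- The bound `UᵀV ⪰ p₀ ≻ 0` makes `U` and `V` invertible on the whole interval, so `y = V U⁻¹ = U⁻ᵀ
(UᵀV) U⁻¹` never blows up and is positive definite. Subtracting the jumps leaves `y - σ = W U⁻¹`,
whose right derivative is the Riccati field. -/
theorem isInfoPath_inv_covSolution {T : ℝ} (hT : 0 ≤ T) {A Q : RMat n} (hQ : Q.PosSemidef)
    {S : Fin M → RMat n} (hS : ∀ j, (S j).PosSemidef) {k : Fin M → ℝ → ℕ} (hk : IsStepPath k)
    {p₀ : RMat n} (hp : p₀.PosDef) :
    IsInfoPath T A Q S k p₀⁻¹ fun t => (covSolution A Q S k p₀ t)⁻¹ := by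
  obtain ⟨U, W, hUW, hU0, hW0, hUc, hWc, hU, hW⟩ := hamiltonian_components A Q S hk p₀ hT
  set σ : ℝ → RMat n := fun t => infoSum S fun j => k j t with hσ
  have hσp : ∀ t, (σ t).PosSemidef := fun t => infoSum_posSemidef hS _
  have hG : ∀ t ∈ Icc 0 T, ((U t)ᵀ * (W t + σ t * U t)).PosDef := fun t ht => by
    have := hp.posSemidef_add (hamiltonian_gram_ge hQ hS hk hp hU0 hW0 hUc hWc hU hW t ht)
    rwa [sub_add_cancel] at this
  have hUdet : ∀ t ∈ Icc 0 T, IsUnit (U t).det := fun t ht => by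
    have := (hG t ht).isUnit_det'
    rw [Matrix.det_mul, Matrix.det_transpose] at this
    exact isUnit_of_mul_isUnit_left this
  have hUU : ∀ t ∈ Icc 0 T, U t * (U t)⁻¹ = 1 := fun t ht => Matrix.mul_nonsing_inv _ (hUdet t ht)
  set y : ℝ → RMat n := fun t => (covSolution A Q S k p₀ t)⁻¹ with hy
  have hyeq : ∀ t ∈ Icc 0 T, y t = (W t + σ t * U t) * (U t)⁻¹ := fun t ht => by
    have hV : IsUnit (W t + σ t * U t).det := by
      have := (hG t ht).isUnit_det'
      rw [Matrix.det_mul] at this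
      exact isUnit_of_mul_isUnit_right this
    simp only [hy, covSolution, hUW]
    rw [Matrix.mul_inv_rev, Matrix.nonsing_inv_nonsing_inv _ hV]
  have hZ : ∀ t ∈ Icc 0 T, y t - σ t = W t * (U t)⁻¹ := fun t ht => by
    rw [hyeq t ht, add_mul, mul_assoc, hUU t ht, mul_one, add_sub_cancel_right]
  have hinvc : ContinuousOn (fun t => (U t)⁻¹) (Icc 0 T) := fun t ht =>
    (continuousAt_rmat_inv (hUdet t ht)).comp_continuousWithinAt (hUc t ht)
  have hZc : ContinuousOn (fun t => y t - σ t) (Icc 0 T) := (hWc.mul hinvc).congr hZ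
  have hint := hk.cadlag_infoDrift (A := A) (Q := Q) hT hZc
  have hZd : ∀ t ∈ Ico 0 T,
      HasDerivWithinAt (fun t => W t * (U t)⁻¹) (infoDrift A Q (y t)) (Ici t) t := by
    intro t ht
    have ht' : t ∈ Icc 0 T := ⟨ht.1, ht.2.le⟩
    have h1 := (hW t ht).mul ((hU t ht).matrix_inv (hUdet t ht'))
    convert! h1 using 1
    have e1 : infoSum S (fun j => k j t) = σ t := rfl
    have e2 : W t = (y t - σ t) * U t := by
      rw [hZ t ht', mul_assoc, Matrix.nonsing_inv_mul _ (hUdet t ht'), mul_one]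
    rw [e1]
    generalize hz : y t - σ t = z at e2
    have e3 : y t = z + σ t := by rw [← hz]; abel
    rw [infoDrift, e3, e2]
    have hu := hUU t ht'
    have r : ∀ X : RMat n, X * U t * (U t)⁻¹ = X := fun X => by rw [mul_assoc, hu, mul_one]
    have e4 : z * U t + σ t * U t = (z + σ t) * U t := by rw [add_mul]
    have e5 : (-(Aᵀ * ((z + σ t) * U t)) - σ t * (A * U t + Q * ((z + σ t) * U t))) =
      (-(Aᵀ * (z + σ t)) - σ t * (A + Q * (z + σ t))) * U t := by noncomm_ring
    have e6 : A * U t + Q * ((z + σ t) * U t) = (A + Q * (z + σ t)) * U t := by noncomm_ring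
    have e7 : z * U t * -((U t)⁻¹ * ((A + Q * (z + σ t)) * U t) * (U t)⁻¹) =
        -(z * (A + Q * (z + σ t))) := by
      rw [mul_assoc (U t)⁻¹, r, mul_neg, ← mul_assoc, r]
    rw [e4, e5, r, e6, e7]
    noncomm_ring
  refine ⟨fun t ht => ?_, hint, fun t ht => ?_⟩
  · have h1 : y t = ((U t)⁻¹)ᵀ * ((U t)ᵀ * (W t + σ t * U t)) * (U t)⁻¹ := by
      rw [hyeq t ht, ← mul_assoc, ← Matrix.transpose_mul, hUU t ht, Matrix.transpose_one, one_mul]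
    have h2 := (hG t ht).conjTranspose_mul_mul_same (B := (U t)⁻¹)
      (Matrix.mulVec_injective_of_isUnit ((Matrix.isUnit_iff_isUnit_det _).2
        (Matrix.isUnit_nonsing_inv_det _ (hUdet t ht))))
    rw [Matrix.conjTranspose_eq_transpose_of_trivial] at h2
    rw [← h1] at h2
    exact h2
  · have h1 := eq_add_integral_of_hasDerivWithinAt_Ici (hWc.mul hinvc) hZd hint ht
    simp only [Pi.mul_apply] at h1
    rw [← hZ t ht, hU0, hW0, one_mul] at h1
    exact sub_eq_iff_eq_add.1 h1

end InfoExistence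

/-! ### A priori bounds for the information and the covariance -/

section InfoBounds

open scoped Matrix.Norms.L2Operator

variable {n M : ℕ} {T : ℝ} {A Q : RMat n} {S : Fin M → RMat n} {k : Fin M → ℝ → ℕ} {y₀ : RMat n}
  {y : ℝ → RMat n}

theorem IsInfoPath.hasDerivWithinAt_sub (hk : IsStepPath k) (h : IsInfoPath T A Q S k y₀ y) {t : ℝ}
    (ht : t ∈ Ico 0 T) :
    HasDerivWithinAt (fun r => y r - infoSum S fun j => k j r) (infoDrift A Q (y t)) (Ici t) t := by
  have hT : 0 ≤ T := ht.1.trans ht.2.le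
  have hc : ∀ r ∈ Ico 0 T, ContinuousWithinAt (fun s => infoDrift A Q (y s)) (Ici r) r :=
    fun r hr => (continuous_infoDrift A Q).continuousAt.comp_continuousWithinAt
      (rightCont_of_continuousOn_sub hk (h.continuousOn_sub hT) r hr)
  refine hasDerivWithinAt_Ici_of_eq_integral h.integrable ht (fun s hs => ?_)
    ((hc t ht).mono Ioi_subset_Ici_self) (aestronglyMeasurable_of_rightCont hT hc)
  rw [h.equation s hs, h.equation 0 ⟨le_rfl, hT⟩]
  simp

/-- By `(Y⁻¹)' = -Y⁻¹ Y' Y⁻¹`, inversion carries the quadratic Riccati field to the affine Lyapunov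
field. -/
theorem neg_inv_mul_infoDrift_mul_inv {Y : RMat n} (hY : Y.PosDef) :
    -(Y⁻¹ * infoDrift A Q Y * Y⁻¹) = A * Y⁻¹ + Y⁻¹ * Aᵀ + Q := by
  have e1 : Y⁻¹ * infoDrift A Q Y * Y⁻¹ =
      -((Y⁻¹ * Y) * A * Y⁻¹) - Y⁻¹ * Aᵀ * (Y * Y⁻¹) - (Y⁻¹ * Y) * Q * (Y * Y⁻¹) := by
    rw [infoDrift]; noncomm_ring
  rw [e1, hY.inv_mul_self', hY.mul_inv_self']
  noncomm_ring

/-- Between jumps the covariance follows the Lyapunov equation. -/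
theorem IsInfoPath.inv_deriv (hk : IsStepPath k) (h : IsInfoPath T A Q S k y₀ y) {s t : ℝ}
    (hs : 0 ≤ s) (ht : t ≤ T) (hc : ∀ r ∈ Icc s t, ∀ j, k j r = k j s) :
    ContinuousOn (fun r => (y r)⁻¹) (Icc s t) ∧
    ∀ r ∈ Ico s t, HasDerivWithinAt (fun r => (y r)⁻¹)
      (A * (y r)⁻¹ + (y r)⁻¹ * Aᵀ + Q) (Ici r) r := by
  rcases lt_or_ge t s with hts | hst
  · exact ⟨by simp [Icc_eq_empty (not_le.2 hts)], fun r hr => absurd (hr.1.trans hr.2.le) (not_le.2 hts)⟩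
  have hT : 0 ≤ T := hs.trans (hst.trans ht)
  have hmem : ∀ r ∈ Icc s t, r ∈ Icc 0 T := fun r hr => ⟨hs.trans hr.1, hr.2.trans ht⟩
  have hdet : ∀ r ∈ Icc s t, IsUnit (y r).det := fun r hr => (h.posDef r (hmem r hr)).isUnit_det'
  have hyc : ContinuousOn y (Icc s t) := by
    have h1 := ((h.continuousOn_sub hT).mono hmem).add
      (continuousOn_const (c := infoSum S fun j => k j s))
    refine h1.congr fun r hr => ?_
    simp [hc r hr]
  refine ⟨fun r hr => (continuousAt_rmat_inv (hdet r hr)).comp_continuousWithinAt (hyc r hr),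
    fun r hr => ?_⟩
  have hr' : r ∈ Icc s t := ⟨hr.1, hr.2.le⟩
  have h1 := (h.hasDerivWithinAt_sub hk ⟨hs.trans hr.1, hr.2.trans_le ht⟩).add_const
    (infoSum S fun j => k j s)
  have h2 : HasDerivWithinAt y (infoDrift A Q (y r)) (Ici r) r := by
    refine h1.congr_of_eventuallyEq ?_ (by simp [hc r hr'])
    filter_upwards [Ico_mem_nhdsGE hr.2] with x hx
    simp [hc x ⟨hr.1.trans hx.1, hx.2.le⟩]
  have h3 := h2.matrix_inv (hdet r hr')
  rwa [neg_inv_mul_infoDrift_mul_inv (h.posDef r (hmem r hr'))] at h3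

theorem HasDerivWithinAt.matrix_trace {F : ℝ → RMat n} {F' : RMat n} {s : Set ℝ} {t : ℝ}
    (hF : HasDerivWithinAt F F' s t) : HasDerivWithinAt (fun x => (F x).trace) F'.trace s t :=
  (traceCLM n).hasFDerivAt.comp_hasDerivWithinAt t hF

/-- The constant in the growth bounds of the traces of the covariance and the information. -/
noncomputable def growthConst (A : RMat n) : ℝ := 2 * (‖traceCLM n‖ * (‖A‖ * entryConst n))

theorem growthConst_nonneg (A : RMat n) : 0 ≤ growthConst A := by
  have := entryConst_nonneg n
  unfold growthConst; positivity

theorem abs_trace_mul_le {X B : RMat n} (hX : X.PosSemidef) :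
    2 * |(B * X).trace| ≤ growthConst B * X.trace := by
  have h1 := abs_trace_le (B * X)
  have h2 : ‖B * X‖ ≤ ‖B‖ * (entryConst n * X.trace) :=
    (norm_mul_le _ _).trans (mul_le_mul_of_nonneg_left hX.norm_le_trace (norm_nonneg _))
  have h3 := h1.trans (mul_le_mul_of_nonneg_left h2 (ContinuousLinearMap.opNorm_nonneg _))
  unfold growthConst
  linarith

/-- The quadratic term `-Y Q Y` has nonpositive trace, so only the linear terms contribute to
growth. -/
theorem infoDrift_trace_le (hQ : Q.PosSemidef) {Y : RMat n} (hY : Y.PosSemidef) :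
    (infoDrift A Q Y).trace ≤ growthConst A * Y.trace := by
  have h1 : (infoDrift A Q Y).trace = -2 * (A * Y).trace - (Yᵀ * Q * Y).trace := by
    have : (Aᵀ * Y).trace = (A * Y).trace := by
      rw [← Matrix.trace_transpose, Matrix.transpose_mul, Matrix.transpose_transpose,
        hY.transpose_eq, Matrix.trace_mul_comm]
    rw [infoDrift, Matrix.trace_sub, Matrix.trace_sub, Matrix.trace_neg, this,
      Matrix.trace_mul_comm Y A, hY.transpose_eq]
    ring
  rw [h1]
  linarith [abs_trace_mul_le (B := A) hY, neg_abs_le (A * Y).trace,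
    (hQ.transpose_mul_mul Y).trace_nonneg]

theorem lyapunov_trace_le {X : RMat n} (hX : X.PosSemidef) :
    (A * X + X * Aᵀ + Q).trace ≤ growthConst A * X.trace + Q.trace := by
  have h1 : (X * Aᵀ).trace = (A * X).trace := by
    rw [← Matrix.trace_transpose, Matrix.transpose_mul, Matrix.transpose_transpose,
      hX.transpose_eq]
  rw [Matrix.trace_add, Matrix.trace_add, h1]
  linarith [abs_trace_mul_le (B := A) hX, le_abs_self (A * X).trace]

theorem infoSum_trace_le (hS : ∀ j, (S j).PosSemidef) (c : Fin M → ℕ) :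
    (infoSum S c).trace ≤ (∑ j, (S j).trace) * ∑ j, (c j : ℝ) := by
  rw [infoSum, Matrix.trace_sum, Finset.mul_sum]
  refine Finset.sum_le_sum fun j _ => ?_
  rw [Matrix.trace_smul, smul_eq_mul, mul_comm]
  exact mul_le_mul_of_nonneg_right (Finset.single_le_sum (f := fun j => (S j).trace)
    (fun i _ => (hS i).trace_nonneg) (Finset.mem_univ j)) (Nat.cast_nonneg _)

theorem exp_mul_hasDerivWithinAt {f : ℝ → ℝ} {f' c : ℝ} {s : Set ℝ} {t : ℝ}
    (hf : HasDerivWithinAt f f' s t) :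
    HasDerivWithinAt (fun r => Real.exp (-c * r) * f r) (Real.exp (-c * t) * (f' - c * f t)) s t := by
  have h1 : HasDerivAt (fun r => Real.exp (-c * r)) (Real.exp (-c * t) * (-c)) t := by
    simpa using ((hasDerivAt_id t).const_mul (-c)).exp
  convert! h1.hasDerivWithinAt.mul hf using 1
  ring

/-- The information grows at most linearly in the number of measurements. -/
theorem IsInfoPath.trace_le (hQ : Q.PosSemidef) (hS : ∀ j, (S j).PosSemidef) (hk : IsStepPath k)
    (h : IsInfoPath T A Q S k y₀ y) {t : ℝ} (ht : t ∈ Icc 0 T) :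
    (y t).trace ≤ Real.exp (growthConst A * T) *
      (|y₀.trace| + growthConst A * T * (infoSum S fun j => k j t).trace) +
      (infoSum S fun j => k j t).trace := by
  have hT : 0 ≤ T := ht.1.trans ht.2
  set c := growthConst A with hc
  have hc0 : 0 ≤ c := growthConst_nonneg A
  set σ : ℝ → RMat n := fun t => infoSum S fun j => k j t with hσ
  have hσ0 : ∀ s, 0 ≤ (σ s).trace := fun s => (infoSum_posSemidef hS _).trace_nonneg
  have hσm : ∀ s ≤ t, (σ s).trace ≤ (σ t).trace := fun s hs => by
    have := (infoSum_sub_posSemidef hS (c := fun j => k j s) (d := fun j => k j t)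
      fun j => hk.mono j hs).trace_nonneg
    rw [Matrix.trace_sub] at this
    linarith
  -- This combination is nonincreasing: the exponential absorbs the growth rate `c`, and the linear
  -- term, with `σ` frozen at the final time `t`, dominates the contribution `c · tr σ(s)` of the
  -- measurements made so far.
  set f : ℝ → ℝ := fun s => Real.exp (-c * s) * (y s - σ s).trace - c * (σ t).trace * s with hf
  have hsub : ∀ s ∈ Icc 0 t, s ∈ Icc 0 T := fun s hs => ⟨hs.1, hs.2.trans ht.2⟩
  have hfc : ContinuousOn f (Icc 0 t) := by
    have h1 : ContinuousOn (fun s => (y s - σ s).trace) (Icc 0 t) :=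
      (traceCLM n).continuous.comp_continuousOn ((h.continuousOn_sub hT).mono hsub)
    exact ((Continuous.continuousOn (by fun_prop)).mul h1).sub (Continuous.continuousOn (by fun_prop))
  have hfd : ∀ s ∈ Ico 0 t, HasDerivWithinAt f
      (Real.exp (-c * s) * ((infoDrift A Q (y s)).trace - c * (y s - σ s).trace) -
        c * (σ t).trace) (Ici s) s := fun s hs => by
    have h1 := exp_mul_hasDerivWithinAt (c := c)
      (h.hasDerivWithinAt_sub hk ⟨hs.1, hs.2.trans_le ht.2⟩).matrix_trace
    have h2 : HasDerivWithinAt (fun s => c * (σ t).trace * s) (c * (σ t).trace) (Ici s) s := by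
      simpa using (hasDerivWithinAt_id s (Ici s)).const_mul (c * (σ t).trace)
    exact h1.sub h2
  have hle := le_of_hasDerivWithinAt_Ici_nonneg hfc hfd (fun s hs => by
    have hs' : s ∈ Icc 0 T := hsub s ⟨hs.1, hs.2.le⟩
    have h1 := infoDrift_trace_le (A := A) hQ (h.posDef s hs').posSemidef
    have h2 : (infoDrift A Q (y s)).trace - c * (y s - σ s).trace ≤ c * (σ t).trace := by
      rw [Matrix.trace_sub]
      have := mul_le_mul_of_nonneg_left (hσm s hs.2.le) hc0
      linarith
    have h3 : Real.exp (-c * s) ≤ 1 := Real.exp_le_one_iff.2 (by nlinarith [hs.1])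
    have h4 := mul_le_mul_of_nonneg_left h2 (Real.exp_pos (-c * s)).le
    have h5 := mul_le_mul_of_nonneg_right h3 (mul_nonneg hc0 (hσ0 t))
    linarith) (right_mem_Icc.2 ht.1)
  have hy0 : y 0 - σ 0 = y₀ := by
    rw [h.equation 0 ⟨le_rfl, hT⟩]; simp [hσ]
  simp only [hf, mul_zero, Real.exp_zero, one_mul, sub_zero, hy0] at hle
  have h6 : (y t - σ t).trace ≤ Real.exp (c * t) * (y₀.trace + c * t * (σ t).trace) := by
    have h7 : (y t - σ t).trace = Real.exp (c * t) * (Real.exp (-c * t) * (y t - σ t).trace) := by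
      rw [← mul_assoc, ← Real.exp_add]; simp
    rw [h7]
    refine mul_le_mul_of_nonneg_left ?_ (Real.exp_pos _).le
    linarith
  have h8 : Real.exp (c * t) * (|y₀.trace| + c * t * (σ t).trace) ≤
      Real.exp (c * T) * (|y₀.trace| + c * T * (σ t).trace) := by
    have := hσ0 t
    have := ht.1
    gcongr <;> exact ht.2
  have h9 : Real.exp (c * t) * (y₀.trace + c * t * (σ t).trace) ≤
      Real.exp (c * t) * (|y₀.trace| + c * t * (σ t).trace) := by
    gcongr; exact le_abs_self _
  rw [Matrix.trace_sub] at h6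
  linarith

/-- The constant is chosen before the counting paths. This uniformity later turns moments of Poisson
counts into moments of the information. -/
theorem exists_norm_infoPath_le (hT : 0 ≤ T) (hQ : Q.PosSemidef) (hS : ∀ j, (S j).PosSemidef)
    (y₀ : RMat n) : ∃ C, 0 ≤ C ∧ ∀ k : Fin M → ℝ → ℕ, IsStepPath k → ∀ y : ℝ → RMat n,
      IsInfoPath T A Q S k y₀ y → ∀ t ∈ Icc 0 T, ‖y t‖ ≤ C * (1 + ∑ j, (k j t : ℝ)) := by
  set c := growthConst A
  have hc0 : 0 ≤ c := growthConst_nonneg A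
  set s := ∑ j, (S j).trace with hs
  have hs0 : 0 ≤ s := Finset.sum_nonneg fun j _ => (hS j).trace_nonneg
  set a := Real.exp (c * T) * |y₀.trace|
  set b := Real.exp (c * T) * (c * T) * s + s
  have ha : 0 ≤ a := by positivity
  have hb : 0 ≤ b := by positivity
  have he := entryConst_nonneg n
  refine ⟨entryConst n * (a + b), by positivity, fun k hk y h t ht => ?_⟩
  refine (h.posDef t ht).posSemidef.norm_le_trace.trans ?_
  rw [mul_assoc]
  refine mul_le_mul_of_nonneg_left ?_ he
  refine (h.trace_le hQ hS hk ht).trans ?_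
  have h1 := infoSum_trace_le hS fun j => k j t
  have h2 : 0 ≤ ∑ j, (k j t : ℝ) := Finset.sum_nonneg fun j _ => Nat.cast_nonneg _
  set κ := ∑ j, (k j t : ℝ)
  calc _ ≤ Real.exp (c * T) * (|y₀.trace| + c * T * (s * κ)) + s * κ := by gcongr
    _ = a + b * κ := by ring
    _ ≤ (a + b) * (1 + κ) := by nlinarith

/-- The covariance is bounded uniformly over all measurement histories. -/
theorem IsInfoPath.inv_trace_le (hQ : Q.PosSemidef) (hS : ∀ j, (S j).PosSemidef)
    (hk : IsStepPath k) (hy₀ : y₀.PosDef) (h : IsInfoPath T A Q S k y₀ y) :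
    ∀ t ∈ Icc 0 T,
      Real.exp (-growthConst A * t) * ((y t)⁻¹).trace - Q.trace * t ≤ (y₀⁻¹).trace := by
  set c := growthConst A with hc
  have hc0 : 0 ≤ c := growthConst_nonneg A
  have hQ0 := hQ.trace_nonneg
  have hX : ∀ t ∈ Icc 0 T, ((y t)⁻¹).PosSemidef := fun t ht => (h.posDef t ht).inv.posSemidef
  refine Icc_induction (fun hT => ?_) ?_ ?_
  -- Measurements at time `0` are allowed here; they only decrease the inverse.
  · have h0 : y 0 = y₀ + infoSum S fun j => k j 0 := by
      rw [h.equation 0 ⟨le_rfl, hT⟩]; simp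
    have := (inv_sub_inv_add_posSemidef hy₀ (infoSum_posSemidef hS fun j => k j 0)).trace_nonneg
    rw [Matrix.trace_sub] at this
    simp only [mul_zero, Real.exp_zero, one_mul, sub_zero, h0]
    linarith
  · intro t ht hprev
    obtain ⟨u, hu, hsub⟩ := mem_nhdsGE_iff_exists_Ico_subset.1 (hk.right t)
    refine ⟨u, hu, fun s hs hsT => ?_⟩
    obtain ⟨hXc, hXd⟩ := h.inv_deriv hk ht.1 hsT fun r hr => hsub ⟨hr.1, hr.2.trans_lt hs.2⟩
    refine le_trans ?_ (hprev t ⟨ht.1, le_rfl⟩)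
    refine le_of_hasDerivWithinAt_Ici_nonneg (a := t) (b := s)
      (f := fun r => Real.exp (-c * r) *
        ((A * (y r)⁻¹ + (y r)⁻¹ * Aᵀ + Q).trace - c * ((y r)⁻¹).trace) - Q.trace)
      (F := fun r => Real.exp (-c * r) * ((y r)⁻¹).trace - Q.trace * r) ?_ (fun r hr => ?_)
      (fun r hr => ?_) (right_mem_Icc.2 hs.1.le)
    · exact ((Continuous.continuousOn (by fun_prop)).mul
        ((traceCLM n).continuous.comp_continuousOn hXc)).sub (Continuous.continuousOn (by fun_prop))
    · have h2 : HasDerivWithinAt (fun s => Q.trace * s) Q.trace (Ici r) r := by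
        simpa using (hasDerivWithinAt_id r (Ici r)).const_mul Q.trace
      exact (exp_mul_hasDerivWithinAt (c := c) (hXd r hr).matrix_trace).sub h2
    · have hr0 : 0 ≤ r := ht.1.trans hr.1
      have h1 := lyapunov_trace_le (A := A) (Q := Q) (hX r ⟨hr0, hr.2.le.trans hsT⟩)
      have h3 : Real.exp (-c * r) ≤ 1 := Real.exp_le_one_iff.2 (by nlinarith)
      have h2 : (A * (y r)⁻¹ + (y r)⁻¹ * Aᵀ + Q).trace - c * ((y r)⁻¹).trace ≤ Q.trace := by
        linarith
      have h4 := mul_le_mul_of_nonneg_left h2 (Real.exp_pos (-c * r)).le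
      have h5 := mul_le_mul_of_nonneg_right h3 hQ0
      linarith
  · intro t ht hprev
    have hT : 0 ≤ T := ht.1.le.trans ht.2
    obtain ⟨l, hl, hev⟩ := hk.left t
    have hlim := leftLimit_of_continuousOn_sub ht hev (h.continuousOn_sub hT)
    set L := y t - infoSum S (fun j => k j t) + infoSum S l with hL
    set K := Real.exp (c * T) * ((y₀⁻¹).trace + Q.trace * T) with hK
    have hXb : ∀ s ∈ Ico 0 t, ‖(y s)⁻¹‖ ≤ entryConst n * K := fun s hs => by
      have hs' : s ∈ Icc 0 T := ⟨hs.1, hs.2.le.trans ht.2⟩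
      refine (hX s hs').norm_le_trace.trans (mul_le_mul_of_nonneg_left ?_ (entryConst_nonneg n))
      have h1 := hprev s hs
      have h2 : ((y s)⁻¹).trace = Real.exp (c * s) * (Real.exp (-c * s) * ((y s)⁻¹).trace) := by
        rw [← mul_assoc, ← Real.exp_add]; simp
      rw [h2, hK]
      have h3 : Real.exp (-c * s) * ((y s)⁻¹).trace ≤ (y₀⁻¹).trace + Q.trace * T := by
        have := mul_le_mul_of_nonneg_left hs'.2 hQ0
        linarith
      refine mul_le_mul (Real.exp_le_exp.2 (mul_le_mul_of_nonneg_left hs'.2 hc0)) h3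
        (mul_nonneg (Real.exp_pos _).le (hX s hs').trace_nonneg) (Real.exp_pos _).le
    have hLp : L.PosSemidef := posSemidef_of_tendsto hlim (by
      filter_upwards [Ioo_mem_nhdsLT ht.1] with s hs
      exact (h.posDef s ⟨hs.1.le, hs.2.le.trans ht.2⟩).posSemidef)
    -- The left limit is a priori only semidefinite. Bounded inverses before `t` exclude
    -- singularity: for `s` near `t` the product `(y s - L)(y s)⁻¹` has norm below one, and `L (y
    -- s)⁻¹` is one minus it.
    have hLu : IsUnit L := by
      have h0 : Tendsto (fun s => ‖y s - L‖ * (entryConst n * K)) (𝓝[<] t) (𝓝 0) := by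
        have := ((tendsto_iff_norm_sub_tendsto_zero.1 hlim).mul_const (entryConst n * K))
        rwa [zero_mul] at this
      obtain ⟨s, hs, hs'⟩ := ((h0.eventually_lt_const zero_lt_one).and
        (Ioo_mem_nhdsLT ht.1)).exists
      have hs0 : s ∈ Ico 0 t := ⟨hs'.1.le, hs'.2⟩
      have h1 : ‖(y s - L) * (y s)⁻¹‖ < 1 :=
        ((norm_mul_le _ _).trans (mul_le_mul_of_nonneg_left (hXb s hs0) (norm_nonneg _))).trans_lt hs
      have h2 := isUnit_one_sub_of_norm_lt_one h1
      have h3 : 1 - (y s - L) * (y s)⁻¹ = L * (y s)⁻¹ := by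
        rw [sub_mul, (h.posDef s ⟨hs0.1, hs0.2.le.trans ht.2⟩).mul_inv_self']; abel
      rw [h3, Matrix.isUnit_iff_isUnit_det, Matrix.det_mul] at h2
      exact (Matrix.isUnit_iff_isUnit_det _).2 (isUnit_of_mul_isUnit_left h2)
    have hLd : L.PosDef := hLp.posDef_iff_isUnit.2 hLu
    have hinv := (continuousAt_rmat_inv hLd.isUnit_det').tendsto.comp hlim
    have hφ : Tendsto (fun s => Real.exp (-c * s) * ((y s)⁻¹).trace - Q.trace * s) (𝓝[<] t)
        (𝓝 (Real.exp (-c * t) * (L⁻¹).trace - Q.trace * t)) := by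
      have h1 : Tendsto (fun s : ℝ => s) (𝓝[<] t) (𝓝 t) := tendsto_id.mono_left nhdsWithin_le_nhds
      exact (((Real.continuous_exp.tendsto _).comp (h1.const_mul (-c))).mul
        (((traceCLM n).continuous.tendsto _).comp hinv)).sub (h1.const_mul _)
    have hle := le_of_tendsto hφ (b := (y₀⁻¹).trace) (by
      filter_upwards [Ioo_mem_nhdsLT ht.1] with s hs using hprev s ⟨hs.1.le, hs.2⟩)
    -- The jump at `t` adds a semidefinite matrix to `L`, so the trace of the inverse can only drop.
    have hyt : y t = L + (infoSum S (fun j => k j t) - infoSum S l) := by rw [hL]; abel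
    have h4 := (inv_sub_inv_add_posSemidef hLd (infoSum_sub_posSemidef hS hl)).trace_nonneg
    rw [← hyt, Matrix.trace_sub] at h4
    have h5 := mul_le_mul_of_nonneg_left (sub_nonneg.1 h4) (Real.exp_pos (-c * t)).le
    linarith

theorem exists_trace_inv_infoPath_le (hT : 0 ≤ T) (hQ : Q.PosSemidef)
    (hS : ∀ j, (S j).PosSemidef) (hy₀ : y₀.PosDef) :
    ∃ C, 0 ≤ C ∧ ∀ k : Fin M → ℝ → ℕ, IsStepPath k → ∀ y : ℝ → RMat n,
      IsInfoPath T A Q S k y₀ y → ∀ t ∈ Icc 0 T, ((y t)⁻¹).trace ≤ C := by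
  set c := growthConst A with hc
  have hc0 : 0 ≤ c := growthConst_nonneg A
  have hQ0 := hQ.trace_nonneg
  have hp0 := hy₀.inv.posSemidef.trace_nonneg
  refine ⟨Real.exp (c * T) * ((y₀⁻¹).trace + Q.trace * T), by positivity, fun k hk y h t ht => ?_⟩
  have h1 := h.inv_trace_le hQ hS hk hy₀ t ht
  have h2 : ((y t)⁻¹).trace = Real.exp (c * t) * (Real.exp (-c * t) * ((y t)⁻¹).trace) := by
    rw [← mul_assoc, ← Real.exp_add]; simp
  have h3 : Real.exp (-c * t) * ((y t)⁻¹).trace ≤ (y₀⁻¹).trace + Q.trace * T := by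
    have := mul_le_mul_of_nonneg_left ht.2 hQ0
    linarith
  rw [h2]
  exact mul_le_mul (Real.exp_le_exp.2 (mul_le_mul_of_nonneg_left ht.2 hc0)) h3
    (mul_nonneg (Real.exp_pos _).le (h.posDef t ht).inv.posSemidef.trace_nonneg) (Real.exp_pos _).le

end InfoBounds

/-! ### Uniqueness and the one-step expansion of the covariance -/

section InfoEstimates

open scoped Matrix.Norms.L2Operator

variable {n M : ℕ} {T : ℝ} {A Q : RMat n} {S : Fin M → RMat n} {k : Fin M → ℝ → ℕ} {y₀ : RMat n}
  {y : ℝ → RMat n}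

/-- The jumps cancel in the difference of two solutions, which is therefore continuous. Both
solutions are bounded and the quadratic field is Lipschitz on bounded sets, so Grönwall applies. -/
theorem IsInfoPath.unique (hQ : Q.PosSemidef) (hS : ∀ j, (S j).PosSemidef) (hk : IsStepPath k)
    {y₁ y₂ : ℝ → RMat n} (h₁ : IsInfoPath T A Q S k y₀ y₁) (h₂ : IsInfoPath T A Q S k y₀ y₂) :
    ∀ t ∈ Icc 0 T, y₁ t = y₂ t := by
  intro t ht
  have hT : 0 ≤ T := ht.1.trans ht.2
  obtain ⟨C, hC0, hC⟩ := exists_norm_infoPath_le (A := A) hT hQ hS y₀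
  set B := C * (1 + ∑ j, (k j T : ℝ)) with hB
  have hb : ∀ {z}, IsInfoPath T A Q S k y₀ z → ∀ s ∈ Icc 0 T, ‖z s‖ ≤ B := fun hz s hs =>
    (hC k hk _ hz s hs).trans (mul_le_mul_of_nonneg_left (by
      have : ∑ j, (k j s : ℝ) ≤ ∑ j, (k j T : ℝ) := Finset.sum_le_sum fun j _ =>
        Nat.cast_le.2 (hk.mono j hs.2)
      linarith) hC0)
  have hd : ∀ s ∈ Ico 0 T, HasDerivWithinAt (fun r => (y₁ r - infoSum S fun j => k j r) -
      (y₂ r - infoSum S fun j => k j r)) (infoDrift A Q (y₁ s) - infoDrift A Q (y₂ s)) (Ici s) s :=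
    fun s hs => (h₁.hasDerivWithinAt_sub hk hs).sub (h₂.hasDerivWithinAt_sub hk hs)
  have h0 : (y₁ 0 - infoSum S fun j => k j 0) - (y₂ 0 - infoSum S fun j => k j 0) = 0 := by
    rw [h₁.equation 0 ⟨le_rfl, hT⟩, h₂.equation 0 ⟨le_rfl, hT⟩]; simp
  have := eq_zero_of_abs_deriv_le_mul_abs_self_of_eq_zero_right
    (f := fun r => (y₁ r - infoSum S fun j => k j r) - (y₂ r - infoSum S fun j => k j r)) (K := ‖A‖ + ‖Aᵀ‖ + ‖Q‖ * B + B * ‖Q‖)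
    ((h₁.continuousOn_sub hT).sub (h₂.continuousOn_sub hT)) hd h0 (fun s hs => ?_) t ht
  · have h3 : y₁ t - y₂ t = 0 := by rw [← this]; abel
    exact sub_eq_zero.1 h3
  · have hs' : s ∈ Icc 0 T := ⟨hs.1, hs.2.le⟩
    have e1 : (y₁ s - infoSum S fun j => k j s) - (y₂ s - infoSum S fun j => k j s) =
        y₁ s - y₂ s := by abel
    rw [e1]
    set D := y₁ s - y₂ s with hD
    have e2 : infoDrift A Q (y₁ s) - infoDrift A Q (y₂ s) =
        -(D * A + Aᵀ * D + D * (Q * y₁ s) + y₂ s * Q * D) := by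
      simp only [infoDrift, hD]; noncomm_ring
    rw [e2, norm_neg]
    have n1 := norm_mul_le D A
    have n2 := norm_mul_le Aᵀ D
    have n3 : ‖D * (Q * y₁ s)‖ ≤ ‖D‖ * (‖Q‖ * B) :=
      (norm_mul_le _ _).trans (mul_le_mul_of_nonneg_left ((norm_mul_le _ _).trans
        (mul_le_mul_of_nonneg_left (hb h₁ s hs') (norm_nonneg _))) (norm_nonneg _))
    have n4 : ‖y₂ s * Q * D‖ ≤ B * ‖Q‖ * ‖D‖ :=
      (norm_mul_le _ _).trans (mul_le_mul_of_nonneg_right ((norm_mul_le _ _).trans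
        (mul_le_mul_of_nonneg_right (hb h₂ s hs') (norm_nonneg _))) (norm_nonneg _))
    refine (norm_add₄_le).trans ?_
    linarith

theorem norm_infoDrift_le (A Q Y : RMat n) :
    ‖infoDrift A Q Y‖ ≤ (‖A‖ + ‖Aᵀ‖ + ‖Q‖) * (1 + ‖Y‖) ^ 2 := by
  have n1 := norm_mul_le Y A
  have n2 := norm_mul_le Aᵀ Y
  have n3 : ‖Y * Q * Y‖ ≤ ‖Y‖ * ‖Q‖ * ‖Y‖ :=
    (norm_mul_le _ _).trans (mul_le_mul_of_nonneg_right (norm_mul_le _ _) (norm_nonneg _))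
  have n4 : ‖infoDrift A Q Y‖ ≤ ‖Y * A‖ + ‖Aᵀ * Y‖ + ‖Y * Q * Y‖ := by
    refine (norm_sub_le _ _).trans (add_le_add_left ((norm_sub_le _ _).trans ?_) _)
    rw [norm_neg]
  have hA := norm_nonneg A
  have hA' := norm_nonneg Aᵀ
  have hQ := norm_nonneg Q
  have hY := norm_nonneg Y
  refine n4.trans ((add_le_add (add_le_add n1 n2) n3).trans ?_)
  have h1 : ‖Y‖ ≤ (1 + ‖Y‖) ^ 2 := by nlinarith
  have h2 : ‖Y‖ * ‖Y‖ ≤ (1 + ‖Y‖) ^ 2 := by nlinarith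
  have e1 := mul_le_mul_of_nonneg_left h1 hA
  have e2 := mul_le_mul_of_nonneg_left h1 hA'
  have e3 := mul_le_mul_of_nonneg_left h2 hQ
  linarith

theorem norm_lyapunov_le (A Q X : RMat n) :
    ‖A * X + X * Aᵀ + Q‖ ≤ (‖A‖ + ‖Aᵀ‖) * ‖X‖ + ‖Q‖ := by
  have n1 := norm_mul_le A X
  have n2 := norm_mul_le X Aᵀ
  refine (norm_add₃_le).trans ?_
  linarith

theorem IsInfoPath.sub_eq (h : IsInfoPath T A Q S k y₀ y) {s t : ℝ} (hs : 0 ≤ s) (hst : s ≤ t)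
    (ht : t ≤ T) : y t = y s + (∫ r in s..t, infoDrift A Q (y r)) +
      (infoSum S (fun j => k j t) - infoSum S fun j => k j s) := by
  have hT : 0 ≤ T := hs.trans (hst.trans ht)
  have i1 : IntervalIntegrable (fun s => infoDrift A Q (y s)) volume 0 s :=
    h.integrable.mono_set (by rw [uIcc_of_le hs, uIcc_of_le hT]; exact Icc_subset_Icc_right (hst.trans ht))
  have i2 : IntervalIntegrable (fun s => infoDrift A Q (y s)) volume s t :=
    h.integrable.mono_set (by rw [uIcc_of_le hst, uIcc_of_le hT]; exact Icc_subset_Icc hs ht)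
  rw [h.equation t ⟨hs.trans hst, ht⟩, h.equation s ⟨hs, hst.trans ht⟩,
    ← intervalIntegral.integral_add_adjacent_intervals i1 i2]
  abel

variable {m : Fin M → ℕ} {H : ∀ j, Matrix (Fin (m j)) (Fin n) ℝ}
  {R : ∀ j, Matrix (Fin (m j)) (Fin (m j)) ℝ}

set_option maxHeartbeats 1000000 in
/-- The one-step expansion of the covariance: over `(s, t]` it moves by the Lyapunov drift and by
the jump maps evaluated at time `s`, up to an error of second order in expectation. -/
theorem exists_increment_estimate (hT : 0 ≤ T) (hQ : Q.PosSemidef) (hR : ∀ j, (R j).PosDef)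
    (hy₀ : y₀.PosDef) : ∃ C, 0 ≤ C ∧ ∀ k : Fin M → ℝ → ℕ, IsStepPath k → ∀ y : ℝ → RMat n,
      IsInfoPath T A Q (fun j => infoContribution (H j) (R j)) k y₀ y → ∀ s t, 0 ≤ s → s ≤ t →
      t ≤ T → ‖(y t)⁻¹ - (y s)⁻¹ - (∫ r in s..t, (A * (y r)⁻¹ + (y r)⁻¹ * Aᵀ + Q)) +
        ∑ j, ((k j t : ℝ) - k j s) • jumpMap (H j) (R j) (y s)⁻¹‖ ≤
      C * ((1 + ∑ j, (k j s : ℝ)) ^ 2 * (t - s) * (∑ j, (k j t : ℝ) - ∑ j, (k j s : ℝ)) +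
        (∑ j, (k j t : ℝ) - ∑ j, (k j s : ℝ)) *
          ((∑ j, (k j t : ℝ) - ∑ j, (k j s : ℝ)) - 1)) := by
  set S : Fin M → RMat n := fun j => infoContribution (H j) (R j) with hSdef
  have hS : ∀ j, (S j).PosSemidef := fun j => infoContribution_posSemidef (H j) (hR j)
  obtain ⟨Cy, hCy0, hCy⟩ := exists_norm_infoPath_le (A := A) hT hQ hS y₀
  obtain ⟨Ct, hCt0, hCt⟩ := exists_trace_inv_infoPath_le (A := A) hT hQ hS hy₀
  have hE := entryConst_nonneg n
  set Cx := entryConst n * Ct with hCx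
  have hCx0 : 0 ≤ Cx := by positivity
  set Cd := (‖A‖ + ‖Aᵀ‖) * Cx + ‖Q‖ with hCd
  have hCd0 : 0 ≤ Cd := by positivity
  set Cr := (‖A‖ + ‖Aᵀ‖ + ‖Q‖) * (1 + 2 * Cy) ^ 2 with hCr
  have hCr0 : 0 ≤ Cr := by positivity
  -- The first two terms serve a single jump: the error from moving it to time `s`, and the drift.
  -- The last term is the crude bound for two or more jumps: both covariances, the drift, and the
  -- jump maps.
  set C := Cx * Cr * Cx + Cd + (2 * Cx + Cd * T + Cx) with hC
  refine ⟨C, by positivity, fun k hk y h s t hs hst ht => ?_⟩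
  have hmem : ∀ r ∈ Icc s t, r ∈ Icc 0 T := fun r hr => ⟨hs.trans hr.1, hr.2.trans ht⟩
  have hsm : s ∈ Icc s t := ⟨le_rfl, hst⟩
  have htm : t ∈ Icc s t := ⟨hst, le_rfl⟩
  have hXn : ∀ r ∈ Icc s t, ‖(y r)⁻¹‖ ≤ Cx := fun r hr =>
    (h.posDef r (hmem r hr)).inv.posSemidef.norm_le_trace.trans
      (mul_le_mul_of_nonneg_left (hCt k hk y h r (hmem r hr)) hE)
  have hsubX : ∀ {Z : RMat n}, Z.PosSemidef → ((y s)⁻¹ - Z).PosSemidef → ‖Z‖ ≤ Cx :=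
    fun hZ hZ' => (norm_le_of_posSemidef_sub hZ hZ').trans
      (mul_le_mul_of_nonneg_left (hCt k hk y h s (hmem s hsm)) hE)
  have hXs := (h.posDef s (hmem s hsm)).inv
  have hdrift : ‖∫ r in s..t, (A * (y r)⁻¹ + (y r)⁻¹ * Aᵀ + Q)‖ ≤ Cd * (t - s) := by
    have := intervalIntegral.norm_integral_le_of_norm_le_const (a := s) (b := t) (C := Cd)
      (f := fun r => A * (y r)⁻¹ + (y r)⁻¹ * Aᵀ + Q) (fun r hr => by
        rw [uIoc_of_le hst] at hr
        refine (norm_lyapunov_le A Q _).trans ?_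
        have := hXn r ⟨hr.1.le, hr.2⟩
        rw [hCd]; gcongr)
    rwa [abs_of_nonneg (sub_nonneg.2 hst)] at this
  have hts : 0 ≤ t - s := sub_nonneg.2 hst
  have hsumle : ∑ j, k j s ≤ ∑ j, k j t := Finset.sum_le_sum fun j _ => hk.mono j hst
  obtain ⟨d, hd⟩ := Nat.exists_eq_add_of_le hsumle
  have hdR : ∑ j, (k j t : ℝ) - ∑ j, (k j s : ℝ) = d := by
    have : (∑ j, (k j t : ℝ)) = ∑ j, (k j s : ℝ) + d := by exact_mod_cast hd
    rw [this]; ring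
  have hκ0 : 0 ≤ ∑ j, (k j s : ℝ) := Finset.sum_nonneg fun j _ => Nat.cast_nonneg _
  rw [hdR]
  set κ := ∑ j, (k j s : ℝ) with hκ
  -- Here `d` is the number of jumps in `(s, t]`. Without a jump the expansion is exact; one jump
  -- costs a multiple of `t - s`; from two jumps on, `d (d - 1)` absorbs any bounded error.
  rcases Nat.lt_or_ge d 2 with hd2 | hd2
  · interval_cases d
    · have hkt : ∀ j, k j t = k j s := by
        have h1 : ∑ j, k j s = ∑ j, k j t := by omega
        exact fun j => ((Finset.sum_eq_sum_iff_of_le fun i _ => hk.mono i hst).1 h1 j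
          (Finset.mem_univ j)).symm
      have hconst : ∀ r ∈ Icc s t, ∀ j, k j r = k j s := fun r hr j =>
        le_antisymm ((hk.mono j hr.2).trans (hkt j).le) (hk.mono j hr.1)
      obtain ⟨hc, hder⟩ := h.inv_deriv hk hs ht hconst
      have hfc : ContinuousOn (fun r => A * (y r)⁻¹ + (y r)⁻¹ * Aᵀ + Q) (Icc s t) :=
        ((continuousOn_const.mul hc).add (hc.mul continuousOn_const)).add continuousOn_const
      have hF := eq_add_integral_of_hasDerivWithinAt_Ici hc hder
        (hfc.intervalIntegrable_of_Icc hst) htm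
      have hz : (y t)⁻¹ - (y s)⁻¹ - (∫ r in s..t, (A * (y r)⁻¹ + (y r)⁻¹ * Aᵀ + Q)) +
        ∑ j, ((k j t : ℝ) - k j s) • jumpMap (H j) (R j) (y s)⁻¹ = 0 := by
        simp only [hkt, sub_self, zero_smul, Finset.sum_const_zero, add_zero]
        rw [hF]; abel
      rw [hz]; simp
    · obtain ⟨j₀, hj₀, hoth⟩ : ∃ j₀, k j₀ t = k j₀ s + 1 ∧ ∀ j ≠ j₀, k j t = k j s := by
        have h1 : ∑ j, (k j t - k j s) = 1 := by
          have := Finset.sum_tsub_distrib (s := Finset.univ) (f := fun j => k j t)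
            (g := fun j => k j s) (fun j _ => hk.mono j hst)
          omega
        obtain ⟨j₀, -, hj₀⟩ := Finset.exists_ne_zero_of_sum_ne_zero
          (h1.trans_ne one_ne_zero)
        have h2 := Finset.add_sum_erase Finset.univ (fun j => k j t - k j s) (Finset.mem_univ j₀)
        have h3 : ∑ j ∈ Finset.univ.erase j₀, (k j t - k j s) = 0 := by omega
        refine ⟨j₀, by have := hk.mono j₀ hst; omega, fun j hj => ?_⟩
        have h4 := Finset.sum_eq_zero_iff.1 h3 j (Finset.mem_erase.2 ⟨hj, Finset.mem_univ j⟩)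
        have := hk.mono j hst
        omega
      have hsum : ∀ f : Fin M → RMat n, ∑ j, ((k j t : ℝ) - k j s) • f j = f j₀ := fun f => by
        rw [Finset.sum_eq_single j₀]
        · simp [hj₀]
        · intro j _ hj; simp [hoth j hj]
        · simp
      have hσ : infoSum S (fun j => k j t) - infoSum S (fun j => k j s) = S j₀ := by
        rw [← hsum S]; simp only [infoSum, sub_smul, Finset.sum_sub_distrib]
      have hy := h.sub_eq hs hst ht
      rw [hσ] at hy
      rw [hsum fun j => jumpMap (H j) (R j) (y s)⁻¹]
      have hYs := h.posDef s (hmem s hsm)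
      have hYS := hYs.add_posSemidef (hS j₀)
      set J := (y s + S j₀)⁻¹ with hJ
      have hJe : (y s)⁻¹ - jumpMap (H j₀) (R j₀) (y s)⁻¹ = J := by
        rw [sub_jumpMap_eq_inv _ (hR j₀) hXs, Matrix.nonsing_inv_nonsing_inv _ hYs.isUnit_det']
      have hJn : ‖J‖ ≤ Cx := by
        refine hsubX hYS.inv.posSemidef ?_
        exact inv_sub_inv_add_posSemidef hYs (hS j₀)
      set I := ∫ r in s..t, infoDrift A Q (y r) with hI
      -- Resolvent identity: `J` is the covariance if the jump happens at time `s` and nothing else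
      -- moves. The true time of the jump does not matter, since only the integrated drift `I`
      -- separates `y t` from `J⁻¹`.
      have hXJ : (y t)⁻¹ - J = -((y t)⁻¹ * I * J) := by
        have h1 : I = y t - (y s + S j₀) := by rw [hy]; abel
        rw [h1, mul_sub, sub_mul, (h.posDef t (hmem t htm)).inv_mul_self', one_mul, mul_assoc,
          hYS.mul_inv_self', mul_one]
        abel
      have hIn : ‖I‖ ≤ Cr * (1 + κ) ^ 2 * (t - s) := by
        have := intervalIntegral.norm_integral_le_of_norm_le_const (a := s) (b := t)
          (C := Cr * (1 + κ) ^ 2) (f := fun r => infoDrift A Q (y r)) (fun r hr => by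
            rw [uIoc_of_le hst] at hr
            refine (norm_infoDrift_le A Q _).trans ?_
            have h1 := hCy k hk y h r (hmem r ⟨hr.1.le, hr.2⟩)
            have h2 : ∑ j, (k j r : ℝ) ≤ κ + 1 := by
              have h3 : ∑ j, k j r ≤ ∑ j, k j t := Finset.sum_le_sum fun j _ => hk.mono j hr.2
              have h4 : (∑ j, (k j r : ℝ)) ≤ ∑ j, (k j t : ℝ) := by exact_mod_cast h3
              have h5 : ((1 : ℕ) : ℝ) = 1 := Nat.cast_one
              linarith
            have h6 : 1 + ‖y r‖ ≤ (1 + 2 * Cy) * (1 + κ) := by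
              have := mul_le_mul_of_nonneg_left h2 hCy0
              nlinarith [mul_nonneg hCy0 hκ0]
            have h7 : (1 + ‖y r‖) ^ 2 ≤ ((1 + 2 * Cy) * (1 + κ)) ^ 2 := by gcongr
            calc _ ≤ (‖A‖ + ‖Aᵀ‖ + ‖Q‖) * ((1 + 2 * Cy) * (1 + κ)) ^ 2 := by gcongr
              _ = _ := by rw [hCr]; ring)
        rwa [abs_of_nonneg hts] at this
      have hXJn : ‖(y t)⁻¹ * I * J‖ ≤ Cx * (Cr * (1 + κ) ^ 2 * (t - s)) * Cx := by
        refine (norm_mul_le _ _).trans (mul_le_mul ((norm_mul_le _ _).trans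
          (mul_le_mul (hXn t htm) hIn (norm_nonneg _) hCx0)) hJn (norm_nonneg _) (by positivity))
      have he : (y t)⁻¹ - (y s)⁻¹ - (∫ r in s..t, (A * (y r)⁻¹ + (y r)⁻¹ * Aᵀ + Q)) +
          jumpMap (H j₀) (R j₀) (y s)⁻¹ =
          -((y t)⁻¹ * I * J) - ∫ r in s..t, (A * (y r)⁻¹ + (y r)⁻¹ * Aᵀ + Q) := by
        rw [← hXJ, ← hJe]; abel
      rw [he]
      refine (norm_sub_le _ _).trans ?_
      rw [norm_neg]
      have h1 : Cd * (t - s) ≤ Cd * ((1 + κ) ^ 2 * (t - s)) :=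
        mul_le_mul_of_nonneg_left (le_mul_of_one_le_left hts (by nlinarith)) hCd0
      have h2 : 0 ≤ (2 * Cx + Cd * T + Cx) * ((1 + κ) ^ 2 * (t - s)) := by positivity
      have e : C * ((1 + κ) ^ 2 * (t - s) * ((1 : ℕ) : ℝ) + ((1 : ℕ) : ℝ) * (((1 : ℕ) : ℝ) - 1)) =
          Cx * (Cr * (1 + κ) ^ 2 * (t - s)) * Cx + Cd * ((1 + κ) ^ 2 * (t - s)) +
            (2 * Cx + Cd * T + Cx) * ((1 + κ) ^ 2 * (t - s)) := by rw [hC]; push_cast; ring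
      rw [e]
      linarith
  · have hd' : (2 : ℝ) ≤ d := by exact_mod_cast hd2
    have hg : ∀ j, ‖jumpMap (H j) (R j) (y s)⁻¹‖ ≤ Cx := fun j =>
      hsubX (jumpMap_posSemidef _ (hR j) hXs) (sub_jumpMap_posSemidef _ (hR j) hXs)
    have hgs : ‖∑ j, ((k j t : ℝ) - k j s) • jumpMap (H j) (R j) (y s)⁻¹‖ ≤ d * Cx := by
      rw [← hdR, hκ, ← Finset.sum_sub_distrib, Finset.sum_mul]
      refine (norm_sum_le _ _).trans (Finset.sum_le_sum fun j _ => ?_)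
      have : (0 : ℝ) ≤ (k j t : ℝ) - k j s := sub_nonneg.2 (Nat.cast_le.2 (hk.mono j hst))
      rw [norm_smul, Real.norm_of_nonneg this]
      exact mul_le_mul_of_nonneg_left (hg j) this
    have hn := norm_add_le ((y t)⁻¹ - (y s)⁻¹ - (∫ r in s..t, (A * (y r)⁻¹ + (y r)⁻¹ * Aᵀ + Q)))
      (∑ j, ((k j t : ℝ) - k j s) • jumpMap (H j) (R j) (y s)⁻¹)
    have hn2 := norm_sub_le ((y t)⁻¹ - (y s)⁻¹)
      (∫ r in s..t, (A * (y r)⁻¹ + (y r)⁻¹ * Aᵀ + Q))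
    have hn3 := norm_sub_le (y t)⁻¹ (y s)⁻¹
    have h1 := hXn t htm
    have h2 := hXn s hsm
    have h3 : Cd * (t - s) ≤ Cd * T := mul_le_mul_of_nonneg_left (by linarith) hCd0
    have h4 : (d : ℝ) ≤ d * (d - 1) := by nlinarith
    have h5 : (1 : ℝ) ≤ d * (d - 1) := by nlinarith
    have h6 : (2 * Cx + Cd * T) ≤ (2 * Cx + Cd * T) * (d * (d - 1)) :=
      le_mul_of_one_le_right (by positivity) h5
    have h7 : d * Cx ≤ d * (d - 1) * Cx := mul_le_mul_of_nonneg_right h4 hCx0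
    have h8 : 0 ≤ C * ((1 + κ) ^ 2 * (t - s) * d) := by positivity
    have h9 : 0 ≤ (Cx * Cr * Cx + Cd) * (d * (d - 1)) := by positivity
    have e : C * ((1 + κ) ^ 2 * (t - s) * d + d * (d - 1)) = C * ((1 + κ) ^ 2 * (t - s) * d) +
        ((Cx * Cr * Cx + Cd) * (d * (d - 1)) + ((2 * Cx + Cd * T) * (d * (d - 1)) +
          d * (d - 1) * Cx)) := by rw [hC]; ring
    rw [e]
    linarith

end InfoEstimates

/-! ### From the covariance equation to the information equation -/

section CovariancePaths

open scoped Matrix.Norms.L2Operator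

variable {n M : ℕ} {T : ℝ} {A Q : RMat n}

/-- With no sensors at all the filter follows the Lyapunov equation, so the existence theory above
applies to it. -/
theorem isStepPath_zero : IsStepPath (fun (_ : Fin 0) (_ : ℝ) => 0) :=
  ⟨fun j => j.elim0, fun _ => Eventually.of_forall fun _ j => j.elim0, ⟨0, fun j => j.elim0⟩⟩

/-- A solution of the Lyapunov equation that starts from a positive definite matrix stays positive
definite, and its inverse solves the Riccati equation. -/
theorem lyapunov_inv (hQ : Q.PosSemidef) {s t : ℝ} (hst : s ≤ t) {q : ℝ → RMat n}
    (hq : ContinuousOn q (Icc s t)) (hqs : (q s).PosDef)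
    (heq : ∀ r ∈ Icc s t, q r = q s + ∫ x in s..r, (A * q x + q x * Aᵀ + Q)) :
    ∀ r ∈ Icc s t, (q r).PosDef ∧ (q r)⁻¹ = (q s)⁻¹ + ∫ x in s..r, infoDrift A Q (q x)⁻¹ := by
  have hT : 0 ≤ t - s := sub_nonneg.2 hst
  have hk := isStepPath_zero
  -- The Riccati solution without measurements stays positive definite. Its inverse and the shifted
  -- `q` solve the same affine equation, so Grönwall identifies them.
  have h := isInfoPath_inv_covSolution (A := A) hT hQ (S := fun _ : Fin 0 => 0) (fun j => j.elim0)
    hk hqs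
  set y : ℝ → RMat n := fun t => (covSolution A Q (fun _ : Fin 0 => 0) (fun _ _ => 0) (q s) t)⁻¹
    with hy
  have hy0 : y 0 = (q s)⁻¹ := by
    have := h.equation 0 ⟨le_rfl, hT⟩
    simpa [infoSum] using this
  obtain ⟨hXc, hXd⟩ := h.inv_deriv hk le_rfl le_rfl fun r _ j => j.elim0
  have hshift : ContinuousOn (fun r => q (s + r)) (Icc 0 (t - s)) :=
    hq.comp (Continuous.continuousOn (by fun_prop)) fun r hr =>
      ⟨by linarith [hr.1], by linarith [hr.2]⟩
  have hfc : ContinuousOn (fun x => A * q x + q x * Aᵀ + Q) (Icc s t) :=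
    ((continuousOn_const.mul hq).add (hq.mul continuousOn_const)).add continuousOn_const
  have hqd : ∀ r ∈ Ico 0 (t - s), HasDerivWithinAt (fun r => q (s + r))
      (A * q (s + r) + q (s + r) * Aᵀ + Q) (Ici r) r := by
    intro r hr
    have hr' : s + r ∈ Ico s t := ⟨by linarith [hr.1], by linarith [hr.2]⟩
    have h1 := hasDerivWithinAt_Ici_of_eq_integral (hfc.intervalIntegrable_of_Icc hst) hr' heq
      ((hfc (s + r) ⟨hr'.1, hr'.2.le⟩).mono_of_mem_nhdsWithin
        (mem_of_superset (Ioo_mem_nhdsGT hr'.2) fun x hx => ⟨hr'.1.trans hx.1.le, hx.2.le⟩))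
      (hfc.aestronglyMeasurable measurableSet_Icc)
    have h2 : HasDerivWithinAt (fun r : ℝ => s + r) 1 (Ici r) r :=
      ((hasDerivAt_id r).const_add s).hasDerivWithinAt
    have h3 := h1.scomp r h2 (fun x hx => by simpa using hx)
    rw [one_smul] at h3
    exact h3
  have hzero := eq_zero_of_abs_deriv_le_mul_abs_self_of_eq_zero_right
    (f := fun r => q (s + r) - (y r)⁻¹)
    (f' := fun r => (A * q (s + r) + q (s + r) * Aᵀ + Q) - (A * (y r)⁻¹ + (y r)⁻¹ * Aᵀ + Q))
    (K := ‖A‖ + ‖Aᵀ‖) (hshift.sub hXc) (fun r hr => (hqd r hr).sub (hXd r hr))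
    (by rw [hy0, Matrix.nonsing_inv_nonsing_inv _ hqs.isUnit_det', add_zero, sub_self])
    (fun r hr => by
      set D := q (s + r) - (y r)⁻¹ with hD
      have : (A * q (s + r) + q (s + r) * Aᵀ + Q) - (A * (y r)⁻¹ + (y r)⁻¹ * Aᵀ + Q) =
          A * D + D * Aᵀ := by rw [hD]; noncomm_ring
      rw [this]
      have n1 := norm_mul_le A D
      have n2 := norm_mul_le D Aᵀ
      refine (norm_add_le _ _).trans ?_
      linarith)
  have hqy : ∀ r ∈ Icc 0 (t - s), (q (s + r))⁻¹ = y r := fun r hr => by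
    rw [sub_eq_zero.1 (hzero r hr),
      Matrix.nonsing_inv_nonsing_inv _ (h.posDef r hr).isUnit_det']
  intro r hr
  have hr' : r - s ∈ Icc 0 (t - s) := ⟨by linarith [hr.1], by linarith [hr.2]⟩
  have e1 : s + (r - s) = r := by ring
  have e2 := hqy _ hr'
  have e3 := hzero _ hr'
  rw [e1] at e2 e3
  refine ⟨sub_eq_zero.1 e3 ▸ (h.posDef _ hr').inv, ?_⟩
  rw [e2, h.equation _ hr']
  have hz : infoSum (fun _ : Fin 0 => (0 : RMat n)) (fun _ => 0) = 0 := by simp [infoSum]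
  rw [hz, add_zero]
  congr 1
  have e4 : ∫ x in s..r, infoDrift A Q (q x)⁻¹ =
      ∫ x in (0 : ℝ)..(r - s), infoDrift A Q (q (s + x))⁻¹ := by
    rw [intervalIntegral.integral_comp_add_left (fun x => infoDrift A Q (q x)⁻¹)]
    simp
  rw [e4]
  refine intervalIntegral.integral_congr fun x hx => ?_
  rw [uIcc_of_le hr'.1] at hx
  show _ = infoDrift A Q (q (s + x))⁻¹
  rw [hqy x ⟨hx.1, hx.2.trans hr'.2⟩]

theorem countJump_eq {k : ℝ → ℕ} {t : ℝ} {l : ℕ} (h : ∀ᶠ s in 𝓝[<] t, k s = l) :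
    countJump k t = k t - l := by
  rw [countJump, leftLim_eq_of_tendsto
    (tendsto_const_nhds.congr' (h.mono fun _ hs => hs.symm))]

/-- The path is injective on its jump times and bounded by `k t` there. Finiteness matters because a
`finsum` with infinite support would be zero by convention. -/
theorem finite_support_countJump {k : ℝ → ℕ} (hk : Monotone k) (t : ℝ) :
    {s ∈ Ioc 0 t | countJump k s ≠ 0}.Finite := by
  refine Set.Finite.of_finite_image (f := k)
    ((Set.finite_Iic (k t)).subset (by rintro _ ⟨s, hs, rfl⟩; exact hk hs.1.2)) ?_
  have key : ∀ x y, x < y → countJump k y ≠ 0 → k x < k y := fun x y hxy hy => by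
    obtain ⟨l, hl, hev⟩ := exists_eventually_eq_left (f := k) (t := y)
      (Eventually.of_forall fun a => hk.monotoneOn _)
    rw [countJump_eq hev] at hy
    obtain ⟨z, hz, hz'⟩ := (hev.and (Ioo_mem_nhdsLT hxy)).exists
    have := hk hz'.1.le
    omega
  intro x hx y hy hxy
  by_contra hne
  rcases lt_or_gt_of_ne hne with h | h
  · exact absurd hxy (key x y h hy.2).ne
  · exact absurd hxy (key y x h hx.2).ne'

end CovariancePaths

/-! ### Solving the covariance equation jump by jump -/

section CovariancePaths

open scoped Matrix.Norms.L2Operator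

variable {n M : ℕ} {T : ℝ} {A Q : RMat n} {m : Fin M → ℕ} {H : ∀ j, Matrix (Fin (m j)) (Fin n) ℝ}
  {R : ∀ j, Matrix (Fin (m j)) (Fin (m j)) ℝ} {k : Fin M → ℝ → ℕ} {p : ℝ → RMat n}

theorem IsCovariancePath.intervalIntegrable (h : IsCovariancePath T A Q H R k p) {s t : ℝ}
    (hs : 0 ≤ s) (hst : s ≤ t) (ht : t ≤ T) :
    IntervalIntegrable (fun x => A * p x + p x * Aᵀ + Q) volume s t := by
  have hT : 0 ≤ T := hs.trans (hst.trans ht)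
  have hc : Continuous fun X : RMat n => A * X + X * Aᵀ + Q := by fun_prop
  refine IntervalIntegrable.mono_set (intervalIntegrable_of_cadlag hT (fun t ht => ?_)
    fun t ht => ?_) (by rw [uIcc_of_le hst, uIcc_of_le hT]; exact Icc_subset_Icc hs ht)
  · exact hc.continuousAt.comp_continuousWithinAt (h.rightCont t ht)
  · obtain ⟨l, hl⟩ := h.leftLimit t ht
    exact ⟨_, (hc.tendsto _).comp hl⟩

/-- The covariance equation over an interval without jumps in its interior. -/
theorem IsCovariancePath.sub_eq (hk : IsStepPath k) (h : IsCovariancePath T A Q H R k p) {s t : ℝ}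
    (hs : 0 ≤ s) (hst : s < t) (ht : t ≤ T) (hc : ∀ r ∈ Ico s t, ∀ j, k j r = k j s) :
    p t = p s + (∫ x in s..t, (A * p x + p x * Aᵀ + Q)) -
      ∑ j, ((k j t : ℝ) - k j s) • jumpMap (H j) (R j) (Function.leftLim p t) := by
  have hint : ∀ r, r ∈ Icc 0 T → Matrix.of (fun a b => ∫ x in (0 : ℝ)..r,
      (A * p x + p x * Aᵀ + Q) a b) = ∫ x in (0 : ℝ)..r, (A * p x + p x * Aᵀ + Q) := by
    intro r hr
    ext a b
    have := h.intervalIntegrable le_rfl hr.1 hr.2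
    rw [Matrix.of_apply, intervalIntegral.integral_of_le hr.1, intervalIntegral.integral_of_le hr.1]
    exact (integral_matrix_apply
      ((intervalIntegrable_iff_integrableOn_Ioc_of_le hr.1).1 this) a b).symm
  have hs' : s ∈ Icc 0 T := ⟨hs, hst.le.trans ht⟩
  have ht' : t ∈ Icc 0 T := ⟨hs.trans hst.le, ht⟩
  have hjump : ∀ j, ∑ᶠ x ∈ Ioc 0 t, (countJump (k j) x : ℝ) •
      jumpMap (H j) (R j) (Function.leftLim p x) = (∑ᶠ x ∈ Ioc 0 s, (countJump (k j) x : ℝ) •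
      jumpMap (H j) (R j) (Function.leftLim p x)) +
      ((k j t : ℝ) - k j s) • jumpMap (H j) (R j) (Function.leftLim p t) := by
    intro j
    set f : ℝ → RMat n := fun x => (countJump (k j) x : ℝ) •
      jumpMap (H j) (R j) (Function.leftLim p x) with hf
    have hfin : ∀ r, (Ioc 0 r ∩ Function.support f).Finite := fun r =>
      (finite_support_countJump (hk.mono j) r).subset fun x hx => ⟨hx.1, fun h0 => hx.2 (by
        simp [hf, h0])⟩
    have hfin2 : (Ioc s t ∩ Function.support f).Finite :=
      (hfin t).subset (inter_subset_inter_left _ (Ioc_subset_Ioc_left hs))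
    rw [← Ioc_union_Ioc_eq_Ioc hs hst.le, finsum_mem_union' (Ioc_disjoint_Ioc_of_le le_rfl)
      (hfin s) hfin2]
    congr 1
    have hzero : ∀ x ∈ Ioo s t, f x = 0 := fun x hx => by
      have : countJump (k j) x = k j x - k j s := countJump_eq (by
        filter_upwards [Ioo_mem_nhdsLT hx.1] with r hr using hc r ⟨hr.1.le, hr.2.trans hx.2⟩ j)
      simp [hf, this, hc x ⟨hx.1.le, hx.2⟩ j]
    have hsing : ∑ᶠ x ∈ Ioc s t, f x = ∑ᶠ x ∈ ({t} : Set ℝ), f x := by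
      refine finsum_mem_inter_support_eq' f _ _ fun x hx => ⟨fun h1 => ?_, fun h1 => ?_⟩
      · by_contra hne
        exact hx (hzero x ⟨h1.1, lt_of_le_of_ne h1.2 hne⟩)
      · rw [mem_singleton_iff.1 h1]; exact ⟨hst, le_rfl⟩
    rw [hsing, finsum_mem_singleton, hf]
    have : countJump (k j) t = k j t - k j s := countJump_eq (by
      filter_upwards [Ioo_mem_nhdsLT hst] with r hr using hc r ⟨hr.1.le, hr.2⟩ j)
    simp only [this]
    rw [Nat.cast_sub (hk.mono j hst.le)]
  rw [h.equation t ht', h.equation s hs', hint t ht', hint s hs',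
    ← intervalIntegral.integral_add_adjacent_intervals
      (h.intervalIntegrable le_rfl hs hs'.2) (h.intervalIntegrable hs hst.le ht)]
  simp_rw [hjump, Finset.sum_add_distrib]
  abel

/-- On an interval without jumps in its interior, the inverse of the covariance follows the Riccati
equation up to and including the left limit at the right end. -/
theorem IsCovariancePath.segment (hQ : Q.PosSemidef) (hk : IsStepPath k)
    (h : IsCovariancePath T A Q H R k p) {s t : ℝ} (hs : 0 ≤ s) (hst : s < t) (ht : t ≤ T)
    (hc : ∀ r ∈ Ico s t, ∀ j, k j r = k j s) (hps : (p s).PosDef) :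
    ∃ q : RMat n, q.PosDef ∧ (∀ r ∈ Ico s t, (p r).PosDef) ∧
      IntervalIntegrable (fun x => infoDrift A Q (p x)⁻¹) volume s t ∧
      q⁻¹ = (p s)⁻¹ + (∫ x in s..t, infoDrift A Q (p x)⁻¹) ∧
      p t = q - ∑ j, ((k j t : ℝ) - k j s) • jumpMap (H j) (R j) q := by
  -- The continuation without the jump at `t`: it agrees with `p` before `t`, and its value at `t`
  -- is the left limit of `p`.
  set q : ℝ → RMat n := fun r => p s + ∫ x in s..r, (A * p x + p x * Aᵀ + Q) with hq
  have hint := h.intervalIntegrable hs hst.le ht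
  have hqp : ∀ r ∈ Ico s t, q r = p r := by
    intro r hr
    rcases eq_or_lt_of_le hr.1 with rfl | h'
    · simp [hq]
    · rw [h.sub_eq hk hs h' (hr.2.le.trans ht) fun x hx => hc x ⟨hx.1, hx.2.trans hr.2⟩]
      simp [hq, hc r hr]
  have hqc : ContinuousOn q (Icc s t) := by
    have h1 : ContinuousOn (fun r => ∫ x in s..r, (A * p x + p x * Aᵀ + Q)) (uIcc s t) :=
      intervalIntegral.continuousOn_primitive_interval (by
        rw [uIcc_of_le hst.le]
        exact (intervalIntegrable_iff_integrableOn_Icc_of_le hst.le).1 hint)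
    rw [uIcc_of_le hst.le] at h1
    exact continuousOn_const.add h1
  have hcongr : ∀ {f : RMat n → RMat n} (r), r ∈ Icc s t →
      ∫ x in s..r, f (p x) = ∫ x in s..r, f (q x) := fun {f} r hr => by
    refine intervalIntegral.integral_congr_uIoo fun x hx => ?_
    rw [uIoo_of_le hr.1] at hx
    show f (p x) = f (q x)
    rw [hqp x ⟨hx.1.le, hx.2.trans_le hr.2⟩]
  have hqs : q s = p s := by simp [hq]
  have hmain := lyapunov_inv hQ hst.le hqc (by rwa [hqs]) (fun r hr => by
    rw [hqs, ← hcongr (f := fun X => A * X + X * Aᵀ + Q) r hr])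
  have htm : t ∈ Icc s t := ⟨hst.le, le_rfl⟩
  have hlim : Function.leftLim p t = q t := by
    refine leftLim_eq_of_tendsto ?_
    have h1 : Tendsto q (𝓝[<] t) (𝓝 (q t)) :=
      (hqc t htm).mono_of_mem_nhdsWithin (mem_of_superset (Ioo_mem_nhdsLT hst) Ioo_subset_Icc_self)
    refine h1.congr' ?_
    filter_upwards [Ioo_mem_nhdsLT hst] with r hr using hqp r ⟨hr.1.le, hr.2⟩
  refine ⟨q t, (hmain t htm).1, fun r hr => ?_, ?_, ?_, ?_⟩
  · rw [← hqp r hr]; exact (hmain r ⟨hr.1, hr.2.le⟩).1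
  · have h1 : ContinuousOn (fun x => infoDrift A Q (q x)⁻¹) (Icc s t) := fun r hr =>
      (continuous_infoDrift A Q).continuousAt.comp_continuousWithinAt
        ((continuousAt_rmat_inv (hmain r hr).1.isUnit_det').comp_continuousWithinAt (hqc r hr))
    refine (h1.intervalIntegrable_of_Icc hst.le).congr_uIoo fun x hx => ?_
    rw [uIoo_of_le hst.le] at hx
    show infoDrift A Q (q x)⁻¹ = infoDrift A Q (p x)⁻¹
    rw [hqp x ⟨hx.1.le, hx.2⟩]
  · rw [(hmain t htm).2, hqs, hcongr (f := fun X => infoDrift A Q X⁻¹) t htm]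
  · rw [h.sub_eq hk hs hst ht hc, hlim]

/-- The inverse of the covariance process is the information process, when the counting paths have
no simultaneous jumps. -/
theorem IsCovariancePath.isInfoPath_inv (hQ : Q.PosSemidef) (hR : ∀ j, (R j).PosDef)
    (hk : IsStepPath k) (hk0 : ∀ j, k j 0 = 0)
    (hsimple : ∀ t ∈ Ioc 0 T, ∀ s ∈ Ico 0 t, (∀ r ∈ Ico s t, ∀ j, k j r = k j s) →
      ∑ j, (k j t - k j s) ≤ 1)
    (h : IsCovariancePath T A Q H R k p) (hp : (p 0).PosDef) (hT : 0 ≤ T) :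
    IsInfoPath T A Q (fun j => infoContribution (H j) (R j)) k (p 0)⁻¹ fun t => (p t)⁻¹ := by
  set S : Fin M → RMat n := fun j => infoContribution (H j) (R j) with hS
  have hSp : ∀ j, (S j).PosSemidef := fun j => infoContribution_posSemidef (H j) (hR j)
  have step : ∀ s t, 0 ≤ s → s < t → t ≤ T → (∀ r ∈ Ico s t, ∀ j, k j r = k j s) →
      ((p s).PosDef ∧ IntervalIntegrable (fun x => infoDrift A Q (p x)⁻¹) volume 0 s ∧
        (p s)⁻¹ = (p 0)⁻¹ + (∫ x in (0 : ℝ)..s, infoDrift A Q (p x)⁻¹) +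
          infoSum S fun j => k j s) →
      ((p t).PosDef ∧ IntervalIntegrable (fun x => infoDrift A Q (p x)⁻¹) volume 0 t ∧
        (p t)⁻¹ = (p 0)⁻¹ + (∫ x in (0 : ℝ)..t, infoDrift A Q (p x)⁻¹) +
          infoSum S fun j => k j t) := by
    rintro s t hs hst ht hc ⟨hps, hi, he⟩
    obtain ⟨q, hq, -, hi2, hqe, hpt⟩ := h.segment hQ hk hs hst ht hc hps
    have hle := hsimple t ⟨hs.trans_lt hst, ht⟩ s ⟨hs, hst⟩ hc
    -- The total increment is at most one, so either nothing jumps or exactly one count rises by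
    -- one. In the second case Woodbury applies to that single jump.
    have key : (p t).PosDef ∧ (p t)⁻¹ = q⁻¹ +
        (infoSum S (fun j => k j t) - infoSum S fun j => k j s) := by
      have hsubσ : infoSum S (fun j => k j t) - infoSum S (fun j => k j s) =
          ∑ j, ((k j t : ℝ) - k j s) • S j := by
        simp only [infoSum, sub_smul, Finset.sum_sub_distrib]
      rw [hsubσ]
      by_cases hall : ∀ j, k j t = k j s
      · have : p t = q := by rw [hpt]; simp [hall]
        rw [this]
        exact ⟨hq, by simp [hall]⟩
      · push Not at hall
        obtain ⟨j₀, hj₀⟩ := hall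
        have h2 := Finset.add_sum_erase Finset.univ (fun j => k j t - k j s) (Finset.mem_univ j₀)
        have hm := hk.mono j₀ hst.le
        have h3 : ∑ j ∈ Finset.univ.erase j₀, (k j t - k j s) = 0 := by omega
        have hj : k j₀ t = k j₀ s + 1 := by omega
        have hoth : ∀ j ≠ j₀, k j t = k j s := fun j hj => by
          have h4 := Finset.sum_eq_zero_iff.1 h3 j (Finset.mem_erase.2 ⟨hj, Finset.mem_univ j⟩)
          have := hk.mono j hst.le
          omega
        have hsum : ∀ f : Fin M → RMat n, ∑ j, ((k j t : ℝ) - k j s) • f j = f j₀ := fun f => by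
          rw [Finset.sum_eq_single j₀]
          · simp [hj]
          · intro j _ hj; simp [hoth j hj]
          · simp
        rw [hsum] at hpt ⊢
        rw [hpt, sub_jumpMap_eq_inv _ (hR j₀) hq]
        have hpd := hq.inv.add_posSemidef (hSp j₀)
        exact ⟨hpd.inv, Matrix.nonsing_inv_nonsing_inv _ hpd.isUnit_det'⟩
    refine ⟨key.1, hi.trans hi2, ?_⟩
    rw [key.2, hqe, he, ← intervalIntegral.integral_add_adjacent_intervals hi hi2]
    abel
  have hmain : ∀ t ∈ Icc 0 T, ((p t).PosDef ∧
      IntervalIntegrable (fun x => infoDrift A Q (p x)⁻¹) volume 0 t ∧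
        (p t)⁻¹ = (p 0)⁻¹ + (∫ x in (0 : ℝ)..t, infoDrift A Q (p x)⁻¹) +
          infoSum S fun j => k j t) := by
    refine Icc_induction (fun _ => ⟨hp, by simp, by simp [infoSum, hk0]⟩) ?_ ?_
    · intro t ht hprev
      obtain ⟨u, hu, hsub⟩ := mem_nhdsGE_iff_exists_Ico_subset.1 (hk.right t)
      exact ⟨u, hu, fun s hs hsT => step t s ht.1 hs.1 hsT
        (fun r hr => hsub ⟨hr.1, hr.2.trans hs.2⟩) (hprev t ⟨ht.1, le_rfl⟩)⟩
    · intro t ht hprev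
      obtain ⟨l, -, hev⟩ := hk.left t
      obtain ⟨a, ha, hsub⟩ := (mem_nhdsLT_iff_exists_mem_Ico_Ioo_subset ht.1).1 hev
      have hv : (a + t) / 2 ∈ Ioo a t := ⟨by linarith [ha.2], by linarith [ha.2]⟩
      refine step ((a + t) / 2) t (by linarith [ha.1, ht.1]) hv.2 ht.2 (fun r hr j => ?_)
        (hprev _ ⟨by linarith [ha.1, ht.1], hv.2⟩)
      have e1 : ∀ j, k j r = l j := hsub ⟨hv.1.trans_le hr.1, hr.2⟩
      have e2 : ∀ j, k j ((a + t) / 2) = l j := hsub hv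
      rw [e1, e2]
  exact ⟨fun t ht => (hmain t ht).1.inv, (hmain T ⟨hT, le_rfl⟩).2.1, fun t ht => (hmain t ht).2.2⟩

end CovariancePaths

/-! ### Measurable dependence on the counting paths -/

section PathSpace

open scoped Matrix.Norms.L2Operator

variable {n M : ℕ} {T : ℝ}

/-- The right-continuous nondecreasing regularization of a counting path on `[0, T]`. -/
noncomputable def regPath (hT : 0 ≤ T) (γ : Icc (0 : ℝ) T → ℕ) (s : ℝ) : ℕ :=
  ⨅ q : ℚ, if s < q then min (γ (projIcc 0 T hT q)) (γ ⟨T, hT, le_rfl⟩) else γ ⟨T, hT, le_rfl⟩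

section

variable (hT : 0 ≤ T) (γ : Icc (0 : ℝ) T → ℕ)

theorem regPath_le_of_lt {s : ℝ} {q : ℚ} (h : s < q) :
    regPath hT γ s ≤ min (γ (projIcc 0 T hT q)) (γ ⟨T, hT, le_rfl⟩) := by
  have := ciInf_le (OrderBot.bddBelow (range fun q : ℚ => if s < q then
    min (γ (projIcc 0 T hT q)) (γ ⟨T, hT, le_rfl⟩) else γ ⟨T, hT, le_rfl⟩)) q
  rw [if_pos h] at this
  exact this

theorem regPath_le (s : ℝ) : regPath hT γ s ≤ γ ⟨T, hT, le_rfl⟩ := by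
  obtain ⟨q, hq⟩ := exists_rat_gt s
  exact (regPath_le_of_lt hT γ hq).trans (min_le_right _ _)

theorem monotone_regPath : Monotone (regPath hT γ) := by
  intro s t hst
  refine ciInf_mono (OrderBot.bddBelow _) fun q => ?_
  by_cases h : t < q
  · rw [if_pos h, if_pos (hst.trans_lt h)]
  · rw [if_neg h]
    split_ifs
    exacts [min_le_right _ _, le_rfl]

/-- An infimum of natural numbers is attained at some rational `q`. If `q` lies beyond `t`, the same
`q` serves every time in `[t, q)`; otherwise the value is already the cap. -/
theorem regPath_right (t : ℝ) : ∀ᶠ s in 𝓝[≥] t, regPath hT γ s = regPath hT γ t := by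
  obtain ⟨q, hq⟩ := ciInf_mem fun q : ℚ => if t < q then
    min (γ (projIcc 0 T hT q)) (γ ⟨T, hT, le_rfl⟩) else γ ⟨T, hT, le_rfl⟩
  change _ = regPath hT γ t at hq
  by_cases h : t < q
  · filter_upwards [Ico_mem_nhdsGE h] with s hs
    refine le_antisymm ?_ (monotone_regPath hT γ hs.1)
    rw [← hq]
    simp only [if_pos h]
    exact regPath_le_of_lt hT γ hs.2
  · filter_upwards [self_mem_nhdsWithin] with s hs
    refine le_antisymm ?_ (monotone_regPath hT γ hs)
    rw [← hq]
    simp only [if_neg h]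
    exact regPath_le hT γ s

/-- On nondecreasing right-continuous paths the regularization changes nothing. It exists so that
every point of the path space, not just almost every one, yields a bounded step path. -/
theorem regPath_eq (hmono : Monotone γ)
    (hr : ∀ t : Icc (0 : ℝ) T, (t : ℝ) < T → ∀ᶠ s in 𝓝[≥] (t : ℝ), ∀ hs : s ∈ Icc 0 T,
      γ ⟨s, hs⟩ = γ t) (t : Icc (0 : ℝ) T) : regPath hT γ t = γ t := by
  refine le_antisymm ?_ (le_ciInf fun q => ?_)
  · rcases eq_or_lt_of_le t.2.2 with h | h
    · have : t = ⟨T, hT, le_rfl⟩ := Subtype.ext h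
      rw [this]
      exact regPath_le hT γ _
    · obtain ⟨u, hu, hsub⟩ := mem_nhdsGE_iff_exists_Ico_subset.1 (hr t h)
      obtain ⟨q, hq1, hq2⟩ := exists_rat_btwn (lt_min hu h)
      refine (regPath_le_of_lt hT γ hq1).trans ((min_le_left _ _).trans ?_)
      have hqm : (q : ℝ) ∈ Icc 0 T := ⟨t.2.1.trans hq1.le, (hq2.trans_le (min_le_right _ _)).le⟩
      rw [projIcc_of_mem hT hqm]
      exact (hsub ⟨hq1.le, hq2.trans_le (min_le_left _ _)⟩ hqm).le
  · split_ifs with h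
    · refine le_min (hmono ?_) (hmono t.2.2)
      rw [← Subtype.coe_le_coe, coe_projIcc]
      exact le_max_of_le_right (le_min t.2.2 h.le)
    · exact hmono t.2.2

end

/-- Only rational times and the endpoint enter, so the product σ-algebra suffices. -/
theorem measurable_regPath (hT : 0 ≤ T) :
    Measurable fun q : (Icc (0 : ℝ) T → ℕ) × ℝ => regPath hT q.1 q.2 := by
  unfold regPath
  refine Measurable.iInf fun q => Measurable.ite (measurableSet_lt measurable_snd measurable_const)
    ?_ ?_
  · exact ((measurable_pi_apply _).comp measurable_fst).min
      ((measurable_pi_apply _).comp measurable_fst)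
  · exact (measurable_pi_apply _).comp measurable_fst

/-- The regularized family of counting paths. -/
noncomputable def regPaths (hT : 0 ≤ T) (γ : Fin M → Icc (0 : ℝ) T → ℕ) (j : Fin M) (s : ℝ) : ℕ :=
  regPath hT (γ j) s

theorem isStepPath_regPaths (hT : 0 ≤ T) (γ : Fin M → Icc (0 : ℝ) T → ℕ) :
    IsStepPath (regPaths hT γ) where
  mono j := monotone_regPath hT (γ j)
  right t := eventually_all.2 fun j => regPath_right hT (γ j) t
  bdd := ⟨∑ j, γ j ⟨T, hT, le_rfl⟩, fun j s => (regPath_le hT (γ j) s).trans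
    (Finset.single_le_sum (f := fun j => γ j ⟨T, hT, le_rfl⟩) (fun _ _ => Nat.zero_le _)
      (Finset.mem_univ j))⟩

theorem measurable_regPaths (hT : 0 ≤ T) (j : Fin M) :
    Measurable fun q : (Fin M → Icc (0 : ℝ) T → ℕ) × ℝ => regPaths hT q.1 j q.2 := by
  have h : Measurable fun q : (Fin M → Icc (0 : ℝ) T → ℕ) × ℝ => (q.1 j, q.2) :=
    ((measurable_pi_apply j).comp measurable_fst).prodMk measurable_snd
  exact (measurable_regPath hT).comp h

theorem measurable_regPaths_at (hT : 0 ≤ T) (j : Fin M) (t : ℝ) :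
    Measurable fun γ : Fin M → Icc (0 : ℝ) T → ℕ => regPaths hT γ j t :=
  (measurable_regPaths hT j).comp measurable_prodMk_right

theorem stronglyMeasurable_linearSolution_at {E Γ : Type*} [NormedAddCommGroup E]
    [NormedSpace ℝ E] [CompleteSpace E] [MeasurableSpace Γ] {B : Γ → ℝ → E →L[ℝ] E} {x₀ : Γ → E}
    (hB : StronglyMeasurable fun q : Γ × ℝ => B q.1 q.2) (hx : StronglyMeasurable x₀)
    (hb : ∀ ω, ∃ b, ∀ s, ‖B ω s‖ ≤ b) (t : ℝ) :
    StronglyMeasurable fun ω => linearSolution (B ω) (x₀ ω) t :=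
  (stronglyMeasurable_linearSolution hB hx hb).comp_measurable measurable_prodMk_right

/-- The covariance of the filter is a measurable function of the initial covariance and the
counting paths. -/
theorem stronglyMeasurable_covSolution (hT : 0 ≤ T) (A Q : RMat n) (S : Fin M → RMat n) (t : ℝ) :
    StronglyMeasurable fun q : (Fin n → Fin n → ℝ) × (Fin M → Icc (0 : ℝ) T → ℕ) =>
      covSolution A Q S (regPaths hT q.2) (Matrix.of q.1) t := by
  have hσ : StronglyMeasurable (β := RMat n)
      fun q : ((Fin n → Fin n → ℝ) × (Fin M → Icc (0 : ℝ) T → ℕ)) × ℝ =>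
        infoSum S fun j => regPaths hT q.1.2 j q.2 :=
    measurable_infoSum S fun j => (measurable_regPaths hT j).comp
      ((measurable_snd.comp measurable_fst).prodMk measurable_snd)
  have hx : StronglyMeasurable fun q : (Fin n → Fin n → ℝ) × (Fin M → Icc (0 : ℝ) T → ℕ) =>
      ((Matrix.of q.1 : RMat n), (1 : RMat n)) := by
    have h0 : Continuous fun z : Fin n → Fin n → ℝ => (Matrix.of z : RMat n) :=
      continuous_matrix fun a b => (continuous_apply b).comp (continuous_apply a)
    exact (h0.prodMk continuous_const).stronglyMeasurable.comp_measurable measurable_fst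
  have h1 := stronglyMeasurable_linearSolution_at
    (B := fun (q : (Fin n → Fin n → ℝ) × (Fin M → Icc (0 : ℝ) T → ℕ)) s =>
      hamiltonianField A Q (infoSum S fun j => regPaths hT q.2 j s))
    ((continuous_hamiltonianField A Q).comp_stronglyMeasurable hσ) hx
    (fun q => IsStepPath.norm_hamiltonianField_le (isStepPath_regPaths hT q.2).bdd A Q S) t
  have h3 : StronglyMeasurable (β := RMat n)
      fun q : (Fin n → Fin n → ℝ) × (Fin M → Icc (0 : ℝ) T → ℕ) =>
        infoSum S fun j => regPaths hT q.2 j t :=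
    measurable_infoSum S fun j => (measurable_regPaths_at hT j t).comp measurable_snd
  have hU := h1.fst
  have hW := h1.snd
  unfold covSolution hamiltonianState
  exact hU.mul (hW.add (h3.mul hU)).matrix_inv

theorem IsInfoPath.congr {s T : ℝ} {A Q : RMat n} {S : Fin M → RMat n} {k k' : Fin M → ℝ → ℕ}
    {y₀ : RMat n} {y : ℝ → RMat n} (h : IsInfoPath T A Q S k y₀ y) (hs : 0 ≤ s) (hsT : s ≤ T)
    (hk : ∀ t ∈ Icc 0 s, ∀ j, k j t = k' j t) : IsInfoPath s A Q S k' y₀ y where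
  posDef t ht := h.posDef t ⟨ht.1, ht.2.trans hsT⟩
  integrable := h.integrable.mono_set (by
    rw [uIcc_of_le hs, uIcc_of_le (hs.trans hsT)]; exact Icc_subset_Icc_right hsT)
  equation t ht := by
    rw [h.equation t ⟨ht.1, ht.2.trans hsT⟩]
    simp only [hk t ht]

/-- The covariance at time `s` depends on the counting paths up to time `s` only. -/
theorem covSolution_congr {s : ℝ} (hs : 0 ≤ s) {A Q : RMat n} (hQ : Q.PosSemidef)
    {S : Fin M → RMat n} (hS : ∀ j, (S j).PosSemidef) {k k' : Fin M → ℝ → ℕ} (hk : IsStepPath k)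
    (hk' : IsStepPath k') (h : ∀ t ∈ Icc 0 s, ∀ j, k j t = k' j t) {p₀ : RMat n} (hp : p₀.PosDef) :
    covSolution A Q S k p₀ s = covSolution A Q S k' p₀ s := by
  have h1 := (isInfoPath_inv_covSolution (T := s) (A := A) hs hQ hS hk hp).congr hs le_rfl h
  have h2 := isInfoPath_inv_covSolution (T := s) (A := A) hs hQ hS hk' hp
  have hinv := h1.unique hQ hS hk' h2 s ⟨hs, le_rfl⟩
  have hd : ∀ {X : RMat n}, (X⁻¹).PosDef → X = X⁻¹⁻¹ := fun hX =>
    (Matrix.nonsing_inv_nonsing_inv _ ((Matrix.isUnit_nonsing_inv_det_iff).1 hX.isUnit_det')).symm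
  rw [hd (h1.posDef s ⟨hs, le_rfl⟩), hinv, ← hd (h2.posDef s ⟨hs, le_rfl⟩)]

end PathSpace

/-! ### Factorial moments of the Poisson law -/

section PoissonMoments

open scoped NNReal

/-- The descending factorial cancels against `n!`, so a shift by `k` reduces the sum to `r ^ k`
times the total mass. -/
theorem hasSum_descFactorial_poisson (r : ℝ≥0) (k : ℕ) :
    HasSum (fun n : ℕ => Real.exp (-r) * (r : ℝ) ^ n / n.factorial * (n.descFactorial k : ℝ))
      ((r : ℝ) ^ k) := by
  rw [← hasSum_nat_add_iff' k]
  have h0 : ∑ n ∈ Finset.range k,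
      Real.exp (-r) * (r : ℝ) ^ n / n.factorial * (n.descFactorial k : ℝ) = 0 :=
    Finset.sum_eq_zero fun n hn => by
      rw [Nat.descFactorial_of_lt (Finset.mem_range.1 hn)]; simp
  rw [h0, sub_zero]
  have h := (hasSum_one_poissonMeasure r).mul_left ((r : ℝ) ^ k)
  rw [mul_one] at h
  convert! h using 2 with n
  have hf := Nat.factorial_mul_descFactorial (Nat.le_add_left k n)
  rw [Nat.add_sub_cancel] at hf
  have hf' : ((n + k).factorial : ℝ) = n.factorial * (n + k).descFactorial k := by
    exact_mod_cast hf.symm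
  have h1 : (n.factorial : ℝ) ≠ 0 := by positivity
  have h2 : ((n + k).descFactorial k : ℝ) ≠ 0 := by
    intro h
    rw [h, mul_zero] at hf'
    exact (Nat.factorial_ne_zero (n + k)) (by exact_mod_cast hf')
  rw [hf', pow_add]
  field_simp

theorem integrable_descFactorial_poisson (r : ℝ≥0) (k : ℕ) :
    Integrable (fun n : ℕ => (n.descFactorial k : ℝ)) (poissonMeasure r) := by
  rw [integrable_poissonMeasure_iff]
  simpa using (hasSum_descFactorial_poisson r k).summable

theorem integral_descFactorial_poisson (r : ℝ≥0) (k : ℕ) :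
    ∫ n, (n.descFactorial k : ℝ) ∂poissonMeasure r = (r : ℝ) ^ k := by
  rw [integral_poissonMeasure' (integrable_descFactorial_poisson r k)]
  exact (hasSum_descFactorial_poisson r k).tsum_eq

variable {Ω : Type*} [MeasurableSpace Ω] {μ : Measure Ω} {X : Ω → ℕ} {r : ℝ≥0}

theorem integrable_of_poisson (hX : Measurable X) (h : μ.map X = poissonMeasure r) :
    Integrable (fun ω => (X ω : ℝ)) μ ∧ ∫ ω, (X ω : ℝ) ∂μ = r := by
  have h1 := integrable_descFactorial_poisson r 1
  have h2 := integral_descFactorial_poisson r 1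
  simp only [Nat.descFactorial_one, pow_one] at h1 h2
  rw [← h] at h1 h2
  rw [integral_map hX.aemeasurable h1.aestronglyMeasurable] at h2
  exact ⟨h1.comp_measurable hX, h2⟩

theorem integrable_mul_pred_of_poisson (hX : Measurable X) (h : μ.map X = poissonMeasure r) :
    Integrable (fun ω => (X ω : ℝ) * (X ω - 1)) μ ∧ ∫ ω, (X ω : ℝ) * (X ω - 1) ∂μ = r ^ 2 := by
  have h1 := integrable_descFactorial_poisson r 2
  have h2 := integral_descFactorial_poisson r 2
  simp only [Nat.cast_descFactorial_two] at h1 h2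
  rw [← h] at h1 h2
  rw [integral_map hX.aemeasurable h1.aestronglyMeasurable] at h2
  exact ⟨h1.comp_measurable hX, h2⟩

end PoissonMoments

/-! ### Bounds on the rates of a schedule -/

section PoissonFamily

variable {M : ℕ} {Ω : Type*} [MeasurableSpace Ω] {μ : Measure Ω} {T : ℝ}
  {lam : Fin M → ℝ → ℝ} {N : Fin M → ℝ → Ω → ℕ}

theorem IsSchedule.intervalIntegrable (hlam : IsSchedule T lam) (j : Fin M) {s t : ℝ}
    (hs : s ∈ Icc 0 T) (ht : t ∈ Icc 0 T) : IntervalIntegrable (lam j) volume s t := by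
  have h : IntegrableOn (lam j) (Icc 0 T) := (hlam j).1.integrable le_top
  rw [intervalIntegrable_iff]
  exact h.mono_set ((uIoc_subset_uIcc).trans (uIcc_subset_Icc hs ht))

theorem IsSchedule.exists_ae_bound (hlam : IsSchedule T lam) :
    ∃ l : ℝ, 0 ≤ l ∧ ∀ j, ∀ᵐ t ∂volume.restrict (Icc 0 T), ‖lam j t‖ ≤ l := by
  have hb : ∀ j, ∃ l : ℝ, 0 ≤ l ∧ ∀ᵐ t ∂volume.restrict (Icc 0 T), ‖lam j t‖ ≤ l := fun j => by
    refine ⟨(eLpNormEssSup (lam j) (volume.restrict (Icc 0 T))).toReal, ENNReal.toReal_nonneg, ?_⟩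
    have hfin : eLpNormEssSup (lam j) (volume.restrict (Icc 0 T)) ≠ ⊤ := by
      have := (hlam j).1.2
      rw [eLpNorm_exponent_top] at this
      exact this.ne
    filter_upwards [ae_le_eLpNormEssSup (f := lam j) (μ := volume.restrict (Icc 0 T))] with t ht
    rw [← toReal_enorm]
    exact ENNReal.toReal_mono hfin ht
  choose l hl0 hl using hb
  exact ⟨∑ j, l j, Finset.sum_nonneg fun j _ => hl0 j, fun j => (hl j).mono fun t ht =>
    ht.trans (Finset.single_le_sum (fun j _ => hl0 j) (Finset.mem_univ j))⟩

/-- Mean counts over an interval are at most linear in its length, uniformly in its position; the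
second-order errors below rest on this. -/
theorem IsSchedule.exists_bound (hlam : IsSchedule T lam) :
    ∃ L : ℝ, 0 ≤ L ∧ ∀ j s t, 0 ≤ s → s ≤ t → t ≤ T →
      0 ≤ ∫ u in s..t, lam j u ∧ ∫ u in s..t, lam j u ≤ L * (t - s) := by
  obtain ⟨l, hl0, hl⟩ := hlam.exists_ae_bound
  refine ⟨l, hl0, fun j s t hs hst htT => ?_⟩
  have hsub : Ioc s t ⊆ Icc 0 T := fun u hu => ⟨hs.trans hu.1.le, hu.2.trans htT⟩
  rw [intervalIntegral.integral_of_le hst]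
  constructor
  · exact integral_nonneg_of_ae (ae_restrict_of_ae_restrict_of_subset hsub (hlam j).2)
  · refine (le_abs_self _).trans ?_
    rw [← Real.norm_eq_abs]
    refine (norm_setIntegral_le_of_norm_le_const_ae' (C := l) (by simp) ?_).trans ?_
    · exact (ae_restrict_iff' measurableSet_Ioc).1 (ae_restrict_of_ae_restrict_of_subset hsub (hl j))
    · rw [Real.volume_real_Ioc_of_le hst]

end PoissonFamily

/-! ### Independence of past and future increments -/

section Independence

/-- Both sides are the product of the three laws, up to reassociation. -/
theorem indepFun_prodMk_of_indepFun {Ω α β γ : Type*} [MeasurableSpace Ω] [MeasurableSpace α]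
    [MeasurableSpace β] [MeasurableSpace γ] {μ : Measure Ω} [IsProbabilityMeasure μ] {U : Ω → α}
    {B : Ω → β} {C : Ω → γ} (hU : Measurable U) (hB : Measurable B) (hC : Measurable C)
    (h : IndepFun U (fun ω => (B ω, C ω)) μ) (hBC : IndepFun B C μ) :
    IndepFun (fun ω => (U ω, B ω)) C μ := by
  have h1 := (indepFun_iff_map_prod_eq_prod_map_map hU.aemeasurable
    (hB.prodMk hC).aemeasurable).1 h
  have h2 := (indepFun_iff_map_prod_eq_prod_map_map hB.aemeasurable hC.aemeasurable).1 hBC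
  have h3 : IndepFun U B μ := h.comp measurable_id measurable_fst
  have h4 := (indepFun_iff_map_prod_eq_prod_map_map hU.aemeasurable hB.aemeasurable).1 h3
  rw [indepFun_iff_map_prod_eq_prod_map_map (hU.prodMk hB).aemeasurable hC.aemeasurable, h4]
  have := Measure.isProbabilityMeasure_map (μ := μ) hU.aemeasurable
  have := Measure.isProbabilityMeasure_map (μ := μ) hB.aemeasurable
  have := Measure.isProbabilityMeasure_map (μ := μ) hC.aemeasurable
  refine MeasurableEquiv.prodAssoc.map_measurableEquiv_injective ?_
  rw [Measure.prodAssoc_prod, ← h2, ← h1,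
    Measure.map_map MeasurableEquiv.prodAssoc.measurable ((hU.prodMk hB).prodMk hC)]
  rfl

/-- Independent increments are applied along monotone sequences of times; this produces one through
a given finite set, starting at the origin so that values can be recovered by telescoping. -/
theorem exists_monotone_seq_through {α : Type*} [LinearOrder α] {o : α} (ho : ∀ x, o ≤ x)
    (I : Finset α) : ∃ (c : ℕ) (τ : ℕ → α), Monotone τ ∧ τ 0 = o ∧ (∀ i ∈ I, ∃ k ≤ c, τ k = i) ∧
      ∀ b, (∀ i ∈ I, i ≤ b) → ∀ k, τ k ≤ b := by
  induction I using Finset.induction_on_max with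
  | empty => exact ⟨0, fun _ => o, monotone_const, rfl, by simp, fun b _ _ => ho b⟩
  | insert a I ha ih =>
    obtain ⟨c, τ, hτ, h0, hI, hb⟩ := ih
    have hτa := hb a fun i hi => (ha i hi).le
    refine ⟨c + 1, fun k => if k ≤ c then τ k else a, fun k l hkl => ?_, by simpa using h0, ?_, ?_⟩
    · dsimp only
      split_ifs with h1 h2 h2
      exacts [hτ hkl, hτa k, by omega, le_rfl]
    · intro i hi
      rcases Finset.mem_insert.1 hi with rfl | hi
      · exact ⟨c + 1, le_rfl, if_neg (by omega)⟩
      · obtain ⟨k, hk, rfl⟩ := hI i hi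
        exact ⟨k, by omega, if_pos hk⟩
    · intro b hb' k
      dsimp only
      split_ifs
      · exact (hτa k).trans (hb' a (Finset.mem_insert_self _ _))
      · exact hb' a (Finset.mem_insert_self _ _)

variable {Ω : Type*} [MeasurableSpace Ω] {μ : Measure Ω} [IsProbabilityMeasure μ] {T : ℝ}

/-- The past of a process with independent increments, nondecreasing counting paths and initial
value zero is independent of its future increments. -/
theorem indepFun_stopped_increment {α : Type*} [LinearOrder α] {o : α} (ho : ∀ x, o ≤ x)
    {X : α → Ω → ℕ} (hX : ∀ t, Measurable (X t)) (h0 : ∀ᵐ ω ∂μ, X o ω = 0)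
    (hmono : ∀ᵐ ω ∂μ, Monotone fun t => X t ω) (hind : HasIndepIncrements X μ) {s t : α}
    (hst : s ≤ t) : IndepFun (fun ω r => X (min r s) ω) (fun ω => X t ω - X s ω) μ := by
  refine IndepFun.process_indepFun (fun r => hX _) ((hX t).sub (hX s)) fun I => ?_
  obtain ⟨c, τ, hτ, hτ0, hI, hb⟩ := exists_monotone_seq_through ho (I.image fun i => min i s)
  have hτs : ∀ k, τ k ≤ s := hb s fun i hi => by
    obtain ⟨j, -, rfl⟩ := Finset.mem_image.1 hi
    exact min_le_right _ _
  have hk : ∀ i : I, ∃ k ≤ c, τ k = min (i : α) s := fun i =>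
    hI _ (Finset.mem_image_of_mem _ i.2)
  choose k hkc hk using hk
  -- The sequence visits the sampled past, then `s` at index `c + 1`, then stays at `t`. Thus the
  -- increment with index `c + 1` is the future one, and those with indices up to `c` lie in the
  -- past.
  let σ : ℕ → α := fun l => if l ≤ c then τ l else if l = c + 1 then s else t
  have hσ : Monotone σ := by
    refine monotone_nat_of_le_succ fun l => ?_
    simp only [σ]
    split_ifs with h1 h2 h2 h3 h4 h5 h6 h7
    all_goals first | omega | exact hτ (Nat.le_succ l) | exact hτs l | exact hst | exact le_rfl
  have hind' := (hind.nat hσ).indepFun_finset (Finset.range (c + 1)) {c + 1} (by simp)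
    fun i => (hX _).sub (hX _)
  have hf : Measurable fun (x : Finset.range (c + 1) → ℕ) (i : I) =>
      ∑ m : Finset.range (c + 1), if (m : ℕ) < k i then x m else 0 := by
    refine measurable_pi_iff.2 fun i => Finset.measurable_fun_sum _ fun m _ => ?_
    split_ifs
    exacts [measurable_pi_apply m, measurable_const]
  have hg : Measurable fun x : ({c + 1} : Finset ℕ) → ℕ => x ⟨c + 1, by simp⟩ :=
    measurable_pi_apply _
  refine (hind'.comp hf hg).congr ?_ (Eventually.of_forall fun ω => ?_)
  · filter_upwards [h0, hmono] with ω h0 hmono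
    funext i
    simp only [Function.comp]
    rw [Finset.sum_coe_sort (Finset.range (c + 1)) fun m =>
      if m < k i then X (σ (m + 1)) ω - X (σ m) ω else 0, ← Finset.sum_filter]
    have hfil : (Finset.range (c + 1)).filter (· < k i) = Finset.range (k i) := by
      ext m
      have := hkc i
      simp only [Finset.mem_filter, Finset.mem_range]
      omega
    have htel := Finset.sum_range_tsub (f := fun m => X (σ m) ω) (fun a b hab => hmono (hσ hab)) (k i)
    rw [hfil, htel]
    simp only [σ, hkc i, if_pos, zero_le, hτ0, h0, hk, Nat.sub_zero]
  · simp [σ]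

/-- The counting paths stopped at time `s`. -/
def stopPaths {M : ℕ} (s : Icc (0 : ℝ) T) (γ : Fin M → Icc (0 : ℝ) T → ℕ) :
    Fin M → Icc (0 : ℝ) T → ℕ := fun j r => γ j (min r s)

/-- The stopped path of `N j` is independent of its later increment, and the other processes are
independent of the whole of `N j`. Regrouping makes the joint past independent of the increment. -/
theorem indepFun_stopPaths {M : ℕ} (hT : 0 ≤ T) {lam : Fin M → ℝ → ℝ} {N : Fin M → ℝ → Ω → ℕ}
    (hN : ∀ j, IsPoissonProcess μ T (lam j) (N j))
    (hNind : iIndepFun (fun j ω (t : Icc (0 : ℝ) T) => N j t ω) μ) (j : Fin M)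
    {s t : Icc (0 : ℝ) T} (hst : s ≤ t) :
    IndepFun (fun ω => stopPaths s fun i (r : Icc (0 : ℝ) T) => N i r ω)
      (fun ω => N j t ω - N j s ω) μ := by
  have hmeas : ∀ i (r : Icc (0 : ℝ) T), Measurable (N i r) := fun i r => (hN i).measurable r r.2
  have hpath : ∀ i, Measurable fun ω (r : Icc (0 : ℝ) T) => N i r ω := fun i =>
    measurable_pi_iff.2 fun r => hmeas i r
  have h1 : IndepFun (fun ω (r : Icc (0 : ℝ) T) => N j (min r s : Icc (0 : ℝ) T) ω)
      (fun ω => N j t ω - N j s ω) μ :=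
    indepFun_stopped_increment (o := (⟨0, le_rfl, hT⟩ : Icc (0 : ℝ) T)) (fun x => x.2.1)
      (X := fun (r : Icc (0 : ℝ) T) => N j r) (hmeas j) (hN j).zero
      ((hN j).monotone.mono fun ω h a b hab => h a.2 b.2 hab) (hN j).indep hst
  obtain ⟨e, he⟩ : ∃ e : Finset (Fin M), e = Finset.univ.erase j := ⟨_, rfl⟩
  have h2 := hNind.indepFun_finset e {j} (by simp [he]) hpath
  have hψ : Measurable fun x : ({j} : Finset (Fin M)) → Icc (0 : ℝ) T → ℕ =>
      ((fun r => x ⟨j, by simp⟩ (min r s)),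
        x ⟨j, by simp⟩ t - x ⟨j, by simp⟩ s) := by
    refine Measurable.prodMk (measurable_pi_iff.2 fun r => ?_) (Measurable.sub ?_ ?_)
    all_goals exact (measurable_pi_apply _).comp (measurable_pi_apply _)
  have h3 := h2.comp measurable_id hψ
  have h4 := indepFun_prodMk_of_indepFun (U := fun ω (i : e) (r : Icc (0 : ℝ) T) => N i r ω)
    (B := fun ω (r : Icc (0 : ℝ) T) => N j (min r s : Icc (0 : ℝ) T) ω)
    (C := fun ω => N j t ω - N j s ω) (measurable_pi_iff.2 fun i => hpath i)
    (measurable_pi_iff.2 fun r => hmeas j _) ((hmeas j t).sub (hmeas j s)) h3 h1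
  have hφ : Measurable fun (x : (e → Icc (0 : ℝ) T → ℕ) ×
      (Icc (0 : ℝ) T → ℕ)) (i : Fin M) (r : Icc (0 : ℝ) T) =>
      if h : i = j then x.2 r else x.1 ⟨i, by simpa [he] using h⟩ (min r s) := by
    refine measurable_pi_iff.2 fun i => measurable_pi_iff.2 fun r => ?_
    split_ifs
    · exact (measurable_pi_apply _).comp measurable_snd
    · exact (measurable_pi_apply _).comp ((measurable_pi_apply _).comp measurable_fst)
  refine (h4.comp hφ measurable_id).congr (Eventually.of_forall fun ω => ?_) .rfl
  funext i r
  simp only [Function.comp, stopPaths]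
  split_ifs with h
  · rw [h]
  · rfl

end Independence

/-! ### Moments and simple jumps of a Poisson family -/

section PoissonFamily

variable {M : ℕ} {Ω : Type*} [MeasurableSpace Ω] {μ : Measure Ω} {T : ℝ}
  {lam : Fin M → ℝ → ℝ} {N : Fin M → ℝ → Ω → ℕ}

/-- Independent Poisson processes on `[0, T]` with the rates of a schedule. -/
structure IsPoissonFamily (μ : Measure Ω) (T : ℝ) (lam : Fin M → ℝ → ℝ) (N : Fin M → ℝ → Ω → ℕ) :
    Prop where
  nonneg : 0 ≤ T
  schedule : IsSchedule T lam
  poisson : ∀ j, IsPoissonProcess μ T (lam j) (N j)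
  indep : iIndepFun (fun j ω (t : Icc (0 : ℝ) T) => N j t ω) μ

namespace IsPoissonFamily

variable (h : IsPoissonFamily μ T lam N) {s t : ℝ}
include h

theorem isProbabilityMeasure : IsProbabilityMeasure μ := h.indep.isProbabilityMeasure

theorem ae_le (hs : 0 ≤ s) (hst : s ≤ t) (ht : t ≤ T) : ∀ᵐ ω ∂μ, ∀ j, N j s ω ≤ N j t ω :=
  ae_all_iff.2 fun j => (h.poisson j).monotone.mono fun _ hω =>
    hω ⟨hs, hst.trans ht⟩ ⟨hs.trans hst, ht⟩ hst

theorem rate_nonneg (hs : 0 ≤ s) (hst : s ≤ t) (ht : t ≤ T) (j : Fin M) :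
    0 ≤ ∫ u in s..t, lam j u := by
  obtain ⟨L, -, hL⟩ := h.schedule.exists_bound
  exact (hL j s t hs hst ht).1

theorem integral_increment (hs : 0 ≤ s) (hst : s ≤ t) (ht : t ≤ T) (j : Fin M) :
    Integrable (fun ω => (N j t ω : ℝ) - N j s ω) μ ∧
      ∫ ω, ((N j t ω : ℝ) - N j s ω) ∂μ = ∫ u in s..t, lam j u := by
  have hm : Measurable fun ω => N j t ω - N j s ω :=
    ((h.poisson j).measurable t ⟨hs.trans hst, ht⟩).sub
      ((h.poisson j).measurable s ⟨hs, hst.trans ht⟩)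
  have h1 := integrable_of_poisson hm
    ((h.poisson j).law s ⟨hs, hst.trans ht⟩ t ⟨hs.trans hst, ht⟩ hst)
  rw [Real.coe_toNNReal _ (h.rate_nonneg hs hst ht j)] at h1
  have he : (fun ω => ((N j t ω - N j s ω : ℕ) : ℝ)) =ᵐ[μ] fun ω => (N j t ω : ℝ) - N j s ω := by
    filter_upwards [h.ae_le hs hst ht] with ω hω
    exact Nat.cast_sub (hω j)
  exact ⟨h1.1.congr he, (integral_congr_ae he).symm.trans h1.2⟩

theorem integral_increment_mul_pred (hs : 0 ≤ s) (hst : s ≤ t) (ht : t ≤ T) (j : Fin M) :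
    Integrable (fun ω => ((N j t ω : ℝ) - N j s ω) * ((N j t ω : ℝ) - N j s ω - 1)) μ ∧
      ∫ ω, ((N j t ω : ℝ) - N j s ω) * ((N j t ω : ℝ) - N j s ω - 1) ∂μ =
        (∫ u in s..t, lam j u) ^ 2 := by
  have hm : Measurable fun ω => N j t ω - N j s ω :=
    ((h.poisson j).measurable t ⟨hs.trans hst, ht⟩).sub
      ((h.poisson j).measurable s ⟨hs, hst.trans ht⟩)
  have h1 := integrable_mul_pred_of_poisson hm
    ((h.poisson j).law s ⟨hs, hst.trans ht⟩ t ⟨hs.trans hst, ht⟩ hst)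
  rw [Real.coe_toNNReal _ (h.rate_nonneg hs hst ht j)] at h1
  have he : (fun ω => ((N j t ω - N j s ω : ℕ) : ℝ) * (((N j t ω - N j s ω : ℕ) : ℝ) - 1)) =ᵐ[μ]
      fun ω => ((N j t ω : ℝ) - N j s ω) * ((N j t ω : ℝ) - N j s ω - 1) := by
    filter_upwards [h.ae_le hs hst ht] with ω hω
    rw [Nat.cast_sub (hω j)]
  exact ⟨h1.1.congr he, (integral_congr_ae he).symm.trans h1.2⟩

theorem integral_increment_mul (hs : 0 ≤ s) (hst : s ≤ t) (ht : t ≤ T) {i j : Fin M} (hij : i ≠ j) :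
    Integrable (fun ω => ((N i t ω : ℝ) - N i s ω) * ((N j t ω : ℝ) - N j s ω)) μ ∧
      ∫ ω, ((N i t ω : ℝ) - N i s ω) * ((N j t ω : ℝ) - N j s ω) ∂μ =
        (∫ u in s..t, lam i u) * ∫ u in s..t, lam j u := by
  have hf : Measurable fun γ : Icc (0 : ℝ) T → ℕ =>
      (γ ⟨t, hs.trans hst, ht⟩ : ℝ) - γ ⟨s, hs, hst.trans ht⟩ :=
    (measurable_from_nat.comp (measurable_pi_apply _)).sub
      (measurable_from_nat.comp (measurable_pi_apply _))
  have hind := (h.indep.indepFun hij).comp hf hf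
  obtain ⟨h1, h1'⟩ := h.integral_increment hs hst ht i
  obtain ⟨h2, h2'⟩ := h.integral_increment hs hst ht j
  refine ⟨hind.integrable_mul h1 h2, ?_⟩
  rw [← h1', ← h2']
  exact hind.integral_mul_eq_mul_integral h1.aestronglyMeasurable h2.aestronglyMeasurable

theorem integral_total_increment (hs : 0 ≤ s) (hst : s ≤ t) (ht : t ≤ T) :
    Integrable (fun ω => ∑ j, (N j t ω : ℝ) - ∑ j, (N j s ω : ℝ)) μ ∧
      ∫ ω, (∑ j, (N j t ω : ℝ) - ∑ j, (N j s ω : ℝ)) ∂μ = ∑ j, ∫ u in s..t, lam j u := by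
  simp only [← Finset.sum_sub_distrib]
  refine ⟨integrable_finsetSum _ fun j _ => (h.integral_increment hs hst ht j).1, ?_⟩
  rw [integral_finsetSum _ fun j _ => (h.integral_increment hs hst ht j).1]
  exact Finset.sum_congr rfl fun j _ => (h.integral_increment hs hst ht j).2

/-- Expand into pairs: distinct processes factor by independence, and the diagonal gives second
factorial moments. The products of the mean increments assemble into a square. -/
theorem integral_total_increment_mul_pred (hs : 0 ≤ s) (hst : s ≤ t) (ht : t ≤ T) :
    Integrable (fun ω => (∑ j, (N j t ω : ℝ) - ∑ j, (N j s ω : ℝ)) *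
      (∑ j, (N j t ω : ℝ) - ∑ j, (N j s ω : ℝ) - 1)) μ ∧
      ∫ ω, (∑ j, (N j t ω : ℝ) - ∑ j, (N j s ω : ℝ)) *
        (∑ j, (N j t ω : ℝ) - ∑ j, (N j s ω : ℝ) - 1) ∂μ = (∑ j, ∫ u in s..t, lam j u) ^ 2 := by
  have key : ∀ i j, Integrable (fun ω => ((N i t ω : ℝ) - N i s ω) * ((N j t ω : ℝ) - N j s ω) -
      if i = j then (N i t ω : ℝ) - N i s ω else 0) μ ∧
      ∫ ω, (((N i t ω : ℝ) - N i s ω) * ((N j t ω : ℝ) - N j s ω) -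
        if i = j then (N i t ω : ℝ) - N i s ω else 0) ∂μ =
        (∫ u in s..t, lam i u) * ∫ u in s..t, lam j u := by
    intro i j
    rcases eq_or_ne i j with rfl | hij
    · have := h.integral_increment_mul_pred hs hst ht i
      simp only [mul_sub, mul_one, if_true, sq] at this ⊢
      exact this
    · simpa [hij] using h.integral_increment_mul hs hst ht hij
  have he : ∀ ω, (∑ j, (N j t ω : ℝ) - ∑ j, (N j s ω : ℝ)) *
      (∑ j, (N j t ω : ℝ) - ∑ j, (N j s ω : ℝ) - 1) =
      ∑ i, ∑ j, (((N i t ω : ℝ) - N i s ω) * ((N j t ω : ℝ) - N j s ω) -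
        if i = j then (N i t ω : ℝ) - N i s ω else 0) := fun ω => by
    simp only [Finset.sum_sub_distrib, Finset.sum_ite_eq, Finset.mem_univ, if_true,
      ← Finset.mul_sum, ← Finset.sum_mul]
    ring
  simp only [he]
  refine ⟨integrable_finsetSum _ fun i _ => integrable_finsetSum _ fun j _ => (key i j).1, ?_⟩
  rw [integral_finsetSum _ fun i _ => integrable_finsetSum _ fun j _ => (key i j).1]
  simp only [integral_finsetSum _ fun j _ => (key _ j).1, (key _ _).2, sq, Finset.sum_mul_sum]

theorem integrable_total_sq (ht0 : 0 ≤ t) (ht : t ≤ T) :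
    Integrable (fun ω => (1 + ∑ j, (N j t ω : ℝ)) ^ 2) μ := by
  have := h.isProbabilityMeasure
  have h1 := (h.integral_total_increment le_rfl ht0 ht).1
  have h2 := (h.integral_total_increment_mul_pred le_rfl ht0 ht).1
  refine ((h2.add (h1.const_mul 3)).add (integrable_const 1)).congr ?_
  filter_upwards [ae_all_iff.2 fun j => (h.poisson j).zero] with ω hω
  simp only [Pi.add_apply, hω]
  simp
  ring

/-- Markov's inequality for `D (D - 1)`, where `D` is the total increment: this quantity is at least
one when `D ≥ 2`, and its mean is at most `(M L (t - s))²`. -/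
theorem exists_prob_two_jumps_le : ∃ C : ℝ, 0 ≤ C ∧ ∀ s t, 0 ≤ s → s ≤ t → t ≤ T →
    μ.real {ω | 2 ≤ ∑ j, (N j t ω : ℝ) - ∑ j, (N j s ω : ℝ)} ≤ C * (t - s) ^ 2 := by
  have := h.isProbabilityMeasure
  obtain ⟨L, hL0, hL⟩ := h.schedule.exists_bound
  refine ⟨(M * L) ^ 2, by positivity, fun s t hs hst ht => ?_⟩
  obtain ⟨h1, h2⟩ := h.integral_total_increment_mul_pred hs hst ht
  have hnn : 0 ≤ᵐ[μ] fun ω => (∑ j, (N j t ω : ℝ) - ∑ j, (N j s ω : ℝ)) *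
      (∑ j, (N j t ω : ℝ) - ∑ j, (N j s ω : ℝ) - 1) := by
    filter_upwards [h.ae_le hs hst ht] with ω hω
    have : ∑ j, (N j t ω : ℝ) - ∑ j, (N j s ω : ℝ) = ((∑ j, (N j t ω - N j s ω) : ℕ) : ℝ) := by
      push_cast [Nat.cast_sub (hω _)]
      rw [Finset.sum_sub_distrib]
    simp only [Pi.zero_apply, this]
    rcases Nat.eq_zero_or_pos (∑ j, (N j t ω - N j s ω)) with h0 | h0
    · rw [h0]; simp
    · have : (1 : ℝ) ≤ ((∑ j, (N j t ω - N j s ω) : ℕ) : ℝ) := by exact_mod_cast h0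
      nlinarith
  have hmark := mul_meas_ge_le_integral_of_nonneg hnn h1 1
  rw [h2, one_mul] at hmark
  have hsum : ∑ j, ∫ u in s..t, lam j u ≤ M * L * (t - s) := by
    refine (Finset.sum_le_sum fun j _ => (hL j s t hs hst ht).2).trans ?_
    simp [mul_assoc]
  have hsum0 : 0 ≤ ∑ j, ∫ u in s..t, lam j u :=
    Finset.sum_nonneg fun j _ => (hL j s t hs hst ht).1
  calc _ ≤ _ := measureReal_mono (fun ω hω => ?_) (measure_ne_top _ _)
    _ ≤ (∑ j, ∫ u in s..t, lam j u) ^ 2 := hmark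
    _ ≤ (M * L * (t - s)) ^ 2 := by gcongr
    _ = _ := by ring
  simp only [mem_ofPred_eq] at hω ⊢
  nlinarith

/-- Almost surely, no two of the counting processes jump together, and all jumps are of size
one. -/
theorem ae_simple_jumps : ∀ᵐ ω ∂μ, ∀ t ∈ Ioc 0 T, ∀ s ∈ Ico 0 t,
    (∀ r ∈ Ico s t, ∀ j, N j r ω = N j s ω) → ∑ j, (N j t ω - N j s ω) ≤ 1 := by
  have := h.isProbabilityMeasure
  obtain ⟨C, hC0, hC⟩ := h.exists_prob_two_jumps_le
  have hT := h.nonneg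
  have hgrid : ∀ {n i : ℕ}, i ≤ n + 1 → (i : ℝ) * (T / (n + 1)) ≤ T := fun {n i} hi => by
    have : (i : ℝ) ≤ n + 1 := by exact_mod_cast hi
    calc (i : ℝ) * (T / (n + 1)) ≤ (n + 1) * (T / (n + 1)) := by gcongr
      _ = T := by field_simp
  -- The event that some cell of mesh `T / (n + 1)` carries two or more jumps. The union bound sums
  -- `n + 1` terms of order `(n + 1)⁻²`, so these events have vanishing probability and almost
  -- surely infinitely many of them fail.
  let B : ℕ → Set Ω := fun n => ⋃ i ∈ Finset.range (n + 1),
    {ω | 2 ≤ ∑ j, (N j ((i + 1 : ℕ) * (T / (n + 1))) ω : ℝ) - ∑ j, (N j (i * (T / (n + 1))) ω : ℝ)}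
  have hB : ∀ n, μ.real (B n) ≤ C * T ^ 2 / (n + 1) := fun n => by
    refine (measureReal_biUnion_finset_le _ _).trans ?_
    refine (Finset.sum_le_sum (g := fun _ => C * (T / (n + 1)) ^ 2) fun i hi => ?_).trans ?_
    · have hi' : i + 1 ≤ n + 1 := Finset.mem_range.1 hi
      refine (hC _ _ (by positivity) ?_ (hgrid hi')).trans (le_of_eq ?_)
      · gcongr; exact i.le_succ
      · push_cast; ring
    · rw [Finset.sum_const, Finset.card_range, nsmul_eq_mul]
      push_cast
      apply le_of_eq
      field_simp
  have hlim : Tendsto (fun n : ℕ => C * T ^ 2 / ((n : ℝ) + 1)) atTop (𝓝 0) := by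
    have := (tendsto_one_div_add_atTop_nhds_zero_nat (𝕜 := ℝ)).const_mul (C * T ^ 2)
    simpa [div_eq_mul_inv] using this
  have hzero : ∀ m, ∀ᵐ ω ∂μ, ∃ n ≥ m, ω ∉ B n := fun m => by
    have h0 : μ.real (⋂ n ≥ m, B n) ≤ 0 := ge_of_tendsto hlim (by
      filter_upwards [eventually_ge_atTop m] with n hn
      exact (measureReal_mono (biInter_subset_of_mem (show n ∈ {n | n ≥ m} from hn))
        (measure_ne_top _ _)).trans (hB n))
    have h1 : μ (⋂ n ≥ m, B n) = 0 :=
      (measureReal_eq_zero_iff (measure_ne_top _ _)).1 (le_antisymm h0 measureReal_nonneg)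
    filter_upwards [measure_eq_zero_iff_ae_notMem.1 h1] with ω hω
    simpa using hω
  filter_upwards [ae_all_iff.2 hzero, ae_all_iff.2 fun j => (h.poisson j).monotone]
    with ω hω hmono t ht s hs hconst
  by_contra! hcon
  -- This makes the mesh smaller than `t - s`. The cell with index `c` below contains `t` and starts
  -- after `s`, so it would contain the double jump.
  obtain ⟨m, hm⟩ := exists_nat_gt (T / (t - s))
  obtain ⟨n, hn, hnB⟩ := hω m
  have hts : 0 < t - s := sub_pos.2 hs.2
  have hTpos : 0 < T := ht.1.trans_le ht.2
  have hd : 0 < T / (n + 1) := by positivity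
  have hmesh : T / (n + 1) < t - s := by
    rw [div_lt_iff₀ (by positivity)]
    rw [div_lt_iff₀ hts] at hm
    have : (m : ℝ) ≤ n := by exact_mod_cast hn
    nlinarith
  obtain ⟨c, hc⟩ : ∃ c, ⌈t / (T / (n + 1))⌉₊ = c + 1 :=
    Nat.exists_eq_succ_of_ne_zero (Nat.ceil_pos.2 (div_pos ht.1 hd)).ne'
  have hup : t ≤ (c + 1 : ℕ) * (T / (n + 1)) := by
    rw [← hc, ← div_le_iff₀ hd]
    exact Nat.le_ceil _
  have hlow : c * (T / (n + 1)) < t := by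
    have := Nat.ceil_lt_add_one (div_pos ht.1 hd).le
    rw [hc] at this
    push_cast at this
    rw [← lt_div_iff₀ hd]
    linarith
  have hcn : c + 1 ≤ n + 1 := by
    rw [← hc]
    refine Nat.ceil_le.2 ?_
    rw [div_le_iff₀ hd]
    push_cast
    rw [mul_div_cancel₀ _ (by positivity)]
    exact ht.2
  have hls : s ≤ c * (T / (n + 1)) := by push_cast at hup; linarith
  refine hnB (mem_biUnion (Finset.mem_range.2 hcn) ?_)
  have h1 : ∀ j, N j (c * (T / (n + 1))) ω = N j s ω := hconst _ ⟨hls, hlow⟩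
  have h2 : ∀ j, N j t ω ≤ N j ((c + 1 : ℕ) * (T / (n + 1))) ω := fun j =>
    hmono j ⟨ht.1.le, ht.2⟩ ⟨by positivity, hgrid hcn⟩ hup
  have h3 : ∑ j, (N j t ω - N j s ω) ≤
      ∑ j, N j ((c + 1 : ℕ) * (T / (n + 1))) ω - ∑ j, N j s ω := by
    have h5 : ∀ j, N j s ω ≤ N j t ω := fun j =>
      hmono j ⟨hs.1, hs.2.le.trans ht.2⟩ ⟨ht.1.le, ht.2⟩ hs.2.le
    rw [Finset.sum_tsub_distrib _ fun j _ => h5 j]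
    exact Nat.sub_le_sub_right (Finset.sum_le_sum fun j _ => h2 j) _
  have h4 : 2 + ∑ j, N j s ω ≤ ∑ j, N j ((c + 1 : ℕ) * (T / (n + 1))) ω := by omega
  have h5 : (2 : ℝ) + ∑ j, (N j s ω : ℝ) ≤ ∑ j, (N j ((c + 1 : ℕ) * (T / (n + 1))) ω : ℝ) := by
    exact_mod_cast h4
  simp only [mem_ofPred_eq, h1]
  linarith

end IsPoissonFamily

end PoissonFamily

/-! ### Carathéodory solutions and the random counting paths -/

theorem AbsolutelyContinuousOnInterval.congr_dist {f g : ℝ → ℝ} {a b : ℝ}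
    (hf : AbsolutelyContinuousOnInterval f a b)
    (h : ∀ x ∈ uIcc a b, ∀ y ∈ uIcc a b, dist (g x) (g y) = dist (f x) (f y)) :
    AbsolutelyContinuousOnInterval g a b := by
  rw [absolutelyContinuousOnInterval_iff] at hf ⊢
  intro ε hε
  obtain ⟨δ, hδ, H⟩ := hf ε hε
  refine ⟨δ, hδ, fun E hE hlt => ?_⟩
  rw [Finset.sum_congr rfl fun i hi => h _ (hE.1 i hi).1 _ (hE.1 i hi).2]
  exact H E hE hlt

section Model

open scoped Matrix.Norms.L2Operator

variable {n M : ℕ}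

theorem solvesODE_of_eq_integral {T : ℝ} (hT : 0 ≤ T) {X V f : ℝ → RMat n} {c : RMat n}
    (hf : IntervalIntegrable f volume 0 T) (hX : ∀ t ∈ Icc 0 T, X t = c + ∫ s in (0 : ℝ)..t, f s)
    (hV : ∀ t ∈ Icc 0 T, V t = f t) : SolvesODE T X V := by
  refine ⟨fun a b => ?_, ?_⟩
  · have hfab : IntervalIntegrable (fun s => f s a b) volume 0 T :=
      ⟨(entryCLM a b).integrable_comp hf.1, (entryCLM a b).integrable_comp hf.2⟩
    refine (hfab.absolutelyContinuousOnInterval_intervalIntegral left_mem_uIcc).congr_dist ?_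
    have hval : ∀ x ∈ uIcc 0 T, X x a b = c a b + ∫ s in (0 : ℝ)..x, f s a b := fun x hx => by
      have hi : IntervalIntegrable f volume 0 x :=
        hf.mono_set (uIcc_subset_uIcc_left hx)
      rw [uIcc_of_le hT] at hx
      rw [hX x hx, Matrix.add_apply]
      congr 1
      exact ((entryCLM a b).intervalIntegral_comp_comm hi).symm
    intro x hx y hy
    rw [hval x hx, hval y hy, dist_add_left]
  · rw [ae_restrict_iff' measurableSet_Icc]
    -- The integral formula holds on `[0, T]` only, so a two-sided derivative is obtained at
    -- interior points; the endpoints are null.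
    have h0 : ∀ᵐ t : ℝ, t ≠ 0 := by simp [ae_iff, measure_singleton]
    have h1 : ∀ᵐ t : ℝ, t ≠ T := by simp [ae_iff, measure_singleton]
    filter_upwards [hf.ae_hasDerivAt_integral, h0, h1] with t ht ht0 htT htm
    rw [uIcc_of_le hT] at ht
    have := (ht htm 0 ⟨le_rfl, hT⟩).const_add c
    rw [hV t htm]
    refine this.congr_of_eventuallyEq ?_
    filter_upwards [Ioo_mem_nhds (lt_of_le_of_ne htm.1 (Ne.symm ht0)) (lt_of_le_of_ne htm.2 htT)]
      with s hs using hX s ⟨hs.1.le, hs.2.le⟩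

variable {Ω : Type*} [MeasurableSpace Ω] {μ : Measure Ω} {T : ℝ}
  {lam : Fin M → ℝ → ℝ} {N : Fin M → ℝ → Ω → ℕ}

/-- The counting paths on `[0, T]` as a random element of the path space. -/
def pathMap (T : ℝ) (N : Fin M → ℝ → Ω → ℕ) (ω : Ω) : Fin M → Icc (0 : ℝ) T → ℕ :=
  fun j r => N j r ω

namespace IsPoissonFamily

variable (h : IsPoissonFamily μ T lam N)
include h

theorem measurable_pathMap : Measurable (pathMap T N) :=
  measurable_pi_iff.2 fun j => measurable_pi_iff.2 fun r => (h.poisson j).measurable r r.2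

theorem ae_regPaths_eq : ∀ᵐ ω ∂μ, ∀ t ∈ Icc 0 T, ∀ j,
    regPaths h.nonneg (pathMap T N ω) j t = N j t ω := by
  filter_upwards [ae_all_iff.2 fun j => (h.poisson j).monotone,
    ae_all_iff.2 fun j => (h.poisson j).rightCont] with ω hm hr t ht j
  refine regPath_eq h.nonneg _ (fun a b hab => hm j a.2 b.2 hab) (fun r hrT => ?_) ⟨t, ht⟩
  have := hr j r ⟨r.2.1, hrT⟩
  rw [ContinuousWithinAt, nhds_discrete ℕ, tendsto_pure] at this
  exact this.mono fun s hs _ => hs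

/-- Stopping keeps the path monotone and right-continuous: before `s` it follows `N`, afterwards it
is constant. Hence regularization does not alter it. -/
theorem ae_regPaths_stopped_eq (s : Icc (0 : ℝ) T) : ∀ᵐ ω ∂μ, ∀ t ∈ Icc 0 (s : ℝ), ∀ j,
    regPaths h.nonneg (stopPaths s (pathMap T N ω)) j t = N j t ω := by
  filter_upwards [ae_all_iff.2 fun j => (h.poisson j).monotone,
    ae_all_iff.2 fun j => (h.poisson j).rightCont] with ω hm hr t ht j
  have htT : t ∈ Icc 0 T := ⟨ht.1, ht.2.trans s.2.2⟩
  have hst : min (⟨t, htT⟩ : Icc (0 : ℝ) T) s = ⟨t, htT⟩ := min_eq_left ht.2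
  have := regPath_eq h.nonneg (stopPaths s (pathMap T N ω) j)
    (fun a b hab => hm j (min a s).2 (min b s).2 (min_le_min_right s hab)) (fun r hrT => ?_) ⟨t, htT⟩
  · rw [regPaths, this, stopPaths, hst]; rfl
  · rcases lt_or_ge (r : ℝ) s with hrs | hrs
    · have hc := hr j r ⟨r.2.1, hrT⟩
      rw [ContinuousWithinAt, nhds_discrete ℕ, tendsto_pure] at hc
      filter_upwards [hc, Ico_mem_nhdsGE hrs] with u hu hus hum
      have e1 : min (⟨u, hum⟩ : Icc (0 : ℝ) T) s = ⟨u, hum⟩ := min_eq_left hus.2.le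
      have e2 : min r s = r := min_eq_left hrs.le
      rw [stopPaths, stopPaths, e1, e2]
      exact hu
    · filter_upwards [self_mem_nhdsWithin] with u hu hum
      have e1 : min (⟨u, hum⟩ : Icc (0 : ℝ) T) s = s := min_eq_right (hrs.trans hu)
      have e2 : min r s = s := min_eq_right hrs
      rw [stopPaths, stopPaths, e1, e2]

end IsPoissonFamily

/-- The covariance process started from `p₀` and driven by the counting processes `N`. -/
noncomputable def covPath (hT : 0 ≤ T) (A Q : RMat n) (S : Fin M → RMat n)
    (N : Fin M → ℝ → Ω → ℕ) (p₀ : RMat n) (t : ℝ) (ω : Ω) : RMat n :=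
  covSolution A Q S (regPaths hT (pathMap T N ω)) p₀ t

end Model

/-! ### The model process from a fixed initial covariance -/

section CovPaths

open scoped Matrix.Norms.L2Operator

variable {n M : ℕ} {m : Fin M → ℕ} {T : ℝ} {A Q : RMat n}
  {H : ∀ j, Matrix (Fin (m j)) (Fin n) ℝ} {R : ∀ j, Matrix (Fin (m j)) (Fin (m j)) ℝ}
  {S : Fin M → RMat n} {p₀ : RMat n}
  {Ω : Type*}

theorem Matrix.PosDef.of_inv {X : RMat n} (h : (X⁻¹).PosDef) : X.PosDef := by
  have := h.inv
  rwa [Matrix.nonsing_inv_nonsing_inv _ ((Matrix.isUnit_nonsing_inv_det_iff).1 h.isUnit_det')]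
    at this

theorem Matrix.PosDef.inv_inv' {X : RMat n} (h : X.PosDef) : X⁻¹⁻¹ = X :=
  Matrix.nonsing_inv_nonsing_inv _ h.isUnit_det'

section

variable (hT : 0 ≤ T) (hQ : Q.PosSemidef) (hS : ∀ j, (S j).PosSemidef) (hp : p₀.PosDef)
include hQ hS hp

theorem covPath_isInfoPath (N : Fin M → ℝ → Ω → ℕ) (ω : Ω) :
    IsInfoPath T A Q S (regPaths hT (pathMap T N ω)) p₀⁻¹
      fun t => (covPath hT A Q S N p₀ t ω)⁻¹ :=
  isInfoPath_inv_covSolution hT hQ hS (isStepPath_regPaths hT _) hp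

theorem covPath_posDef (N : Fin M → ℝ → Ω → ℕ) (ω : Ω) {t : ℝ} (ht : t ∈ Icc 0 T) :
    (covPath hT A Q S N p₀ t ω).PosDef :=
  ((covPath_isInfoPath hT hQ hS hp N ω).posDef t ht).of_inv

theorem covPath_inv_rightCont (N : Fin M → ℝ → Ω → ℕ) (ω : Ω) :
    ∀ t ∈ Ico 0 T, ContinuousWithinAt (fun t => (covPath hT A Q S N p₀ t ω)⁻¹) (Ici t) t :=
  rightCont_of_continuousOn_sub (isStepPath_regPaths hT _)
    (IsInfoPath.continuousOn_sub hT (covPath_isInfoPath hT hQ hS hp N ω))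

theorem covPath_rightCont (N : Fin M → ℝ → Ω → ℕ) (ω : Ω) :
    ∀ t ∈ Ico 0 T, ContinuousWithinAt (fun t => covPath hT A Q S N p₀ t ω) (Ici t) t := by
  intro t ht
  have hP := covPath_posDef (A := A) hT hQ hS hp N ω (Ico_subset_Icc_self ht)
  have h1 := (continuousAt_rmat_inv hP.inv.isUnit_det').comp_continuousWithinAt
    (f := fun t => (covPath hT A Q S N p₀ t ω)⁻¹)
    (covPath_inv_rightCont (A := A) hT hQ hS hp N ω t ht)
  refine h1.congr_of_eventuallyEq ?_ hP.inv_inv'.symm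
  filter_upwards [Ico_mem_nhdsGE ht.2] with s hs
  exact (covPath_posDef hT hQ hS hp N ω ⟨ht.1.trans hs.1, hs.2.le⟩).inv_inv'.symm

theorem exists_norm_covPath_le (N : Fin M → ℝ → Ω → ℕ) :
    ∃ C, 0 ≤ C ∧ ∀ ω, ∀ t ∈ Icc 0 T, ‖covPath hT A Q S N p₀ t ω‖ ≤ C := by
  obtain ⟨C, hC0, hC⟩ := exists_trace_inv_infoPath_le (A := A) hT hQ hS hp.inv
  have hE := entryConst_nonneg n
  refine ⟨entryConst n * C, by positivity, fun ω t ht => ?_⟩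
  have hP := covPath_posDef (A := A) hT hQ hS hp N ω ht
  refine hP.posSemidef.norm_le_trace.trans (mul_le_mul_of_nonneg_left ?_ hE)
  have := hC _ (isStepPath_regPaths hT _) _ (covPath_isInfoPath hT hQ hS hp N ω) t ht
  rwa [hP.inv_inv'] at this

theorem exists_norm_covPath_inv_le (N : Fin M → ℝ → Ω → ℕ) :
    ∃ C, 0 ≤ C ∧ ∀ ω, ∀ t ∈ Icc 0 T, ‖(covPath hT A Q S N p₀ t ω)⁻¹‖ ≤
      C * (1 + ∑ j, (regPaths hT (pathMap T N ω) j t : ℝ)) := by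
  obtain ⟨C, hC0, hC⟩ := exists_norm_infoPath_le (A := A) hT hQ hS p₀⁻¹
  exact ⟨C, hC0, fun ω t ht => hC _ (isStepPath_regPaths hT _) _
    (covPath_isInfoPath hT hQ hS hp N ω) t ht⟩

end

theorem continuousAt_jumpMap {k : ℕ} (G : Matrix (Fin k) (Fin n) ℝ) {V : RMat k} (hV : V.PosDef)
    {P : RMat n} (hP : P.PosSemidef) : ContinuousAt (jumpMap G V) P := by
  have h1 : ContinuousAt (fun P : RMat n => G * P * Gᵀ + V) P := by fun_prop
  have h2 : ContinuousAt (fun P : RMat n => (G * P * Gᵀ + V)⁻¹) P :=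
    ContinuousAt.comp (g := fun X : RMat k => X⁻¹)
      (continuousAt_rmat_inv (innovation_posDef G hV hP).isUnit_det') h1
  unfold jumpMap
  fun_prop

theorem stronglyMeasurable_jumpMap {k : ℕ} (G : Matrix (Fin k) (Fin n) ℝ) (V : RMat k)
    {α : Type*} [MeasurableSpace α] {F : α → RMat n} (hF : StronglyMeasurable F) :
    StronglyMeasurable fun x => jumpMap G V (F x) := by
  have h1 : StronglyMeasurable fun x => G * F x * Gᵀ + V :=
    (show Continuous fun P : RMat n => G * P * Gᵀ + V by fun_prop).comp_stronglyMeasurable hF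
  have h2 : StronglyMeasurable fun x => Gᵀ * (G * F x * Gᵀ + V)⁻¹ * G :=
    (show Continuous fun C : RMat k => Gᵀ * C * G by fun_prop).comp_stronglyMeasurable h1.matrix_inv
  have h3 := (hF.mul h2).mul hF
  have e : (fun x => jumpMap G V (F x)) =
      (F * fun x => Gᵀ * (G * F x * Gᵀ + V)⁻¹ * G) * F := by
    funext x
    simp only [jumpMap, Pi.mul_apply, Matrix.mul_assoc]
  rw [e]
  exact h3

/-- From `0 ⪯ g(P) ⪯ P`: the jump map grows at most linearly, so it is integrable whenever `P` is.
-/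
theorem norm_jumpMap_le {k : ℕ} (G : Matrix (Fin k) (Fin n) ℝ) {V : RMat k} (hV : V.PosDef)
    {P : RMat n} (hP : P.PosDef) : ‖jumpMap G V P‖ ≤ entryConst n * (‖traceCLM n‖ * ‖P‖) := by
  refine (jumpMap_posSemidef G hV hP).norm_le_trace.trans
    (mul_le_mul_of_nonneg_left ?_ (entryConst_nonneg n))
  have h1 := (sub_jumpMap_posSemidef G hV hP).trace_nonneg
  rw [Matrix.trace_sub] at h1
  exact (by linarith : (jumpMap G V P).trace ≤ P.trace).trans
    ((le_abs_self _).trans (abs_trace_le P))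

variable [MeasurableSpace Ω] {μ : Measure Ω} {lam : Fin M → ℝ → ℝ} {N : Fin M → ℝ → Ω → ℕ}

namespace IsPoissonFamily

variable (h : IsPoissonFamily μ T lam N) (hQ : Q.PosSemidef) (hS : ∀ j, (S j).PosSemidef)
  (hp : p₀.PosDef)
include h

theorem stronglyMeasurable_covPath (A Q : RMat n) (S : Fin M → RMat n) (p₀ : RMat n) (t : ℝ) :
    StronglyMeasurable (covPath h.nonneg A Q S N p₀ t) := by
  have h1 : Measurable fun ω => ((fun a b => p₀ a b), pathMap T N ω) :=
    measurable_const.prodMk h.measurable_pathMap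
  have h2 := (stronglyMeasurable_covSolution h.nonneg A Q S t).comp_measurable h1
  have e : covPath h.nonneg A Q S N p₀ t =
      (fun q : (Fin n → Fin n → ℝ) × (Fin M → Icc (0 : ℝ) T → ℕ) =>
        covSolution A Q S (regPaths h.nonneg q.2) (Matrix.of q.1) t) ∘
      fun ω => ((fun a b => p₀ a b), pathMap T N ω) := rfl
  rw [e]
  exact h2

include hQ hS hp

theorem exists_ae_norm_covPath_inv_le : ∃ C, 0 ≤ C ∧ ∀ᵐ ω ∂μ, ∀ t ∈ Icc 0 T,
    ‖(covPath h.nonneg A Q S N p₀ t ω)⁻¹‖ ≤ C * (1 + ∑ j, (N j T ω : ℝ)) := by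
  obtain ⟨C, hC0, hC⟩ := exists_norm_covPath_inv_le (A := A) h.nonneg hQ hS hp N
  refine ⟨C, hC0, ?_⟩
  filter_upwards [h.ae_regPaths_eq, ae_all_iff.2 fun j => (h.poisson j).monotone]
    with ω hω hm t ht
  refine (hC ω t ht).trans (mul_le_mul_of_nonneg_left ?_ hC0)
  gcongr with j
  rw [hω t ht j]
  exact hm j ht ⟨h.nonneg, le_rfl⟩ ht.2

theorem integrable_covPath {t : ℝ} (ht : t ∈ Icc 0 T) :
    Integrable (covPath h.nonneg A Q S N p₀ t) μ := by
  have := h.isProbabilityMeasure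
  obtain ⟨C, -, hC⟩ := exists_norm_covPath_le (A := A) h.nonneg hQ hS hp N
  exact Integrable.of_bound (h.stronglyMeasurable_covPath A Q S p₀ t).aestronglyMeasurable C
    (Eventually.of_forall fun ω => hC ω t ht)

/-- A continuous function of quadratic growth of the information process is dominated, uniformly in
time, by an integrable variable. -/
theorem exists_dominating {F : RMat n → RMat n} {c : ℝ} (hc : 0 ≤ c)
    (hF : ∀ Y, ‖F Y‖ ≤ c * (1 + ‖Y‖) ^ 2) : ∃ b : Ω → ℝ, Integrable b μ ∧ ∀ᵐ ω ∂μ, ∀ t ∈ Icc 0 T,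
      ‖F (covPath h.nonneg A Q S N p₀ t ω)⁻¹‖ ≤ b ω := by
  obtain ⟨C, hC0, hC⟩ := h.exists_ae_norm_covPath_inv_le (A := A) hQ hS hp
  refine ⟨fun ω => c * ((1 + C) ^ 2 * (1 + ∑ j, (N j T ω : ℝ)) ^ 2),
    ((h.integrable_total_sq h.nonneg le_rfl).const_mul _).const_mul _, ?_⟩
  filter_upwards [hC] with ω hω t ht
  refine (hF _).trans (mul_le_mul_of_nonneg_left ?_ hc)
  rw [← mul_pow]
  have h1 := hω t ht
  have h2 : (0 : ℝ) ≤ ∑ j, (N j T ω : ℝ) := Finset.sum_nonneg fun _ _ => Nat.cast_nonneg _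
  have h3 := norm_nonneg (covPath h.nonneg A Q S N p₀ t ω)⁻¹
  gcongr
  nlinarith

theorem integrable_comp_inv {F : RMat n → RMat n} (hFc : Continuous F) {c : ℝ} (hc : 0 ≤ c)
    (hF : ∀ Y, ‖F Y‖ ≤ c * (1 + ‖Y‖) ^ 2) {t : ℝ} (ht : t ∈ Icc 0 T) :
    Integrable (fun ω => F (covPath h.nonneg A Q S N p₀ t ω)⁻¹) μ := by
  obtain ⟨b, hb, hbd⟩ := h.exists_dominating (A := A) hQ hS hp hc hF
  exact hb.mono' (hFc.comp_stronglyMeasurable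
    (h.stronglyMeasurable_covPath A Q S p₀ t).matrix_inv).aestronglyMeasurable
    (hbd.mono fun ω hω => hω t ht)

theorem integrable_covPath_inv {t : ℝ} (ht : t ∈ Icc 0 T) :
    Integrable (fun ω => (covPath h.nonneg A Q S N p₀ t ω)⁻¹) μ :=
  h.integrable_comp_inv (F := id) hQ hS hp continuous_id zero_le_one
    (fun Y => by have := norm_nonneg Y; simp only [id]; nlinarith) ht

theorem integrable_covPath_inv_quadratic (B : RMat n) {t : ℝ} (ht : t ∈ Icc 0 T) :
    Integrable (fun ω => (covPath h.nonneg A Q S N p₀ t ω)⁻¹ * B *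
      (covPath h.nonneg A Q S N p₀ t ω)⁻¹) μ :=
  h.integrable_comp_inv (F := fun Y => Y * B * Y) (c := ‖B‖) hQ hS hp (by fun_prop) (norm_nonneg _)
    (fun Y => by
      have h1 := norm_nonneg Y
      have h2 := norm_nonneg B
      refine ((norm_mul_le _ _).trans (mul_le_mul_of_nonneg_right (norm_mul_le _ _) h1)).trans ?_
      have h3 : ‖Y‖ * ‖Y‖ ≤ (1 + ‖Y‖) ^ 2 := by nlinarith
      nlinarith [mul_le_mul_of_nonneg_left h3 h2]) ht

theorem integrable_jumpMap_covPath {k : ℕ} (G : Matrix (Fin k) (Fin n) ℝ) {V : RMat k}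
    (hV : V.PosDef) {t : ℝ} (ht : t ∈ Icc 0 T) :
    Integrable (fun ω => jumpMap G V (covPath h.nonneg A Q S N p₀ t ω)) μ :=
  ((h.integrable_covPath hQ hS hp ht).norm.const_mul (entryConst n * ‖traceCLM n‖)).mono'
    (stronglyMeasurable_jumpMap G V
      (h.stronglyMeasurable_covPath A Q S p₀ t)).aestronglyMeasurable
    (Eventually.of_forall fun ω => by
      rw [mul_assoc]
      exact norm_jumpMap_le G hV (covPath_posDef h.nonneg hQ hS hp N ω ht))

end IsPoissonFamily

end CovPaths

/-! ### The mean information -/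

section MeanInformation

open scoped Matrix.Norms.L2Operator

variable {n M : ℕ} {T : ℝ} {A Q : RMat n} {S : Fin M → RMat n} {p₀ : RMat n}
  {Ω : Type*} [MeasurableSpace Ω] {μ : Measure Ω} {lam : Fin M → ℝ → ℝ} {N : Fin M → ℝ → Ω → ℕ}

theorem integral_infoDrift {Y : Ω → RMat n} (hY : Integrable Y μ)
    (hYQ : Integrable (fun ω => Y ω * Q * Y ω) μ) :
    ∫ ω, infoDrift A Q (Y ω) ∂μ =
      -((∫ ω, Y ω ∂μ) * A) - Aᵀ * (∫ ω, Y ω ∂μ) - ∫ ω, Y ω * Q * Y ω ∂μ := by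
  have hYA : Integrable (fun ω => -(Y ω * A)) μ := (hY.mul_const A).neg
  have hAY : Integrable (fun ω => Aᵀ * Y ω) μ := hY.const_mul Aᵀ
  have h1 : Integrable (fun ω => -(Y ω * A) - Aᵀ * Y ω) μ := hYA.sub hAY
  unfold infoDrift
  rw [integral_sub h1 hYQ, integral_sub hYA hAY, integral_neg,
    integral_mul_const_of_integrable hY, integral_const_mul_of_integrable hY]

/-- The gap is a matrix variance: with `Z` the mean it equals `E[(Y - Z) Q (Y - Z)]`, whose
integrand is a congruence of `Q`. -/
theorem infoJensenGap_integral_posSemidef [IsProbabilityMeasure μ] (hQ : Q.PosSemidef)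
    {Y : Ω → RMat n} (hY : Integrable Y μ) (hYQ : Integrable (fun ω => Y ω * Q * Y ω) μ)
    (hpos : ∀ ω, (Y ω).PosSemidef) :
    (infoJensenGap Q (∫ ω, Y ω * Q * Y ω ∂μ) (∫ ω, Y ω ∂μ)).PosSemidef := by
  have hmean := posSemidef_integral hY (Eventually.of_forall hpos)
  generalize hZ : ∫ ω, Y ω ∂μ = Z at hmean ⊢
  have h1 : Integrable (fun ω => Y ω * (Q * Z)) μ := hY.mul_const (Q * Z)
  have h2 : Integrable (fun ω => Z * Q * Y ω) μ := hY.const_mul (Z * Q)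
  have h3 : Integrable (fun ω => Y ω * Q * Y ω - Y ω * (Q * Z)) μ := hYQ.sub h1
  have h4 : Integrable (fun ω => Y ω * Q * Y ω - Y ω * (Q * Z) - Z * Q * Y ω) μ := h3.sub h2
  have h5 : Integrable (fun ω => Y ω * Q * Y ω - Y ω * (Q * Z) - Z * Q * Y ω + Z * Q * Z) μ :=
    h4.add (integrable_const _)
  have e : infoJensenGap Q (∫ ω, Y ω * Q * Y ω ∂μ) Z =
      ∫ ω, (Y ω * Q * Y ω - Y ω * (Q * Z) - Z * Q * Y ω + Z * Q * Z) ∂μ := by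
    rw [integral_add h4 (integrable_const _), integral_sub h3 h2, integral_sub hYQ h1,
      integral_mul_const_of_integrable hY, integral_const_mul_of_integrable hY, hZ, infoJensenGap]
    simp [← mul_assoc]
  rw [e]
  refine posSemidef_integral h5 (Eventually.of_forall fun ω => ?_)
  have h3 := hQ.transpose_mul_mul (Y ω - Z)
  rw [Matrix.transpose_sub, (hpos ω).transpose_eq, hmean.transpose_eq] at h3
  convert h3 using 1
  simp only [sub_mul, mul_sub, mul_assoc]
  abel

namespace IsPoissonFamily

variable (h : IsPoissonFamily μ T lam N)
include h

theorem integral_count {t : ℝ} (ht : t ∈ Icc 0 T) (j : Fin M) :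
    Integrable (fun ω => (N j t ω : ℝ)) μ ∧ ∫ ω, (N j t ω : ℝ) ∂μ = ∫ u in (0 : ℝ)..t, lam j u := by
  obtain ⟨h1, h2⟩ := h.integral_increment le_rfl ht.1 ht.2 j
  have he : (fun ω => (N j t ω : ℝ) - N j 0 ω) =ᵐ[μ] fun ω => (N j t ω : ℝ) := by
    filter_upwards [(h.poisson j).zero] with ω hω
    simp [hω]
  exact ⟨h1.congr he, (integral_congr_ae he).symm.trans h2⟩

theorem integral_infoSum (S : Fin M → RMat n) {t : ℝ} (ht : t ∈ Icc 0 T) :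
    Integrable (fun ω => infoSum S fun j => N j t ω) μ ∧
      ∫ ω, infoSum S (fun j => N j t ω) ∂μ = ∑ j, (∫ u in (0 : ℝ)..t, lam j u) • S j := by
  unfold infoSum
  have h1 : ∀ j ∈ Finset.univ, Integrable (fun ω => (N j t ω : ℝ) • S j) μ := fun j _ =>
    (h.integral_count ht j).1.smul_const (S j)
  refine ⟨integrable_finsetSum _ h1, ?_⟩
  rw [integral_finsetSum _ h1]
  refine Finset.sum_congr rfl fun j _ => ?_
  rw [integral_smul_const, (h.integral_count ht j).2]

variable (hQ : Q.PosSemidef) (hS : ∀ j, (S j).PosSemidef) (hp : p₀.PosDef)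
include hQ hS hp

theorem integrable_prod_infoDrift :
    Integrable (fun q : ℝ × Ω => infoDrift A Q (covPath h.nonneg A Q S N p₀ q.1 q.2)⁻¹)
      ((volume.restrict (Icc 0 T)).prod μ) := by
  have := h.isProbabilityMeasure
  obtain ⟨b, hb, hbd⟩ := h.exists_dominating (A := A) hQ hS hp (by positivity)
    (norm_infoDrift_le A Q)
  have hm : AEStronglyMeasurable
      (fun q : ℝ × Ω => infoDrift A Q (covPath h.nonneg A Q S N p₀ q.1 q.2)⁻¹)
      ((volume.restrict (Icc 0 T)).prod μ) :=
    aestronglyMeasurable_uncurry_of_rightCont h.nonneg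
      (X := fun t ω => infoDrift A Q (covPath h.nonneg A Q S N p₀ t ω)⁻¹)
      (fun t ht => ((continuous_infoDrift A Q).comp_stronglyMeasurable
        (h.stronglyMeasurable_covPath A Q S p₀ t).matrix_inv).aestronglyMeasurable)
      (Eventually.of_forall fun ω t ht => (continuous_infoDrift A Q).continuousAt
        |>.comp_continuousWithinAt (covPath_inv_rightCont h.nonneg hQ hS hp N ω t ht))
  refine (integrable_prod_iff hm).2 ⟨?_, Integrable.of_bound hm.norm.integral_prod_right'
    (∫ ω, b ω ∂μ) ?_⟩
  · filter_upwards [ae_restrict_mem measurableSet_Icc] with t ht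
    exact h.integrable_comp_inv hQ hS hp (continuous_infoDrift A Q) (by positivity)
      (norm_infoDrift_le A Q) ht
  · filter_upwards [ae_restrict_mem measurableSet_Icc] with t ht
    rw [Real.norm_of_nonneg (integral_nonneg fun _ => norm_nonneg _)]
    exact integral_mono_of_nonneg (Eventually.of_forall fun _ => norm_nonneg _) hb
      (hbd.mono fun ω hω => hω t ht)

theorem intervalIntegrable_mean_infoDrift :
    IntervalIntegrable (fun s => ∫ ω, infoDrift A Q (covPath h.nonneg A Q S N p₀ s ω)⁻¹ ∂μ)
      volume 0 T := by
  have := h.isProbabilityMeasure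
  rw [intervalIntegrable_iff_integrableOn_Icc_of_le h.nonneg]
  exact (h.integrable_prod_infoDrift hQ hS hp).integral_prod_left

/-- The noise enters additively with constant coefficients, so Fubini and the mean counts suffice.
-/
theorem mean_information_eq {t : ℝ} (ht : t ∈ Icc 0 T) :
    ∫ ω, (covPath h.nonneg A Q S N p₀ t ω)⁻¹ ∂μ =
      p₀⁻¹ + (∫ s in (0 : ℝ)..t, ∫ ω, infoDrift A Q (covPath h.nonneg A Q S N p₀ s ω)⁻¹ ∂μ) +
        ∑ j, (∫ u in (0 : ℝ)..t, lam j u) • S j := by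
  have := h.isProbabilityMeasure
  have hI : Integrable (fun q : ℝ × Ω =>
      infoDrift A Q (covPath h.nonneg A Q S N p₀ q.1 q.2)⁻¹)
      ((volume.restrict (Ioc 0 t)).prod μ) := by
    refine (h.integrable_prod_infoDrift hQ hS hp).mono_measure ?_
    exact Measure.prod_mono (Measure.restrict_mono
      (Ioc_subset_Icc_self.trans (Icc_subset_Icc_right ht.2)) le_rfl) le_rfl
  have he : (fun ω => (covPath h.nonneg A Q S N p₀ t ω)⁻¹) =ᵐ[μ] fun ω =>
      p₀⁻¹ + (∫ s in Ioc 0 t, infoDrift A Q (covPath h.nonneg A Q S N p₀ s ω)⁻¹) +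
        infoSum S fun j => N j t ω := by
    filter_upwards [h.ae_regPaths_eq] with ω hω
    rw [(covPath_isInfoPath h.nonneg hQ hS hp N ω).equation t ht,
      intervalIntegral.integral_of_le ht.1]
    simp only [hω t ht]
  obtain ⟨h1, h2⟩ := h.integral_infoSum S ht
  have h3 : Integrable
      (fun ω => ∫ s in Ioc 0 t, infoDrift A Q (covPath h.nonneg A Q S N p₀ s ω)⁻¹) μ :=
    hI.integral_prod_right
  have h4 : Integrable (fun ω => p₀⁻¹ +
      ∫ s in Ioc 0 t, infoDrift A Q (covPath h.nonneg A Q S N p₀ s ω)⁻¹) μ :=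
    (integrable_const _).add h3
  rw [integral_congr_ae he, integral_add h4 h1, integral_add (integrable_const _) h3, h2,
    intervalIntegral.integral_of_le ht.1]
  congr 2
  · simp
  · exact (integral_integral_swap hI).symm

/-- The Riccati equation of the mean information, corrected by the Jensen gap. -/
theorem solvesODE_mean_information :
    SolvesODE T (fun t => ∫ ω, (covPath h.nonneg A Q S N p₀ t ω)⁻¹ ∂μ) fun t =>
      -((∫ ω, (covPath h.nonneg A Q S N p₀ t ω)⁻¹ ∂μ) * A) -
        Aᵀ * (∫ ω, (covPath h.nonneg A Q S N p₀ t ω)⁻¹ ∂μ) -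
        (∫ ω, (covPath h.nonneg A Q S N p₀ t ω)⁻¹ ∂μ) * Q *
          (∫ ω, (covPath h.nonneg A Q S N p₀ t ω)⁻¹ ∂μ) + ∑ j, lam j t • S j -
        infoJensenGap Q (∫ ω, (covPath h.nonneg A Q S N p₀ t ω)⁻¹ * Q *
          (covPath h.nonneg A Q S N p₀ t ω)⁻¹ ∂μ)
          (∫ ω, (covPath h.nonneg A Q S N p₀ t ω)⁻¹ ∂μ) := by
  have h0 : (0 : ℝ) ∈ Icc 0 T := ⟨le_rfl, h.nonneg⟩
  have hlam : ∀ j, ∀ t ∈ Icc 0 T, IntervalIntegrable (fun u => lam j u • S j) volume 0 t :=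
    fun j t ht => ⟨(h.schedule.intervalIntegrable j h0 ht).1.smul_const _,
      (h.schedule.intervalIntegrable j h0 ht).2.smul_const _⟩
  have hlams : ∀ t ∈ Icc 0 T,
      IntervalIntegrable (fun u => ∑ j, lam j u • S j) volume 0 t := fun t ht => by
    have := IntervalIntegrable.sum Finset.univ fun j _ => hlam j t ht
    simpa [Finset.sum_fn] using this
  have hd := h.intervalIntegrable_mean_infoDrift (A := A) hQ hS hp
  have hT : T ∈ Icc 0 T := ⟨h.nonneg, le_rfl⟩
  refine solvesODE_of_eq_integral h.nonneg (c := p₀⁻¹) (hd.add (hlams T hT)) (fun t ht => ?_)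
    fun t ht => ?_
  · rw [h.mean_information_eq hQ hS hp ht, add_assoc, intervalIntegral.integral_add
      (hd.mono_set (uIcc_subset_uIcc_left (by rwa [uIcc_of_le h.nonneg]))) (hlams t ht),
      intervalIntegral.integral_finsetSum fun j _ => hlam j t ht]
    simp only [intervalIntegral.integral_smul_const]
  · have hY := h.integrable_covPath_inv (A := A) hQ hS hp ht
    have hYQ := h.integrable_covPath_inv_quadratic (A := A) hQ hS hp Q ht
    have e := integral_infoDrift (A := A) hY hYQ
    simp only [e, infoJensenGap]
    abel

/-- The Jensen gap of the information is positive semidefinite. -/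
theorem infoJensenGap_posSemidef {t : ℝ} (ht : t ∈ Icc 0 T) :
    (infoJensenGap Q (∫ ω, (covPath h.nonneg A Q S N p₀ t ω)⁻¹ * Q *
      (covPath h.nonneg A Q S N p₀ t ω)⁻¹ ∂μ)
      (∫ ω, (covPath h.nonneg A Q S N p₀ t ω)⁻¹ ∂μ)).PosSemidef := by
  have := h.isProbabilityMeasure
  have hY := h.integrable_covPath_inv (A := A) hQ hS hp ht
  have hYQ := h.integrable_covPath_inv_quadratic (A := A) hQ hS hp Q ht
  have hpos : ∀ ω, ((covPath h.nonneg A Q S N p₀ t ω)⁻¹).PosSemidef := fun ω =>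
    (covPath_posDef h.nonneg hQ hS hp N ω ht).inv.posSemidef
  exact infoJensenGap_integral_posSemidef hQ hY hYQ hpos

end IsPoissonFamily

end MeanInformation

/-! ### Second-order expansion of the mean covariance -/

section MeanCovariance

open scoped Matrix.Norms.L2Operator

variable {n M : ℕ} {m : Fin M → ℕ} {T : ℝ} {A Q : RMat n}
  {H : ∀ j, Matrix (Fin (m j)) (Fin n) ℝ} {R : ∀ j, Matrix (Fin (m j)) (Fin (m j)) ℝ}
  {S : Fin M → RMat n} {p₀ : RMat n}
  {Ω : Type*} [MeasurableSpace Ω] {μ : Measure Ω} {lam : Fin M → ℝ → ℝ} {N : Fin M → ℝ → Ω → ℕ}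

theorem entry_ext {X Y : RMat n} (h : ∀ a b, X a b = Y a b) : X = Y := Matrix.ext h

namespace IsPoissonFamily

variable (h : IsPoissonFamily μ T lam N) {s t : ℝ}
include h

theorem indepFun_past_increment (hs : s ∈ Icc 0 T) (hst : s ≤ t) (ht : t ≤ T) (j : Fin M) :
    IndepFun (fun ω => stopPaths ⟨s, hs⟩ (pathMap T N ω)) (fun ω => (N j t ω : ℝ) - N j s ω) μ := by
  have := h.isProbabilityMeasure
  have h1 := indepFun_stopPaths h.nonneg h.poisson h.indep j
    (s := ⟨s, hs⟩) (t := ⟨t, hs.1.trans hst, ht⟩) hst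
  have hcast : Measurable fun i : ℕ => (i : ℝ) := measurable_from_nat
  have h2 := h1.comp measurable_id hcast
  refine h2.congr .rfl ?_
  filter_upwards [h.ae_le hs.1 hst ht] with ω hω
  exact Nat.cast_sub (hω j)

/-- This factorization plays the role that the compensator has in stochastic integration. -/
theorem integral_increment_mul_past (hs : s ∈ Icc 0 T) (hst : s ≤ t) (ht : t ≤ T) (j : Fin M)
    {G : (Fin M → Icc (0 : ℝ) T → ℕ) → ℝ} (hG : Measurable G)
    (hGi : Integrable (fun ω => G (stopPaths ⟨s, hs⟩ (pathMap T N ω))) μ) :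
    Integrable (fun ω => ((N j t ω : ℝ) - N j s ω) * G (stopPaths ⟨s, hs⟩ (pathMap T N ω))) μ ∧
      ∫ ω, ((N j t ω : ℝ) - N j s ω) * G (stopPaths ⟨s, hs⟩ (pathMap T N ω)) ∂μ =
        (∫ u in s..t, lam j u) * ∫ ω, G (stopPaths ⟨s, hs⟩ (pathMap T N ω)) ∂μ := by
  obtain ⟨h1, h2⟩ := h.integral_increment hs.1 hst ht j
  have hind := ((h.indepFun_past_increment hs hst ht j).comp hG measurable_id).symm
  rw [← h2]
  exact ⟨hind.integrable_mul h1 hGi,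
    hind.integral_mul_eq_mul_integral h1.aestronglyMeasurable hGi.aestronglyMeasurable⟩

theorem integral_increment_smul_past (hs : s ∈ Icc 0 T) (hst : s ≤ t) (ht : t ≤ T) (j : Fin M)
    {G : (Fin M → Icc (0 : ℝ) T → ℕ) → RMat n} (hG : StronglyMeasurable G)
    (hGi : Integrable (fun ω => G (stopPaths ⟨s, hs⟩ (pathMap T N ω))) μ) :
    Integrable (fun ω => ((N j t ω : ℝ) - N j s ω) • G (stopPaths ⟨s, hs⟩ (pathMap T N ω))) μ ∧
      ∫ ω, ((N j t ω : ℝ) - N j s ω) • G (stopPaths ⟨s, hs⟩ (pathMap T N ω)) ∂μ =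
        (∫ u in s..t, lam j u) • ∫ ω, G (stopPaths ⟨s, hs⟩ (pathMap T N ω)) ∂μ := by
  obtain ⟨h1, -⟩ := h.integral_increment hs.1 hst ht j
  have hn := (h.integral_increment_mul_past hs hst ht j hG.norm.measurable hGi.norm).1
  have hint : Integrable
      (fun ω => ((N j t ω : ℝ) - N j s ω) • G (stopPaths ⟨s, hs⟩ (pathMap T N ω))) μ := by
    refine hn.norm.mono' (h1.aestronglyMeasurable.smul hGi.aestronglyMeasurable)
      (Eventually.of_forall fun ω => ?_)
    rw [norm_smul, norm_mul, norm_norm]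
  refine ⟨hint, entry_ext fun a b => ?_⟩
  have hab := (h.integral_increment_mul_past hs hst ht j
    ((entryCLM a b).continuous.comp_stronglyMeasurable hG).measurable
    ((entryCLM a b).integrable_comp hGi)).2
  rw [integral_matrix_apply hint, Matrix.smul_apply, integral_matrix_apply hGi, smul_eq_mul]
  exact hab

/-- The weight in the pathwise error bound is known at time `s`. Hence its product with the later
increment has a mean of order `t - s`, and the explicit factor `t - s` in that bound makes it second
order. -/
theorem integral_total_sq_mul_increment (hs : s ∈ Icc 0 T) (hst : s ≤ t) (ht : t ≤ T) :
    Integrable (fun ω => (1 + ∑ j, (N j s ω : ℝ)) ^ 2 *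
      (∑ j, (N j t ω : ℝ) - ∑ j, (N j s ω : ℝ))) μ ∧
      ∫ ω, (1 + ∑ j, (N j s ω : ℝ)) ^ 2 * (∑ j, (N j t ω : ℝ) - ∑ j, (N j s ω : ℝ)) ∂μ =
        (∫ ω, (1 + ∑ j, (N j s ω : ℝ)) ^ 2 ∂μ) * ∑ j, ∫ u in s..t, lam j u := by
  let G : (Fin M → Icc (0 : ℝ) T → ℕ) → ℝ := fun γ => (1 + ∑ j, (γ j ⟨s, hs⟩ : ℝ)) ^ 2
  have hG : Measurable G := by
    refine (measurable_const.add (Finset.measurable_fun_sum _ fun j _ => ?_)).pow_const 2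
    exact measurable_from_nat.comp ((measurable_pi_apply _).comp (measurable_pi_apply _))
  have hGe : ∀ ω, G (stopPaths ⟨s, hs⟩ (pathMap T N ω)) = (1 + ∑ j, (N j s ω : ℝ)) ^ 2 := fun ω => by
    simp only [G, stopPaths, pathMap, min_self]
  have hGi := h.integrable_total_sq hs.1 hs.2
  have key := fun j => h.integral_increment_mul_past hs hst ht j hG (by simpa only [hGe] using hGi)
  simp only [hGe] at key
  have e : ∀ ω, (1 + ∑ j, (N j s ω : ℝ)) ^ 2 * (∑ j, (N j t ω : ℝ) - ∑ j, (N j s ω : ℝ)) =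
      ∑ j, ((N j t ω : ℝ) - N j s ω) * (1 + ∑ j, (N j s ω : ℝ)) ^ 2 := fun ω => by
    rw [← Finset.sum_mul, Finset.sum_sub_distrib, mul_comm]
  simp only [e]
  refine ⟨integrable_finsetSum _ fun j _ => (key j).1, ?_⟩
  rw [integral_finsetSum _ fun j _ => (key j).1, mul_comm, Finset.sum_mul]
  exact Finset.sum_congr rfl fun j _ => (key j).2

section

variable (hQ : Q.PosSemidef) (hS : ∀ j, (S j).PosSemidef) (hp : p₀.PosDef)
include hQ hS hp

/-- Adaptedness in functional form: the covariance at `s` is a function of the stopped paths, to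
which independence from later increments applies. -/
theorem ae_covPath_eq_stopped (hs : s ∈ Icc 0 T) : ∀ᵐ ω ∂μ, covPath h.nonneg A Q S N p₀ s ω =
    covSolution A Q S (regPaths h.nonneg (stopPaths ⟨s, hs⟩ (pathMap T N ω))) p₀ s := by
  filter_upwards [h.ae_regPaths_eq, h.ae_regPaths_stopped_eq ⟨s, hs⟩] with ω h1 h2
  refine covSolution_congr hs.1 hQ hS (isStepPath_regPaths _ _) (isStepPath_regPaths _ _)
    (fun t ht j => ?_) hp
  rw [h1 t ⟨ht.1, ht.2.trans hs.2⟩ j, h2 t ht j]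

theorem integral_increment_smul_jumpMap (hs : s ∈ Icc 0 T) (hst : s ≤ t) (ht : t ≤ T) (j : Fin M)
    {k : ℕ} (G : Matrix (Fin k) (Fin n) ℝ) {V : RMat k} (hV : V.PosDef) :
    Integrable (fun ω => ((N j t ω : ℝ) - N j s ω) •
      jumpMap G V (covPath h.nonneg A Q S N p₀ s ω)) μ ∧
      ∫ ω, ((N j t ω : ℝ) - N j s ω) • jumpMap G V (covPath h.nonneg A Q S N p₀ s ω) ∂μ =
        (∫ u in s..t, lam j u) • ∫ ω, jumpMap G V (covPath h.nonneg A Q S N p₀ s ω) ∂μ := by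
  have hmap : Measurable fun γ : Fin M → Icc (0 : ℝ) T → ℕ => ((fun a b => p₀ a b), γ) :=
    measurable_const.prodMk measurable_id
  have hF := (stronglyMeasurable_covSolution h.nonneg A Q S s).comp_measurable hmap
  have hG := stronglyMeasurable_jumpMap G V hF
  have he := h.ae_covPath_eq_stopped (A := A) hQ hS hp hs
  have he1 : (fun ω => jumpMap G V (covPath h.nonneg A Q S N p₀ s ω)) =ᵐ[μ] fun ω =>
      jumpMap G V (covSolution A Q S (regPaths h.nonneg (stopPaths ⟨s, hs⟩ (pathMap T N ω))) p₀ s) :=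
    he.mono fun ω hω => congrArg (jumpMap G V) hω
  have he2 : (fun ω => ((N j t ω : ℝ) - N j s ω) •
      jumpMap G V (covPath h.nonneg A Q S N p₀ s ω)) =ᵐ[μ] fun ω =>
      ((N j t ω : ℝ) - N j s ω) • jumpMap G V
        (covSolution A Q S (regPaths h.nonneg (stopPaths ⟨s, hs⟩ (pathMap T N ω))) p₀ s) :=
    he1.mono fun ω hω => congrArg (((N j t ω : ℝ) - N j s ω) • ·) hω
  have hi := (h.integrable_jumpMap_covPath (A := A) hQ hS hp G hV hs).congr he1
  have key := h.integral_increment_smul_past hs hst ht j hG hi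
  rw [integral_congr_ae he1, integral_congr_ae he2]
  exact ⟨key.1.congr he2.symm, key.2⟩

theorem integrable_prod_lyapunov :
    Integrable (fun q : ℝ × Ω => A * covPath h.nonneg A Q S N p₀ q.1 q.2 +
      covPath h.nonneg A Q S N p₀ q.1 q.2 * Aᵀ + Q) ((volume.restrict (Icc 0 T)).prod μ) := by
  have := h.isProbabilityMeasure
  obtain ⟨C, hC0, hC⟩ := exists_norm_covPath_le (A := A) h.nonneg hQ hS hp N
  have hc : Continuous fun X : RMat n => A * X + X * Aᵀ + Q := by fun_prop
  have hm : AEStronglyMeasurable (fun q : ℝ × Ω => covPath h.nonneg A Q S N p₀ q.1 q.2)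
      ((volume.restrict (Icc 0 T)).prod μ) :=
    aestronglyMeasurable_uncurry_of_rightCont h.nonneg
      (fun t _ => (h.stronglyMeasurable_covPath A Q S p₀ t).aestronglyMeasurable)
      (Eventually.of_forall fun ω t ht => covPath_rightCont h.nonneg hQ hS hp N ω t ht)
  have hb : ∀ t ∈ Icc 0 T, ∀ ω, ‖A * covPath h.nonneg A Q S N p₀ t ω +
      covPath h.nonneg A Q S N p₀ t ω * Aᵀ + Q‖ ≤ (‖A‖ + ‖Aᵀ‖) * C + ‖Q‖ := fun t ht ω =>
    (norm_lyapunov_le A Q _).trans (by have := hC ω t ht; gcongr)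
  have hm' := hc.comp_aestronglyMeasurable hm
  refine (integrable_prod_iff hm').2 ⟨?_, Integrable.of_bound hm'.norm.integral_prod_right'
    ((‖A‖ + ‖Aᵀ‖) * C + ‖Q‖) ?_⟩
  · filter_upwards [ae_restrict_mem measurableSet_Icc] with t ht
    exact Integrable.of_bound (hc.comp_stronglyMeasurable
      (h.stronglyMeasurable_covPath A Q S p₀ t)).aestronglyMeasurable _
      (Eventually.of_forall (hb t ht))
  · filter_upwards [ae_restrict_mem measurableSet_Icc] with t ht
    rw [Real.norm_of_nonneg (integral_nonneg fun _ => norm_nonneg _)]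
    refine (integral_mono_of_nonneg (Eventually.of_forall fun _ => norm_nonneg _)
      (integrable_const ((‖A‖ + ‖Aᵀ‖) * C + ‖Q‖)) (Eventually.of_forall (hb t ht))).trans ?_
    simp

theorem integral_lyapunov (ht : t ∈ Icc 0 T) :
    ∫ ω, (A * covPath h.nonneg A Q S N p₀ t ω + covPath h.nonneg A Q S N p₀ t ω * Aᵀ + Q) ∂μ =
      A * (∫ ω, covPath h.nonneg A Q S N p₀ t ω ∂μ) +
        (∫ ω, covPath h.nonneg A Q S N p₀ t ω ∂μ) * Aᵀ + Q := by
  have := h.isProbabilityMeasure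
  have hX := h.integrable_covPath (A := A) hQ hS hp ht
  have h1 : Integrable (fun ω => A * covPath h.nonneg A Q S N p₀ t ω) μ := hX.const_mul A
  have h2 : Integrable (fun ω => covPath h.nonneg A Q S N p₀ t ω * Aᵀ) μ := hX.mul_const Aᵀ
  have h3 : Integrable (fun ω => A * covPath h.nonneg A Q S N p₀ t ω +
    covPath h.nonneg A Q S N p₀ t ω * Aᵀ) μ := h1.add h2
  rw [integral_add h3 (integrable_const _), integral_add h1 h2,
    integral_mul_const_of_integrable hX, integral_const_mul_of_integrable hX]
  simp

theorem intervalIntegrable_mean_lyapunov :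
    IntervalIntegrable (fun t => A * (∫ ω, covPath h.nonneg A Q S N p₀ t ω ∂μ) +
        (∫ ω, covPath h.nonneg A Q S N p₀ t ω ∂μ) * Aᵀ + Q) volume 0 T := by
  have := h.isProbabilityMeasure
  have h1 := (h.integrable_prod_lyapunov (A := A) hQ hS hp).integral_prod_left
  rw [intervalIntegrable_iff_integrableOn_Icc_of_le h.nonneg]
  refine Integrable.congr h1 ?_
  filter_upwards [ae_restrict_mem measurableSet_Icc] with t ht
  exact h.integral_lyapunov hQ hS hp ht

end

/-- Averaging the pathwise expansion factors the jump terms by independence. Its two error terms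
have means of order `(t - s)²`, one by the factorization of the weighted increment and one by the
second factorial moment. -/
theorem mean_increment_estimate (hQ : Q.PosSemidef) (hR : ∀ j, (R j).PosDef) (hp : p₀.PosDef)
    (hSdef : S = fun j => infoContribution (H j) (R j)) :
    ∃ C, 0 ≤ C ∧ ∀ s t, 0 ≤ s → s ≤ t → t ≤ T →
      ‖(∫ ω, covPath h.nonneg A Q S N p₀ t ω ∂μ) - (∫ ω, covPath h.nonneg A Q S N p₀ s ω ∂μ) -
        (∫ r in s..t, (A * (∫ ω, covPath h.nonneg A Q S N p₀ r ω ∂μ) +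
          (∫ ω, covPath h.nonneg A Q S N p₀ r ω ∂μ) * Aᵀ + Q)) +
        ∑ j, (∫ u in s..t, lam j u) •
          ∫ ω, jumpMap (H j) (R j) (covPath h.nonneg A Q S N p₀ s ω) ∂μ‖ ≤ C * (t - s) ^ 2 := by
  have := h.isProbabilityMeasure
  have hS : ∀ j, (S j).PosSemidef := fun j => by
    rw [hSdef]; exact infoContribution_posSemidef (H j) (hR j)
  obtain ⟨C, hC0, hC⟩ := exists_increment_estimate (A := A) (H := H) h.nonneg hQ hR hp.inv
  obtain ⟨L, hL0, hL⟩ := h.schedule.exists_bound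
  set E := ∫ ω, (1 + ∑ j, (N j T ω : ℝ)) ^ 2 ∂μ with hE
  have hE0 : 0 ≤ E := integral_nonneg fun _ => sq_nonneg _
  -- `M L (t - s)` bounds the mean number of jumps, and the moment `E` at the final time dominates
  -- those at all earlier times.
  refine ⟨C * (E * (M * L) + (M * L) ^ 2), by positivity, fun s t hs hst ht => ?_⟩
  have hsm : s ∈ Icc 0 T := ⟨hs, hst.trans ht⟩
  have htm : t ∈ Icc 0 T := ⟨hs.trans hst, ht⟩
  have hXt := h.integrable_covPath (A := A) hQ hS hp htm
  have hXs := h.integrable_covPath (A := A) hQ hS hp hsm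
  have hly : Integrable (fun q : ℝ × Ω => A * covPath h.nonneg A Q S N p₀ q.1 q.2 +
      covPath h.nonneg A Q S N p₀ q.1 q.2 * Aᵀ + Q) ((volume.restrict (Ioc s t)).prod μ) :=
    (h.integrable_prod_lyapunov hQ hS hp).mono_measure (Measure.prod_mono (Measure.restrict_mono
      (Ioc_subset_Icc_self.trans (Icc_subset_Icc hs ht)) le_rfl) le_rfl)
  have hly1 : Integrable (fun ω => ∫ r in s..t, (A * covPath h.nonneg A Q S N p₀ r ω +
      covPath h.nonneg A Q S N p₀ r ω * Aᵀ + Q)) μ := by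
    simp only [intervalIntegral.integral_of_le hst]
    exact hly.integral_prod_right
  have hly2 : ∫ ω, (∫ r in s..t, (A * covPath h.nonneg A Q S N p₀ r ω +
      covPath h.nonneg A Q S N p₀ r ω * Aᵀ + Q)) ∂μ =
      ∫ r in s..t, (A * (∫ ω, covPath h.nonneg A Q S N p₀ r ω ∂μ) +
          (∫ ω, covPath h.nonneg A Q S N p₀ r ω ∂μ) * Aᵀ + Q) := by
    simp only [intervalIntegral.integral_of_le hst]
    refine (integral_integral_swap hly).symm.trans (setIntegral_congr_fun measurableSet_Ioc ?_)
    intro r hr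
    exact h.integral_lyapunov hQ hS hp ⟨hs.trans hr.1.le, hr.2.trans ht⟩
  have hj := fun j => h.integral_increment_smul_jumpMap (A := A) hQ hS hp hsm hst ht j (H j) (hR j)
  have hjs : Integrable (fun ω => ∑ j, ((N j t ω : ℝ) - N j s ω) •
      jumpMap (H j) (R j) (covPath h.nonneg A Q S N p₀ s ω)) μ :=
    integrable_finsetSum _ fun j _ => (hj j).1
  have i1 : Integrable (fun ω => covPath h.nonneg A Q S N p₀ t ω -
    covPath h.nonneg A Q S N p₀ s ω) μ := hXt.sub hXs
  have i2 : Integrable (fun ω => covPath h.nonneg A Q S N p₀ t ω -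
    covPath h.nonneg A Q S N p₀ s ω - ∫ r in s..t, (A * covPath h.nonneg A Q S N p₀ r ω +
      covPath h.nonneg A Q S N p₀ r ω * Aᵀ + Q)) μ := i1.sub hly1
  have e : (∫ ω, covPath h.nonneg A Q S N p₀ t ω ∂μ) -
      (∫ ω, covPath h.nonneg A Q S N p₀ s ω ∂μ) -
        (∫ r in s..t, (A * (∫ ω, covPath h.nonneg A Q S N p₀ r ω ∂μ) +
          (∫ ω, covPath h.nonneg A Q S N p₀ r ω ∂μ) * Aᵀ + Q)) +
        ∑ j, (∫ u in s..t, lam j u) •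
          ∫ ω, jumpMap (H j) (R j) (covPath h.nonneg A Q S N p₀ s ω) ∂μ =
      ∫ ω, (covPath h.nonneg A Q S N p₀ t ω - covPath h.nonneg A Q S N p₀ s ω -
        (∫ r in s..t, (A * covPath h.nonneg A Q S N p₀ r ω +
          covPath h.nonneg A Q S N p₀ r ω * Aᵀ + Q)) +
        ∑ j, ((N j t ω : ℝ) - N j s ω) •
          jumpMap (H j) (R j) (covPath h.nonneg A Q S N p₀ s ω)) ∂μ := by
    rw [integral_add i2 hjs, integral_sub i1 hly1, integral_sub hXt hXs, hly2,
      integral_finsetSum _ fun j _ => (hj j).1]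
    simp only [(hj _).2]
  obtain ⟨q1, q1'⟩ := h.integral_total_sq_mul_increment hsm hst ht
  obtain ⟨q2, q2'⟩ := h.integral_total_increment_mul_pred hs hst ht
  have hbound : ∀ᵐ ω ∂μ, ‖covPath h.nonneg A Q S N p₀ t ω - covPath h.nonneg A Q S N p₀ s ω -
        (∫ r in s..t, (A * covPath h.nonneg A Q S N p₀ r ω +
          covPath h.nonneg A Q S N p₀ r ω * Aᵀ + Q)) +
        ∑ j, ((N j t ω : ℝ) - N j s ω) •
          jumpMap (H j) (R j) (covPath h.nonneg A Q S N p₀ s ω)‖ ≤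
      C * ((t - s) * ((1 + ∑ j, (N j s ω : ℝ)) ^ 2 *
        (∑ j, (N j t ω : ℝ) - ∑ j, (N j s ω : ℝ))) +
        (∑ j, (N j t ω : ℝ) - ∑ j, (N j s ω : ℝ)) *
          (∑ j, (N j t ω : ℝ) - ∑ j, (N j s ω : ℝ) - 1)) := by
    filter_upwards [h.ae_regPaths_eq] with ω hω
    have hI := covPath_isInfoPath (A := A) h.nonneg hQ hS hp N ω
    rw [hSdef] at hI
    have key := hC _ (isStepPath_regPaths _ _) _ hI s t hs hst ht
    simp only [hω s hsm, hω t htm, ← hSdef] at key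
    have hinv : ∀ r ∈ Icc 0 T, (covPath h.nonneg A Q S N p₀ r ω)⁻¹⁻¹ =
        covPath h.nonneg A Q S N p₀ r ω := fun r hr =>
      (covPath_posDef h.nonneg hQ hS hp N ω hr).inv_inv'
    have hint : ∫ r in s..t, (A * (covPath h.nonneg A Q S N p₀ r ω)⁻¹⁻¹ +
        (covPath h.nonneg A Q S N p₀ r ω)⁻¹⁻¹ * Aᵀ + Q) =
        ∫ r in s..t, (A * covPath h.nonneg A Q S N p₀ r ω +
          covPath h.nonneg A Q S N p₀ r ω * Aᵀ + Q) :=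
      intervalIntegral.integral_congr fun r hr => by
        rw [uIcc_of_le hst] at hr
        simp only [hinv r ⟨hs.trans hr.1, hr.2.trans ht⟩]
    rw [hint, hinv s hsm, hinv t htm] at key
    refine key.trans (le_of_eq ?_)
    ring
  rw [e]
  have q3 := ((q1.const_mul (t - s)).add q2).const_mul C
  refine (norm_integral_le_of_norm_le q3 hbound).trans ?_
  simp only [Pi.add_apply]
  rw [integral_const_mul, integral_add (q1.const_mul _) q2, integral_const_mul, q1', q2']
  have hEs : ∫ ω, (1 + ∑ j, (N j s ω : ℝ)) ^ 2 ∂μ ≤ E := by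
    refine integral_mono_ae (h.integrable_total_sq hs hsm.2)
      (h.integrable_total_sq h.nonneg le_rfl) ?_
    filter_upwards [h.ae_le hs hsm.2 le_rfl] with ω hω
    have h1 : (0 : ℝ) ≤ ∑ j, (N j s ω : ℝ) := Finset.sum_nonneg fun _ _ => Nat.cast_nonneg _
    have h2 : ∑ j, (N j s ω : ℝ) ≤ ∑ j, (N j T ω : ℝ) :=
      Finset.sum_le_sum fun j _ => by exact_mod_cast hω j
    gcongr
  have hsum : ∑ j, ∫ u in s..t, lam j u ≤ M * L * (t - s) := by
    refine (Finset.sum_le_sum fun j _ => (hL j s t hs hst ht).2).trans ?_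
    simp [mul_assoc]
  have hsum0 : 0 ≤ ∑ j, ∫ u in s..t, lam j u :=
    Finset.sum_nonneg fun j _ => (hL j s t hs hst ht).1
  have hts : 0 ≤ t - s := sub_nonneg.2 hst
  calc _ ≤ C * ((t - s) * (E * (M * L * (t - s))) + (M * L * (t - s)) ^ 2) := by gcongr
    _ = _ := by ring

end IsPoissonFamily

end MeanCovariance

/-! ### From second-order increments to an integral equation -/

section SecondOrder

variable {E : Type*} [NormedAddCommGroup E] [NormedSpace ℝ E] [CompleteSpace E] {M : ℕ}

/-- A path whose increments agree, up to second order, with a drift and with rates that multiply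
right-continuous coefficients solves the corresponding integral equation. -/
theorem eq_add_integral_of_increment_le {T C K l : ℝ} {x f : ℝ → E} {lam : Fin M → ℝ → ℝ}
    {G : Fin M → ℝ → E} (hT : 0 ≤ T) (hC : 0 ≤ C) (hK : 0 ≤ K) (hl : 0 ≤ l)
    (hf : IntervalIntegrable f volume 0 T)
    (hlam : ∀ j, IntervalIntegrable (lam j) volume 0 T)
    (hlaml : ∀ j, ∀ᵐ t ∂volume.restrict (Icc 0 T), ‖lam j t‖ ≤ l)
    (hGc : ∀ j, ∀ t ∈ Ico 0 T, ContinuousWithinAt (G j) (Ici t) t)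
    (hGK : ∀ j, ∀ t ∈ Icc 0 T, ‖G j t‖ ≤ K)
    (hx : ∀ s t, 0 ≤ s → s ≤ t → t ≤ T → ‖x t - x s - (∫ r in s..t, f r) +
      ∑ j, (∫ u in s..t, lam j u) • G j s‖ ≤ C * (t - s) ^ 2) :
    IntervalIntegrable (fun r => f r - ∑ j, lam j r • G j r) volume 0 T ∧
    ∀ t ∈ Icc 0 T, x t = x 0 + ∫ r in (0 : ℝ)..t, (f r - ∑ j, lam j r • G j r) := by
  have hsub : ∀ {s t : ℝ}, s ∈ Icc 0 T → t ∈ Icc 0 T → uIcc s t ⊆ uIcc 0 T := fun hs ht => by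
    rw [uIcc_of_le hT]; exact uIcc_subset_Icc hs ht
  have h0 : (0 : ℝ) ∈ Icc 0 T := ⟨le_rfl, hT⟩
  have hGi : ∀ j, IntervalIntegrable (fun r => lam j r • G j r) volume 0 T := fun j => by
    have h1 := hlam j
    rw [intervalIntegrable_iff_integrableOn_Icc_of_le hT] at h1 ⊢
    refine (h1.norm.mul_const K).mono'
      (h1.aestronglyMeasurable.smul (aestronglyMeasurable_of_rightCont hT (hGc j))) ?_
    filter_upwards [ae_restrict_mem measurableSet_Icc] with r hr
    rw [norm_smul]
    exact mul_le_mul_of_nonneg_left (hGK j r hr) (norm_nonneg _)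
  have hGs : IntervalIntegrable (fun r => ∑ j, lam j r • G j r) volume 0 T := by
    simpa [Finset.sum_fn] using IntervalIntegrable.sum Finset.univ fun j _ => hGi j
  have hF : IntervalIntegrable (fun r => f r - ∑ j, lam j r • G j r) volume 0 T := hf.sub hGs
  refine ⟨hF, ?_⟩
  -- The rates are merely measurable, so `x` need not have a right derivative at every point. The
  -- defect `D` does: comparing integrals before differentiating cancels the rates, and what is left
  -- is small by right continuity of the coefficients. A continuous path with zero right derivative
  -- is constant.
  set D : ℝ → E := fun t => x t - ∫ r in (0 : ℝ)..t, (f r - ∑ j, lam j r • G j r) with hD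
  have hDincr : ∀ s t, 0 ≤ s → s ≤ t → t ≤ T → ∀ ε, 0 ≤ ε →
      (∀ u ∈ Ioc s t, ∀ j, ‖G j u - G j s‖ ≤ ε) →
      ‖D t - D s‖ ≤ C * (t - s) ^ 2 + M * l * ε * (t - s) := by
    intro s t hs hst ht ε hε hG
    have hsm : s ∈ Icc 0 T := ⟨hs, hst.trans ht⟩
    have htm : t ∈ Icc 0 T := ⟨hs.trans hst, ht⟩
    have hst' := hsub hsm htm
    have hterm : ∀ j, (∫ u in s..t, lam j u) • G j s - ∫ u in s..t, lam j u • G j u =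
        -∫ u in s..t, lam j u • (G j u - G j s) := fun j => by
      have h1 := (hGi j).mono_set hst'
      have h2 : IntervalIntegrable (fun u => lam j u • G j s) volume s t :=
        ⟨((hlam j).mono_set hst').1.smul_const _, ((hlam j).mono_set hst').2.smul_const _⟩
      rw [← intervalIntegral.integral_smul_const, ← neg_sub, ← intervalIntegral.integral_sub h1 h2]
      simp only [smul_sub]
    have e : D t - D s = (x t - x s - (∫ r in s..t, f r) + ∑ j, (∫ u in s..t, lam j u) • G j s) +
        ∑ j, ∫ u in s..t, lam j u • (G j u - G j s) := by
      have h1 : (∫ r in (0 : ℝ)..t, (f r - ∑ j, lam j r • G j r)) -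
          (∫ r in (0 : ℝ)..s, (f r - ∑ j, lam j r • G j r)) =
          (∫ r in s..t, f r) - ∑ j, ∫ r in s..t, lam j r • G j r := by
        rw [intervalIntegral.integral_interval_sub_left (hF.mono_set (hsub h0 htm))
          (hF.mono_set (hsub h0 hsm)), intervalIntegral.integral_sub (hf.mono_set hst')
          (hGs.mono_set hst'),
          intervalIntegral.integral_finsetSum fun j _ => (hGi j).mono_set hst']
      have h2 : ∑ j, (∫ u in s..t, lam j u) • G j s = ∑ j, ((∫ u in s..t, lam j u • G j u) -
          ∫ u in s..t, lam j u • (G j u - G j s)) :=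
        Finset.sum_congr rfl fun j _ => by rw [sub_eq_add_neg, ← hterm j]; abel
      rw [h2, Finset.sum_sub_distrib]
      calc D t - D s = x t - x s - ((∫ r in (0 : ℝ)..t, (f r - ∑ j, lam j r • G j r)) -
          (∫ r in (0 : ℝ)..s, (f r - ∑ j, lam j r • G j r))) := sub_sub_sub_comm _ _ _ _
        _ = _ := by rw [h1]; abel
    rw [e]
    refine (norm_add_le _ _).trans (add_le_add (hx s t hs hst ht) ((norm_sum_le _ _).trans ?_))
    have hj : ∀ j, ‖∫ u in s..t, lam j u • (G j u - G j s)‖ ≤ l * ε * (t - s) := fun j => by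
      have := intervalIntegral.norm_integral_le_of_norm_le_const_ae (a := s) (b := t)
        (f := fun u => lam j u • (G j u - G j s)) (C := l * ε) ?_
      · rwa [abs_of_nonneg (sub_nonneg.2 hst)] at this
      · have h1 := (ae_restrict_iff' measurableSet_Icc).1 (hlaml j)
        filter_upwards [h1] with u hu hum
        rw [uIoc_of_le hst] at hum
        rw [norm_smul]
        exact mul_le_mul (hu ⟨hs.trans hum.1.le, hum.2.trans ht⟩) (hG u hum j) (norm_nonneg _) hl
    refine (Finset.sum_le_sum fun j _ => hj j).trans (le_of_eq ?_)
    simp [mul_assoc]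
  have hDlip : ∀ s ∈ Icc 0 T, ∀ t ∈ Icc 0 T, s ≤ t →
      ‖D t - D s‖ ≤ (C * T + M * l * (2 * K)) * (t - s) := by
    intro s hs t ht hst
    refine (hDincr s t hs.1 hst ht.2 (2 * K) (by positivity) fun u hu j => ?_).trans ?_
    · refine (norm_sub_le _ _).trans ?_
      have h1 := hGK j u ⟨hs.1.trans hu.1.le, hu.2.trans ht.2⟩
      have h2 := hGK j s hs
      linarith
    · have h1 : 0 ≤ t - s := sub_nonneg.2 hst
      have h2 : t - s ≤ T := by linarith [hs.1, ht.2]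
      nlinarith [mul_nonneg hC h1, mul_le_mul_of_nonneg_left h2 (mul_nonneg hC h1)]
  have hDc : ContinuousOn D (Icc 0 T) := by
    have : LipschitzOnWith (Real.toNNReal (C * T + M * l * (2 * K))) D (Icc 0 T) := by
      refine LipschitzOnWith.of_dist_le_mul fun s hs t ht => ?_
      rw [Real.coe_toNNReal _ (by positivity)]
      rcases le_total s t with hst | hst
      · rw [dist_comm, dist_eq_norm, dist_comm, Real.dist_eq, abs_of_nonneg (sub_nonneg.2 hst)]
        exact hDlip s hs t ht hst
      · rw [dist_eq_norm, Real.dist_eq, abs_of_nonneg (sub_nonneg.2 hst)]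
        exact hDlip t ht s hs hst
    exact this.continuousOn
  have hDd : ∀ s ∈ Ico 0 T, HasDerivWithinAt D 0 (Ici s) s := by
    intro s hs
    rw [hasDerivWithinAt_iff_isLittleO, Asymptotics.isLittleO_iff]
    intro c hc
    -- The tolerance `c` is split in half: this choice controls the oscillation of the coefficients,
    -- and the restriction `t - s < c / (2 (C + 1))` below controls the quadratic error. The added
    -- ones avoid division by zero.
    have hε : 0 < c / (2 * (M * l + 1)) := by positivity
    have hnear : ∀ᶠ t in 𝓝[≥] s, ∀ j, ‖G j t - G j s‖ ≤ c / (2 * (M * l + 1)) := by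
      refine eventually_all.2 fun j => ?_
      have := (hGc j s hs).eventually (Metric.closedBall_mem_nhds _ hε)
      filter_upwards [this] with t ht
      rwa [← dist_eq_norm]
    obtain ⟨u, hu, hus⟩ := mem_nhdsGE_iff_exists_Ico_subset.1 hnear
    have hu' : s < u := hu
    filter_upwards [Ico_mem_nhdsGE (lt_min (lt_min hu' hs.2)
      (show s < s + c / (2 * (C + 1)) by linarith [show 0 < c / (2 * (C + 1)) by positivity]))]
      with t ht
    have ht1 : t < u := ht.2.trans_le ((min_le_left _ _).trans (min_le_left _ _))
    have ht2 : t < T := ht.2.trans_le ((min_le_left _ _).trans (min_le_right _ _))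
    have ht3 : t < s + c / (2 * (C + 1)) := ht.2.trans_le (min_le_right _ _)
    have hts : 0 ≤ t - s := sub_nonneg.2 ht.1
    rw [smul_zero, sub_zero, Real.norm_of_nonneg hts]
    refine (hDincr s t hs.1 ht.1 ht2.le _ hε.le fun v hv j =>
      hus ⟨hv.1.le, hv.2.trans_lt ht1⟩ j).trans ?_
    have e1 : C * (t - s) ≤ c / 2 := by
      have : t - s ≤ c / (2 * (C + 1)) := by linarith
      refine (mul_le_mul_of_nonneg_left this hC).trans ?_
      rw [mul_div_assoc', div_le_div_iff₀ (by positivity) (by positivity)]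
      nlinarith
    have e2 : M * l * (c / (2 * (M * l + 1))) ≤ c / 2 := by
      have : 0 ≤ M * l := by positivity
      rw [mul_div_assoc', div_le_div_iff₀ (by positivity) (by positivity)]
      nlinarith
    nlinarith [mul_le_mul_of_nonneg_right e1 hts, mul_le_mul_of_nonneg_right e2 hts]
  intro t ht
  have := constant_of_has_deriv_right_zero hDc hDd t ht
  simp only [hD, intervalIntegral.integral_same, sub_zero] at this
  rw [← this]; abel

end SecondOrder

/-! ### Jensen's inequality and the equation of the mean covariance -/

section MeanCovarianceEquation

open scoped Matrix.Norms.L2Operator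

variable {n M : ℕ} {m : Fin M → ℕ} {T : ℝ} {A Q : RMat n}
  {H : ∀ j, Matrix (Fin (m j)) (Fin n) ℝ} {R : ∀ j, Matrix (Fin (m j)) (Fin (m j)) ℝ}
  {S : Fin M → RMat n} {p₀ : RMat n}
  {Ω : Type*} [MeasurableSpace Ω] {μ : Measure Ω} {lam : Fin M → ℝ → ℝ} {N : Fin M → ℝ → Ω → ℕ}

theorem integral_jumpMinorant [IsProbabilityMeasure μ] {k : ℕ} (G : Matrix (Fin k) (Fin n) ℝ)
    (V : RMat k) (K : Matrix (Fin k) (Fin n) ℝ) {X : Ω → RMat n} (hX : Integrable X μ) :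
    Integrable (fun ω => jumpMinorant G V K (X ω)) μ ∧
      ∫ ω, jumpMinorant G V K (X ω) ∂μ = jumpMinorant G V K (∫ ω, X ω ∂μ) := by
  let L : RMat n →L[ℝ] RMat n := LinearMap.toContinuousLinearMap
    { toFun := fun P => (G * P)ᵀ * K + Kᵀ * (G * P) - Kᵀ * (G * P * Gᵀ) * K
      map_add' := fun P P' => by
        simp only [Matrix.mul_add, Matrix.add_mul, Matrix.transpose_add]
        abel
      map_smul' := fun c P => by
        simp [smul_add, smul_sub] }
  have hL : ∀ P, jumpMinorant G V K P = L P - Kᵀ * V * K := fun P => by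
    show _ = (G * P)ᵀ * K + Kᵀ * (G * P) - Kᵀ * (G * P * Gᵀ) * K - Kᵀ * V * K
    rw [jumpMinorant, Matrix.mul_add, Matrix.add_mul]
    abel
  simp only [hL]
  have h1 := L.integrable_comp hX
  refine ⟨h1.sub (integrable_const _), ?_⟩
  rw [integral_sub h1 (integrable_const _), L.integral_comp_comm hX]
  simp

/-- Jensen's inequality for the jump map, in the Loewner order. -/
theorem integral_jumpMap_sub_posSemidef [IsProbabilityMeasure μ] {k : ℕ}
    (G : Matrix (Fin k) (Fin n) ℝ) {V : RMat k} (hV : V.PosDef) {X : Ω → RMat n}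
    (hX : Integrable X μ) (hpos : ∀ ω, (X ω).PosSemidef)
    (hg : Integrable (fun ω => jumpMap G V (X ω)) μ) :
    ((∫ ω, jumpMap G V (X ω) ∂μ) - jumpMap G V (∫ ω, X ω ∂μ)).PosSemidef := by
  have hmean := posSemidef_integral hX (Eventually.of_forall hpos)
  set Z := ∫ ω, X ω ∂μ with hZ
  -- The gain is that of the mean `Z`: the corresponding affine map touches the jump map at `Z`,
  -- lies below it everywhere, and commutes with averaging.
  obtain ⟨h1, h2⟩ := integral_jumpMinorant G V ((G * Z * Gᵀ + V)⁻¹ * (G * Z)) hX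
  rw [← jumpMinorant_eq_jumpMap G hV hmean, ← h2, ← integral_sub hg h1]
  exact posSemidef_integral (hg.sub h1) (Eventually.of_forall fun ω =>
    jumpMap_sub_jumpMinorant_posSemidef G hV _ (hpos ω))

namespace IsPoissonFamily

variable (h : IsPoissonFamily μ T lam N) {t : ℝ}
include h

/-- Dominated convergence with the uniform bound on the covariance; this is the regularity of the
coefficients required by `eq_add_integral_of_increment_le`. -/
theorem mean_jumpMap_rightCont (hQ : Q.PosSemidef) (hS : ∀ j, (S j).PosSemidef) (hp : p₀.PosDef)
    {k : ℕ} (G : Matrix (Fin k) (Fin n) ℝ) {V : RMat k} (hV : V.PosDef) (ht : t ∈ Ico 0 T) :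
    ContinuousWithinAt
      (fun s => ∫ ω, jumpMap G V (covPath h.nonneg A Q S N p₀ s ω) ∂μ) (Ici t) t := by
  have := h.isProbabilityMeasure
  obtain ⟨C, hC0, hC⟩ := exists_norm_covPath_le (A := A) h.nonneg hQ hS hp N
  have hE := entryConst_nonneg n
  refine tendsto_integral_filter_of_dominated_convergence
    (fun _ => entryConst n * (‖traceCLM n‖ * C)) (Eventually.of_forall fun s => ?_) ?_
    (integrable_const _) (Eventually.of_forall fun ω => ?_)
  · exact (stronglyMeasurable_jumpMap G V
      (h.stronglyMeasurable_covPath A Q S p₀ s)).aestronglyMeasurable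
  · filter_upwards [Ico_mem_nhdsGE ht.2] with s hs
    have hsm : s ∈ Icc 0 T := ⟨ht.1.trans hs.1, hs.2.le⟩
    refine Eventually.of_forall fun ω =>
      (norm_jumpMap_le G hV (covPath_posDef h.nonneg hQ hS hp N ω hsm)).trans ?_
    have h1 := hC ω s hsm
    have h2 := ContinuousLinearMap.opNorm_nonneg (traceCLM n)
    exact mul_le_mul_of_nonneg_left (mul_le_mul_of_nonneg_left h1 h2) hE
  · exact ContinuousAt.comp_continuousWithinAt (g := jumpMap G V)
      (f := fun s => covPath h.nonneg A Q S N p₀ s ω) (continuousAt_jumpMap G hV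
      (covPath_posDef h.nonneg hQ hS hp N ω (Ico_subset_Icc_self ht)).posSemidef)
      (covPath_rightCont h.nonneg hQ hS hp N ω t ht)

/-- The Riccati equation of the mean covariance, corrected by the Jensen gap. -/
theorem solvesODE_mean_covariance (hQ : Q.PosSemidef) (hR : ∀ j, (R j).PosDef) (hp : p₀.PosDef)
    (hSdef : S = fun j => infoContribution (H j) (R j)) :
    SolvesODE T (fun t => ∫ ω, covPath h.nonneg A Q S N p₀ t ω ∂μ) fun t =>
      A * (∫ ω, covPath h.nonneg A Q S N p₀ t ω ∂μ) +
        (∫ ω, covPath h.nonneg A Q S N p₀ t ω ∂μ) * Aᵀ + Q -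
        ∑ j, lam j t • jumpMap (H j) (R j) (∫ ω, covPath h.nonneg A Q S N p₀ t ω ∂μ) -
        covJensenGap H R (fun j => lam j t)
          (fun j => ∫ ω, jumpMap (H j) (R j) (covPath h.nonneg A Q S N p₀ t ω) ∂μ)
          (∫ ω, covPath h.nonneg A Q S N p₀ t ω ∂μ) := by
  have := h.isProbabilityMeasure
  have hS : ∀ j, (S j).PosSemidef := fun j => by
    rw [hSdef]; exact infoContribution_posSemidef (H j) (hR j)
  have hE := entryConst_nonneg n
  have hτ := ContinuousLinearMap.opNorm_nonneg (traceCLM n)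
  obtain ⟨C, hC0, hC⟩ := h.mean_increment_estimate (A := A) hQ hR hp hSdef
  obtain ⟨B, hB0, hB⟩ := exists_norm_covPath_le (A := A) h.nonneg hQ hS hp N
  obtain ⟨l, hl0, hl⟩ := h.schedule.exists_ae_bound
  obtain ⟨h1, h2⟩ := eq_add_integral_of_increment_le
    (x := fun t => ∫ ω, covPath h.nonneg A Q S N p₀ t ω ∂μ) (lam := lam)
    (G := fun j t => ∫ ω, jumpMap (H j) (R j) (covPath h.nonneg A Q S N p₀ t ω) ∂μ)
    (K := entryConst n * (‖traceCLM n‖ * B)) h.nonneg hC0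
    (mul_nonneg hE (mul_nonneg hτ hB0)) hl0
    (h.intervalIntegrable_mean_lyapunov (A := A) hQ hS hp)
    (fun j => h.schedule.intervalIntegrable j ⟨le_rfl, h.nonneg⟩ ⟨h.nonneg, le_rfl⟩) hl
    (fun j t ht => h.mean_jumpMap_rightCont hQ hS hp (H j) (hR j) ht)
    (fun j t ht => by
      refine (norm_integral_le_of_norm_le (integrable_const (entryConst n * (‖traceCLM n‖ * B)))
        (Eventually.of_forall fun ω => (norm_jumpMap_le (H j) (hR j)
          (covPath_posDef h.nonneg hQ hS hp N ω ht)).trans (mul_le_mul_of_nonneg_left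
          (mul_le_mul_of_nonneg_left (hB ω t ht) hτ) hE))).trans (le_of_eq ?_)
      simp) hC
  refine solvesODE_of_eq_integral h.nonneg h1 h2 fun t _ => ?_
  simp only [covJensenGap, smul_sub, Finset.sum_sub_distrib]
  abel

/-- The Jensen gap of the covariance is positive semidefinite at nonnegative rates. -/
theorem covJensenGap_posSemidef (hQ : Q.PosSemidef) (hR : ∀ j, (R j).PosDef) (hp : p₀.PosDef)
    (hS : ∀ j, (S j).PosSemidef) (ht : t ∈ Icc 0 T) (hlam : ∀ j, 0 ≤ lam j t) :
    (covJensenGap H R (fun j => lam j t)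
      (fun j => ∫ ω, jumpMap (H j) (R j) (covPath h.nonneg A Q S N p₀ t ω) ∂μ)
      (∫ ω, covPath h.nonneg A Q S N p₀ t ω ∂μ)).PosSemidef := by
  have := h.isProbabilityMeasure
  refine Matrix.posSemidef_sum _ fun j _ => (integral_jumpMap_sub_posSemidef (H j) (hR j)
    (h.integrable_covPath hQ hS hp ht) (fun ω =>
      (covPath_posDef h.nonneg hQ hS hp N ω ht).posSemidef)
    (h.integrable_jumpMap_covPath hQ hS hp (H j) (hR j) ht)).smul (hlam j)

end IsPoissonFamily

end MeanCovarianceEquation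

/-! ### Conditioning on an independent initial value -/

section CondMean

variable {Ω β γ : Type*} [MeasurableSpace Ω] [MeasurableSpace β] [MeasurableSpace γ]
  {μ : Measure Ω} [IsProbabilityMeasure μ] {Z : Ω → β} {W : Ω → γ}

/-- The regular conditional law given `Z` of a function of `Z` and an independent variable `W`. -/
theorem condDistrib_of_indepFun_comp {X : Ω → ℝ} {f : β × γ → ℝ} (hZ : Measurable Z)
    (hW : Measurable W) (hind : IndepFun Z W μ) (hf : Measurable f)
    (hX : X =ᵐ[μ] fun ω => f (Z ω, W ω)) :
    ∀ᵐ ω ∂μ, condDistrib X Z μ (Z ω) = μ.map fun ω' => f (Z ω, W ω') := by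
  have := Measure.isProbabilityMeasure_map (μ := μ) hW.aemeasurable
  have hfz : ∀ z, Measurable fun w => f (z, w) := fun z => hf.comp measurable_prodMk_left
  -- The candidate sends `z` to the law of `f (z, W)`. By independence it disintegrates the joint
  -- law of `Z` and `X`, and disintegrations are almost everywhere unique.
  let κ : Kernel β ℝ := (Kernel.id ×ₖ Kernel.const β (μ.map W)).map f
  have hκ : ∀ z, κ z = (μ.map W).map fun w => f (z, w) := fun z => by
    rw [Kernel.map_apply _ hf, Kernel.prod_apply, Kernel.id_apply, Kernel.const_apply,
      Measure.dirac_prod, Measure.map_map hf measurable_prodMk_left]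
    rfl
  have : IsMarkovKernel κ := Kernel.IsMarkovKernel.map _ hf
  have hfm : AEMeasurable X μ := ((hf.comp (hZ.prodMk hW)).aemeasurable).congr hX.symm
  have key : condDistrib X Z μ =ᵐ[μ.map Z] κ := by
    refine condDistrib_ae_eq_of_measure_eq_compProd Z hfm ?_
    have h1 : μ.map (fun ω => (Z ω, X ω)) = μ.map fun ω => (Z ω, f (Z ω, W ω)) :=
      Measure.map_congr (hX.mono fun ω hω => congrArg (Prod.mk (Z ω)) hω)
    have hg : Measurable fun q : β × γ => (q.1, f q) := measurable_fst.prodMk hf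
    have h2 : μ.map (fun ω => (Z ω, f (Z ω, W ω))) =
        ((μ.map Z).prod (μ.map W)).map fun q => (q.1, f q) := by
      rw [← (indepFun_iff_map_prod_eq_prod_map_map hZ.aemeasurable hW.aemeasurable).1 hind,
        Measure.map_map hg (hZ.prodMk hW)]
      rfl
    rw [h1, h2]
    ext s hs
    rw [Measure.map_apply hg hs, Measure.prod_apply (hg hs), Measure.compProd_apply hs]
    refine lintegral_congr fun z => ?_
    rw [hκ, Measure.map_apply (hfz z) (measurable_prodMk_left hs)]
    rfl
  filter_upwards [ae_of_ae_map hZ.aemeasurable key] with ω hω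
  rw [hω, hκ, Measure.map_map (hfz _) hW]
  rfl

open scoped Matrix.Norms.L2Operator in
/-- The conditional mean given `Z` of a function of `Z` and an independent variable `W` is obtained
by integrating over `W`. -/
theorem isCondMean_of_indepFun {n : ℕ} {X : Ω → RMat n} {F : β × γ → RMat n} (hZ : Measurable Z)
    (hW : Measurable W) (hind : IndepFun Z W μ) (hF : StronglyMeasurable F)
    (hX : X =ᵐ[μ] fun ω => F (Z ω, W ω))
    (hint : ∀ᵐ ω ∂μ, Integrable (fun ω' => F (Z ω, W ω')) μ) :
    IsCondMean μ X Z fun ω => ∫ ω', F (Z ω, W ω') ∂μ := by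
  intro a b
  have hFab : Measurable fun q => F q a b :=
    ((entryCLM a b).continuous.comp_stronglyMeasurable hF).measurable
  have hW' : Measurable fun q : β × Ω => (q.1, W q.2) :=
    measurable_fst.prodMk (hW.comp measurable_snd)
  have hm : StronglyMeasurable fun z => ∫ ω', F (z, W ω') ∂μ :=
    (hF.comp_measurable hW').integral_prod_right'
  refine ⟨?_, ?_⟩
  · exact ((entryCLM a b).continuous.comp_stronglyMeasurable hm).measurable.comp
      (comap_measurable Z)
  · filter_upwards [hint, condDistrib_of_indepFun_comp (X := fun ω => X ω a b) hZ hW hind hFab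
      (hX.mono fun ω hω => congrArg (fun Y : RMat n => Y a b) hω)] with ω h1 h2
    have hg : Measurable fun ω' => F (Z ω, W ω') a b :=
      hFab.comp (measurable_const.prodMk hW)
    rw [h2]
    refine ⟨(integrable_map_measure aestronglyMeasurable_id hg.aemeasurable).2
      ((entryCLM a b).integrable_comp h1), ?_⟩
    exact (integral_matrix_apply h1 a b).trans
      (integral_map hg.aemeasurable aestronglyMeasurable_id).symm

end CondMean

/-! ### Identification of the filter and its conditional means -/

section Filtering

open scoped Matrix.Norms.L2Operator

variable {n M : ℕ} {m : Fin M → ℕ} {T : ℝ} {A Q : RMat n}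
  {H : ∀ j, Matrix (Fin (m j)) (Fin n) ℝ} {R : ∀ j, Matrix (Fin (m j)) (Fin (m j)) ℝ}
  {S : Fin M → RMat n}

/-- The covariance equation sees the counting paths on `[0, T]` only. -/
theorem IsCovariancePath.congr {k k' : Fin M → ℝ → ℕ} {p : ℝ → RMat n}
    (h : IsCovariancePath T A Q H R k p) (hk' : IsStepPath k')
    (hkk' : ∀ t ∈ Icc 0 T, ∀ j, k' j t = k j t) : IsCovariancePath T A Q H R k' p where
  rightCont := h.rightCont
  leftLimit := h.leftLimit
  equation t ht := by
    rw [h.equation t ht]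
    congr 1
    refine Finset.sum_congr rfl fun j _ => finsum_congr fun s => finsum_congr fun hs => ?_
    have hsT : s ∈ Icc 0 T := ⟨hs.1.le, hs.2.trans ht.2⟩
    obtain ⟨l, -, hl⟩ := hk'.left s
    have hl' : ∀ᶠ r in 𝓝[<] s, k j r = l j := by
      filter_upwards [hl, Ico_mem_nhdsLT hs.1] with r hr hrs
      rw [← hkk' r ⟨hrs.1, hrs.2.le.trans hsT.2⟩ j, hr j]
    rw [countJump_eq (hl.mono fun r hr => hr j), countJump_eq hl', hkk' s hsT j]

/-- The entries of the inverse matrix. -/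
noncomputable def invEntries (z : Fin n → Fin n → ℝ) : Fin n → Fin n → ℝ :=
  fun a b => (Matrix.of z : RMat n)⁻¹ a b

theorem measurable_invEntries : Measurable (invEntries (n := n)) := by
  have h0 : Continuous fun z : Fin n → Fin n → ℝ => (Matrix.of z : RMat n) :=
    continuous_matrix fun a b => (continuous_apply b).comp (continuous_apply a)
  have h1 := h0.stronglyMeasurable.matrix_inv
  exact measurable_pi_iff.2 fun a => measurable_pi_iff.2 fun b =>
    ((entryCLM a b).continuous.comp_stronglyMeasurable h1).measurable

variable {Ω : Type*} [MeasurableSpace Ω] {μ : Measure Ω} {lam : Fin M → ℝ → ℝ}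
  {N : Fin M → ℝ → Ω → ℕ} {P Y : ℝ → Ω → Matrix (Fin n) (Fin n) ℝ}

namespace IsPoissonFamily

variable (h : IsPoissonFamily μ T lam N)
include h

/-- Pathwise uniqueness: the covariance process of the filter is the model process started from its
initial value. -/
theorem ae_eq_covPath (hQ : Q.PosSemidef) (hR : ∀ j, (R j).PosDef)
    (hSdef : S = fun j => infoContribution (H j) (R j)) (hP0 : ∀ᵐ ω ∂μ, (P 0 ω).PosDef)
    (hP : ∀ᵐ ω ∂μ, IsCovariancePath T A Q H R (fun j t => N j t ω) (fun t => P t ω)) :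
    ∀ᵐ ω ∂μ, ∀ t ∈ Icc 0 T, P t ω = covPath h.nonneg A Q S N (P 0 ω) t ω := by
  have hS : ∀ j, (S j).PosSemidef := fun j => by
    rw [hSdef]; exact infoContribution_posSemidef (H j) (hR j)
  filter_upwards [hP0, hP, h.ae_regPaths_eq, h.ae_simple_jumps,
    ae_all_iff.2 fun j => (h.poisson j).zero] with ω hp hcov hreg hsimple hzero t ht
  have hk := isStepPath_regPaths h.nonneg (pathMap T N ω)
  -- Regularized and original counts agree on `[0, T]` almost surely, so the inverse of the given
  -- process and the inverse of the model process solve the same information equation from the same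
  -- initial value.
  have h1 := (hcov.congr hk hreg).isInfoPath_inv hQ hR hk
    (fun j => by rw [hreg 0 ⟨le_rfl, h.nonneg⟩ j, hzero j])
    (fun t ht s hs hc => by
      have hmem : ∀ r ∈ Icc s t, r ∈ Icc 0 T := fun r hr => ⟨hs.1.trans hr.1, hr.2.trans ht.2⟩
      have hsm := hmem s ⟨le_rfl, hs.2.le⟩
      have := hsimple t ht s hs fun r hr j => by
        have := hc r hr j
        rwa [hreg r (hmem r ⟨hr.1, hr.2.le⟩) j, hreg s hsm j] at this
      refine le_trans (le_of_eq (Finset.sum_congr rfl fun j _ => ?_)) this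
      rw [hreg t (hmem t ⟨hs.2.le, le_rfl⟩) j, hreg s hsm j]) hp h.nonneg
  rw [← hSdef] at h1
  have h2 := covPath_isInfoPath (A := A) h.nonneg hQ hS hp N ω
  have hinv := h1.unique hQ hS hk h2 t ht
  rw [← (h1.posDef t ht).of_inv.inv_inv', hinv, (h2.posDef t ht).of_inv.inv_inv']

/-- The conditional means of the filter solve the Riccati equations corrected by the Jensen gaps. -/
theorem exists_conditional_means (hQ : Q.PosSemidef) (hR : ∀ j, (R j).PosDef)
    (hPmeas : ∀ a b, Measurable (fun ω => P 0 ω a b)) (hP0 : ∀ᵐ ω ∂μ, (P 0 ω).PosDef)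
    (hP0ind : IndepFun (fun ω a b => P 0 ω a b) (pathMap T N) μ)
    (hP : ∀ᵐ ω ∂μ, IsCovariancePath T A Q H R (fun j t => N j t ω) (fun t => P t ω))
    (hY : ∀ t ω, Y t ω = (P t ω)⁻¹) [IsProbabilityMeasure μ] :
    ∃ (Ybar Pbar YQYbar : ℝ → Ω → Matrix (Fin n) (Fin n) ℝ)
      (gbar : Fin M → ℝ → Ω → Matrix (Fin n) (Fin n) ℝ),
      (∀ t ∈ Icc 0 T,
        IsCondMean μ (Y t) (fun ω a b => Y 0 ω a b) (Ybar t) ∧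
        IsCondMean μ (P t) (fun ω a b => P 0 ω a b) (Pbar t) ∧
        IsCondMean μ (fun ω => Y t ω * Q * Y t ω) (fun ω a b => Y 0 ω a b) (YQYbar t) ∧
        ∀ j, IsCondMean μ (fun ω => jumpMap (H j) (R j) (P t ω))
          (fun ω a b => P 0 ω a b) (gbar j t)) ∧
      ∀ᵐ ω ∂μ,
        SolvesODE T (fun t => Ybar t ω) (fun t =>
          -(Ybar t ω * A) - Aᵀ * Ybar t ω - Ybar t ω * Q * Ybar t ω
            + ∑ j, lam j t • infoContribution (H j) (R j) -
            infoJensenGap Q (YQYbar t ω) (Ybar t ω)) ∧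
        SolvesODE T (fun t => Pbar t ω) (fun t =>
          A * Pbar t ω + Pbar t ω * Aᵀ + Q
            - ∑ j, lam j t • jumpMap (H j) (R j) (Pbar t ω) -
            covJensenGap H R (fun j => lam j t) (fun j => gbar j t ω) (Pbar t ω)) ∧
        (∀ t ∈ Icc 0 T, (infoJensenGap Q (YQYbar t ω) (Ybar t ω)).PosSemidef) ∧
        (∀ t ∈ Icc 0 T, (∀ j, 0 ≤ lam j t) → (covJensenGap H R (fun j => lam j t)
          (fun j => gbar j t ω) (Pbar t ω)).PosSemidef) := by
  obtain ⟨S, hSdef⟩ : ∃ S : Fin M → RMat n, S = fun j => infoContribution (H j) (R j) := ⟨_, rfl⟩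
  have hS : ∀ j, (S j).PosSemidef := fun j => by
    rw [hSdef]; exact infoContribution_posSemidef (H j) (hR j)
  have hZ : Measurable fun ω a b => P 0 ω a b :=
    measurable_pi_iff.2 fun a => measurable_pi_iff.2 fun b => hPmeas a b
  -- The initial information is a measurable function of the initial covariance, so it inherits
  -- independence from the counting paths.
  have hYZ : (fun ω a b => Y 0 ω a b) = fun ω => invEntries fun a b => P 0 ω a b := by
    funext ω a b
    rw [hY]; rfl
  have hZY : Measurable fun ω a b => Y 0 ω a b := by
    rw [hYZ]; exact measurable_invEntries.comp hZ
  have hindY : IndepFun (fun ω a b => Y 0 ω a b) (pathMap T N) μ := by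
    rw [hYZ]; exact hP0ind.comp measurable_invEntries measurable_id
  have hW := h.measurable_pathMap
  have hae := h.ae_eq_covPath (A := A) hQ hR hSdef hP0 hP
  have hF := fun t => stronglyMeasurable_covSolution (M := M) h.nonneg A Q S t
  have hFY : ∀ t, StronglyMeasurable
      fun q : (Fin n → Fin n → ℝ) × (Fin M → Icc (0 : ℝ) T → ℕ) =>
        (covSolution A Q S (regPaths h.nonneg q.2) (Matrix.of (invEntries q.1)) t)⁻¹ := fun t => by
    have hm : Measurable fun q : (Fin n → Fin n → ℝ) × (Fin M → Icc (0 : ℝ) T → ℕ) =>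
        (invEntries q.1, q.2) := (measurable_invEntries.comp measurable_fst).prodMk measurable_snd
    exact ((hF t).comp_measurable hm).matrix_inv
  have hYQ : ∀ t, StronglyMeasurable
      fun q : (Fin n → Fin n → ℝ) × (Fin M → Icc (0 : ℝ) T → ℕ) =>
        (covSolution A Q S (regPaths h.nonneg q.2) (Matrix.of (invEntries q.1)) t)⁻¹ * Q *
        (covSolution A Q S (regPaths h.nonneg q.2) (Matrix.of (invEntries q.1)) t)⁻¹ := fun t =>
    (show Continuous fun X : RMat n => X * Q * X by fun_prop).comp_stronglyMeasurable (hFY t)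
  -- Almost surely `P(0)` is recovered from `Y(0)`. The means given `Y(0)` are therefore written in
  -- terms of `Y(0)⁻¹`, which makes them measurable with respect to `Y(0)` everywhere.
  have hinv : ∀ᵐ ω ∂μ, (Y 0 ω)⁻¹ = P 0 ω := hP0.mono fun ω hω => by rw [hY, hω.inv_inv']
  have hYae : ∀ᵐ ω ∂μ, ∀ t ∈ Icc 0 T,
      Y t ω = (covPath h.nonneg A Q S N (Y 0 ω)⁻¹ t ω)⁻¹ := by
    filter_upwards [hae, hinv] with ω h1 h2 t ht
    rw [h2, hY, ← h1 t ht]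
  -- The versions are obtained by freezing the initial value at `ω` and averaging over the noise
  -- `ω'` alone. A single null set then serves all times simultaneously in the differential
  -- equations.
  refine ⟨fun t ω => ∫ ω', (covPath h.nonneg A Q S N (Y 0 ω)⁻¹ t ω')⁻¹ ∂μ,
    fun t ω => ∫ ω', covPath h.nonneg A Q S N (P 0 ω) t ω' ∂μ,
    fun t ω => ∫ ω', (covPath h.nonneg A Q S N (Y 0 ω)⁻¹ t ω')⁻¹ * Q *
      (covPath h.nonneg A Q S N (Y 0 ω)⁻¹ t ω')⁻¹ ∂μ,
    fun j t ω => ∫ ω', jumpMap (H j) (R j) (covPath h.nonneg A Q S N (P 0 ω) t ω') ∂μ,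
    fun t ht => ⟨?_, ?_, ?_, fun j => ?_⟩, ?_⟩
  · refine isCondMean_of_indepFun hZY hW hindY (hFY t) (hYae.mono fun ω hω => hω t ht) ?_
    filter_upwards [hP0, hinv] with ω hp h1
    have := h.integrable_covPath_inv (A := A) hQ hS hp ht
    rw [← h1] at this
    exact this
  · refine isCondMean_of_indepFun hZ hW hP0ind (hF t) (hae.mono fun ω hω => hω t ht) ?_
    filter_upwards [hP0] with ω hp
    exact h.integrable_covPath (A := A) hQ hS hp ht
  · refine isCondMean_of_indepFun hZY hW hindY (hYQ t) (hYae.mono fun ω hω => ?_) ?_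
    · exact congrArg (fun X : RMat n => X * Q * X) (hω t ht)
    · filter_upwards [hP0, hinv] with ω hp h1
      have := h.integrable_covPath_inv_quadratic (A := A) hQ hS hp Q ht
      rw [← h1] at this
      exact this
  · refine isCondMean_of_indepFun hZ hW hP0ind (stronglyMeasurable_jumpMap (H j) (R j) (hF t))
      (hae.mono fun ω hω => congrArg (jumpMap (H j) (R j)) (hω t ht)) ?_
    filter_upwards [hP0] with ω hp
    exact h.integrable_jumpMap_covPath (A := A) hQ hS hp (H j) (hR j) ht
  · filter_upwards [hP0, hinv] with ω hp h1
    have e1 := h.solvesODE_mean_information (A := A) hQ hS hp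
    have e2 := fun t (ht : t ∈ Icc 0 T) => h.infoJensenGap_posSemidef (A := A) hQ hS hp ht
    rw [← h1] at e1 e2
    rw [hSdef] at e1 e2 ⊢
    have e3 := h.solvesODE_mean_covariance (A := A) hQ hR hp hSdef
    rw [hSdef] at e3
    exact ⟨e1, e3, e2, fun t ht hl => h.covJensenGap_posSemidef (A := A) hQ hR hp
      (fun j => infoContribution_posSemidef (H j) (hR j)) ht hl⟩

end IsPoissonFamily

end Filtering

theorem mainTheorem4 {n M : ℕ} {m : Fin M → ℕ} {Ω : Type*} [MeasurableSpace Ω]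
    (μ : Measure Ω) [IsProbabilityMeasure μ] (T : ℝ) (hT : 0 < T)
    (A Q : Matrix (Fin n) (Fin n) ℝ) (hQ : Q.PosSemidef)
    (H : ∀ j, Matrix (Fin (m j)) (Fin n) ℝ) (R : ∀ j, Matrix (Fin (m j)) (Fin (m j)) ℝ)
    (hR : ∀ j, (R j).PosDef)
    (lam : Fin M → ℝ → ℝ) (hlam : IsSchedule T lam)
    (N : Fin M → ℝ → Ω → ℕ) (hN : ∀ j, IsPoissonProcess μ T (lam j) (N j))
    (hNind : iIndepFun (fun j ω (t : Icc (0 : ℝ) T) => N j t ω) μ)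
    (P Y : ℝ → Ω → Matrix (Fin n) (Fin n) ℝ)
    (hPmeas : ∀ t ∈ Icc 0 T, ∀ a b, Measurable (fun ω => P t ω a b))
    (hP0 : ∀ᵐ ω ∂μ, (P 0 ω).PosDef)
    (hP0ind : IndepFun (fun ω a b => P 0 ω a b) (fun ω j (t : Icc (0 : ℝ) T) => N j t ω) μ)
    (hP : ∀ᵐ ω ∂μ, IsCovariancePath T A Q H R (fun j t => N j t ω) (fun t => P t ω))
    (hY : ∀ t ω, Y t ω = (P t ω)⁻¹)
    (hmom : ∀ t ∈ Icc 0 T, CondMeanFinite μ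
      (fun ω => frobNorm (Y t ω) ^ 2 + frobNorm (P t ω)) (fun ω a b => Y 0 ω a b)) :
    ∃ (Ybar Pbar YQYbar : ℝ → Ω → Matrix (Fin n) (Fin n) ℝ)
      (gbar : Fin M → ℝ → Ω → Matrix (Fin n) (Fin n) ℝ)
      (DeltaY DeltaP : ℝ → Ω → Matrix (Fin n) (Fin n) ℝ),
      (∀ t ∈ Icc 0 T,
        IsCondMean μ (Y t) (fun ω a b => Y 0 ω a b) (Ybar t) ∧
        IsCondMean μ (P t) (fun ω a b => P 0 ω a b) (Pbar t) ∧
        IsCondMean μ (fun ω => Y t ω * Q * Y t ω) (fun ω a b => Y 0 ω a b) (YQYbar t) ∧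
        ∀ j, IsCondMean μ (fun ω => jumpMap (H j) (R j) (P t ω))
          (fun ω a b => P 0 ω a b) (gbar j t)) ∧
      (∀ t ω, DeltaY t ω = infoJensenGap Q (YQYbar t ω) (Ybar t ω)) ∧
      (∀ t ω, DeltaP t ω =
        covJensenGap H R (fun j => lam j t) (fun j => gbar j t ω) (Pbar t ω)) ∧
      ∀ᵐ ω ∂μ,
        SolvesODE T (fun t => Ybar t ω) (fun t =>
          -(Ybar t ω * A) - Aᵀ * Ybar t ω - Ybar t ω * Q * Ybar t ω
            + ∑ j, lam j t • infoContribution (H j) (R j) - DeltaY t ω) ∧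
        SolvesODE T (fun t => Pbar t ω) (fun t =>
          A * Pbar t ω + Pbar t ω * Aᵀ + Q
            - ∑ j, lam j t • jumpMap (H j) (R j) (Pbar t ω) - DeltaP t ω) ∧
        (∀ t ∈ Icc 0 T, (DeltaY t ω).PosSemidef) ∧
        (∀ t ∈ Icc 0 T, (∀ j, 0 ≤ lam j t) → (DeltaP t ω).PosSemidef) := by
  obtain ⟨Ybar, Pbar, YQYbar, gbar, hmean, hae⟩ :=
    (IsPoissonFamily.mk hT.le hlam hN hNind).exists_conditional_means (A := A) (Y := Y) hQ hR
      (hPmeas 0 ⟨le_rfl, hT.le⟩) hP0 hP0ind hP hY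
  exact ⟨Ybar, Pbar, YQYbar, gbar, fun t ω => infoJensenGap Q (YQYbar t ω) (Ybar t ω),
    fun t ω => covJensenGap H R (fun j => lam j t) (fun j => gbar j t ω) (Pbar t ω), hmean,
    fun _ _ => rfl, fun _ _ => rfl, hae⟩
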